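/- In static online bin covering, items with sizes in $(0,1]$ arrive one by one (there are no departures), and after each arrival all items that have arrived must be partitioned into bins; reassigning earlier items is allowed. A bin is covered if the total size of its items is at least $1$. For an instance $I$ (the sequence of sizes of the items that have arrived so far), let $\mathrm{OPT}(I)$ be the maximum number of bins that a partition of its items can cover, and $\mathrm{ALG}(I)$ the number of bins covered by the solution that an online algorithm $\mathrm{ALG}$ maintains after the items of $I$ have arrived. **Theorem.** There is a polynomial-time algorithm $\mathrm{ALG}$ for static online bin covering, which is given in addition a parameter $\varepsilon$, such that for each $\varepsilon\in(0,0.5]$: 1. (asymptotic competitive ratio $1.5+\varepsilon$ with additive constant $3$) $\mathrm{OPT}(I)\le(1.5+\varepsilon)\,\mathrm{ALG}(I)+3$ for every instance $I$, that is, after each arrival; 2. (non-amortized migration factor $27/\varepsilon=O(1/\varepsilon)$) whenever an item of size $s$ arrives, the total size of the previously arrived items that are reassigned to another bin is at most $\frac{27}{\varepsilon}s$. Polynomial time means: there is one program for a real RAM (indexed memory of natural and real numbers; unit-cost addition, subtraction, comparison and indirect addressing; no multiplication or rounding; no real constant other than $1$) and one polynomial $p$, independent of $\varepsilon$, such that on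 input $\varepsilon$ and any instance $I$ with $n$ items the program halts after at most $p(n)$ steps and outputs the bin of each item in the solution that $\mathrm{ALG}$ maintains for $I$. -/

import Mathlib

namespace BinCovering

/-! ## Bin covering

An instance of static online bin covering is the list `I` of the sizes of the items that have
arrived so far, in order of arrival; the items are the positions `0, …, I.length - 1`.
A solution sends each item to the index of its bin and is given as a function `P : ℕ → ℕ`, of which
only the values at the items are ever used. -/

/-- All item sizes lie in `(0, 1]`. -/
def IsInstance (I : List ℝ) : Prop := ∀ x ∈ I, 0 < x ∧ x ≤ 1

/-- The size of item `i` (used for `i < I.length` only). -/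
def size (I : List ℝ) (i : ℕ) : ℝ := I.getD i 0

/-- The load of bin `k`: the total size of the items packed into it. -/
noncomputable def load (I : List ℝ) (P : ℕ → ℕ) (k : ℕ) : ℝ :=
  ∑ i ∈ (Finset.range I.length).filter (fun i => P i = k), size I i

open Classical in
/-- The number of covered bins, that is of bins of load at least `1`. -/
noncomputable def numCovered (I : List ℝ) (P : ℕ → ℕ) : ℕ :=
  (((Finset.range I.length).image P).filter (fun k => 1 ≤ load I P k)).card

/-- There are at most as many covered bins as items. -/
theorem numCovered_le_length (I : List ℝ) (P : ℕ → ℕ) : numCovered I P ≤ I.length := by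
  unfold numCovered
  exact (Finset.card_filter_le _ _).trans (Finset.card_image_le.trans (by simp))

/-- The maximum number of bins that a solution can cover. -/
noncomputable def opt (I : List ℝ) : ℕ := sSup (Set.range (numCovered I))

/-- `opt I` is the number of bins covered by an optimal solution. -/
theorem isGreatest_opt (I : List ℝ) : IsGreatest (Set.range (numCovered I)) (opt I) := by
  have hb : BddAbove (Set.range (numCovered I)) := by
    refine ⟨I.length, ?_⟩
    rintro _ ⟨P, rfl⟩
    exact numCovered_le_length I P
  exact ⟨Nat.sSup_mem (Set.range_nonempty _) hb, fun m hm => le_csSup hb hm⟩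

/-- The total size of the items of `I` that are reassigned when the solution `P` is replaced
by `Q`. -/
noncomputable def migrated (I : List ℝ) (P Q : ℕ → ℕ) : ℝ :=
  ∑ i ∈ (Finset.range I.length).filter (fun i => P i ≠ Q i), size I i

/-! A (deterministic) online algorithm `A` maintains the solution `A I` after the items of `I` have
arrived, for each `I`. -/

/-- `A` has asymptotic competitive ratio `α` with additive constant `c`: the performance guarantee
holds after each arrival. -/
def HasCompetitiveRatio (A : List ℝ → ℕ → ℕ) (α c : ℝ) : Prop :=
  ∀ I : List ℝ, IsInstance I → (opt I : ℝ) ≤ α * (numCovered I (A I) : ℝ) + c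

/-- `A` has non-amortized migration factor `β`: on the arrival of an item of size `x`, previously
arrived items of total size at most `β * x` are reassigned. -/
def HasMigrationFactor (A : List ℝ → ℕ → ℕ) (β : ℝ) : Prop :=
  ∀ (I : List ℝ) (x : ℝ), IsInstance (I ++ [x]) →
    migrated I (A I) (A (I ++ [x])) ≤ β * x

/-! ## The machine model

Item sizes are real numbers, so the model is a real RAM. Its memory consists of arrays of natural
numbers and arrays of real numbers, with computed (indirect) indices. The arithmetic operations are
addition, subtraction and comparison. There is no multiplication, no rounding, and no real constant
other than `1`, so numbers grow by at most a factor of two per step and a polynomial number of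
steps is polynomial time in the bit model as well when the inputs are rational. Programs are
structured (sequence, conditional, while loop). Each evaluated node of an expression and
each executed instruction or test costs one step. -/

/-- A memory: entry `i` of the array number `a` of natural numbers is `nat a i`, and entry `i` of
the array number `a` of real numbers is `real a i`. -/
structure Memory where
  nat : ℕ → ℕ → ℕ
  real : ℕ → ℕ → ℝ

/-- Expressions with values in the natural numbers; subtraction is truncated. -/
inductive NatExpr where
  | const (n : ℕ)
  | get (a : ℕ) (i : NatExpr)
  | add (e f : NatExpr)
  | sub (e f : NatExpr)

/-- Expressions with values in the real numbers. -/
inductive RealExpr where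
  | one
  | get (a : ℕ) (i : NatExpr)
  | add (e f : RealExpr)
  | sub (e f : RealExpr)

/-- Tests. -/
inductive BoolExpr where
  | natLe (e f : NatExpr)
  | realLe (e f : RealExpr)
  | not (b : BoolExpr)
  | and (b c : BoolExpr)

/-- Programs. `setNat a i e` assigns the value of `e` to entry `i` of the array number `a` of
natural numbers, and `setReal` does so for real numbers. -/
inductive Program where
  | skip
  | setNat (a : ℕ) (i e : NatExpr)
  | setReal (a : ℕ) (i : NatExpr) (e : RealExpr)
  | seq (c d : Program)
  | ite (b : BoolExpr) (c d : Program)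
  | loop (b : BoolExpr) (c : Program)

/-- The value of an expression. -/
def NatExpr.eval (m : Memory) : NatExpr → ℕ
  | .const n => n
  | .get a i => m.nat a (i.eval m)
  | .add e f => e.eval m + f.eval m
  | .sub e f => e.eval m - f.eval m

/-- The number of steps needed to evaluate an expression. -/
def NatExpr.cost : NatExpr → ℕ
  | .const _ => 1
  | .get _ i => i.cost + 1
  | .add e f => e.cost + f.cost + 1
  | .sub e f => e.cost + f.cost + 1

/-- The value of an expression. -/
noncomputable def RealExpr.eval (m : Memory) : RealExpr → ℝ
  | .one => 1
  | .get a i => m.real a (i.eval m)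
  | .add e f => e.eval m + f.eval m
  | .sub e f => e.eval m - f.eval m

/-- The number of steps needed to evaluate an expression. -/
def RealExpr.cost : RealExpr → ℕ
  | .one => 1
  | .get _ i => i.cost + 1
  | .add e f => e.cost + f.cost + 1
  | .sub e f => e.cost + f.cost + 1

/-- The truth of a test. -/
def BoolExpr.Holds (m : Memory) : BoolExpr → Prop
  | .natLe e f => e.eval m ≤ f.eval m
  | .realLe e f => e.eval m ≤ f.eval m
  | .not b => ¬ b.Holds m
  | .and b c => b.Holds m ∧ c.Holds m

/-- The number of steps needed to evaluate a test. -/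
def BoolExpr.cost : BoolExpr → ℕ
  | .natLe e f => e.cost + f.cost + 1
  | .realLe e f => e.cost + f.cost + 1
  | .not b => b.cost + 1
  | .and b c => b.cost + c.cost + 1

/-- Write `v` to entry `i` of the array number `a` of natural numbers. -/
def Memory.writeNat (m : Memory) (a i v : ℕ) : Memory :=
  { m with nat := Function.update m.nat a (Function.update (m.nat a) i v) }

/-- Write `v` to entry `i` of the array number `a` of real numbers. -/
noncomputable def Memory.writeReal (m : Memory) (a i : ℕ) (v : ℝ) : Memory :=
  { m with real := Function.update m.real a (Function.update (m.real a) i v) }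

/-- `Exec c m m' t`: the program `c`, started with the memory `m`, halts after exactly `t` steps
with the memory `m'`. -/
inductive Exec : Program → Memory → Memory → ℕ → Prop where
  | skip (m : Memory) : Exec .skip m m 1
  | setNat (a : ℕ) (i e : NatExpr) (m : Memory) :
      Exec (.setNat a i e) m (m.writeNat a (i.eval m) (e.eval m)) (i.cost + e.cost + 1)
  | setReal (a : ℕ) (i : NatExpr) (e : RealExpr) (m : Memory) :
      Exec (.setReal a i e) m (m.writeReal a (i.eval m) (e.eval m)) (i.cost + e.cost + 1)
  | seq {c d : Program} {m m' m'' : Memory} {t u : ℕ} (hc : Exec c m m' t)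
      (hd : Exec d m' m'' u) : Exec (.seq c d) m m'' (t + u)
  | iteTrue {b : BoolExpr} {c : Program} (d : Program) {m m' : Memory} {t : ℕ}
      (hb : b.Holds m) (hc : Exec c m m' t) : Exec (.ite b c d) m m' (b.cost + t + 1)
  | iteFalse {b : BoolExpr} (c : Program) {d : Program} {m m' : Memory} {t : ℕ}
      (hb : ¬ b.Holds m) (hd : Exec d m m' t) : Exec (.ite b c d) m m' (b.cost + t + 1)
  | loopFalse {b : BoolExpr} (c : Program) {m : Memory}
      (hb : ¬ b.Holds m) : Exec (.loop b c) m m (b.cost + 1)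
  | loopTrue {b : BoolExpr} {c : Program} {m m' m'' : Memory} {t u : ℕ}
      (hb : b.Holds m) (hc : Exec c m m' t) (hl : Exec (.loop b c) m' m'' u) :
      Exec (.loop b c) m m'' (b.cost + t + u + 1)

/-- The initial memory. The number of items is entry `0` of array `0` of natural numbers; the
item sizes are the first entries of array `0` of real numbers; the parameter `ε` is entry `0` of
array `1` of real numbers. All other entries are `0`. -/
noncomputable def initMemory (ε : ℝ) (I : List ℝ) : Memory where
  nat := fun a i => if a = 0 ∧ i = 0 then I.length else 0
  real := fun a i => if a = 0 then I.getD i 0 else if a = 1 ∧ i = 0 then ε else 0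

/-- The program `c`, run with the parameter `ε`, is the online algorithm `A`, and its running time
is bounded by the polynomial `p`: on each instance `I` the program halts after at most
`p (number of items)` steps, and the bins of the items in the solution `A I` are then the first
entries of array `1` of natural numbers. -/
def Implements (c : Program) (p : Polynomial ℕ) (ε : ℝ) (A : List ℝ → ℕ → ℕ) : Prop :=
  ∀ I : List ℝ, IsInstance I → ∃ (m : Memory) (t : ℕ),
    Exec c (initMemory ε I) m t ∧ t ≤ p.eval I.length ∧ ∀ i < I.length, m.nat 1 i = A I i

end BinCovering

namespace BinCovering
open Finset Function Classical
noncomputable section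

/-! ## The algorithm -/

/-! The algorithm distinguishes pairs of big items, singles (a big item in an uncovered bin), mixed
bins (covered, with one big item) and bins of small items only. Label `0` is a pool of items without
a bin. `Valid` orders the big items: paired ones are at most the singles, and these are at most the
ones in mixed bins. Small items lie in at most one uncovered bin, and the big item there, if there
is one, is the largest single. If that bin has no big item, it is the only nonempty uncovered bin. A
covered bin of small items coexists with no single. Two potentials are summed over the bins: `chi`
is the number of pairs minus the number of singles, and `psi` measures the load in excess of `3/2 +
ε` per covered bin. The invariant `Good` keeps `chi ≥ -3` and `psi ≤ 2`.

Ratio. If some bin holds only small items, all uncovered load sits in one bin. The total size, which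
bounds `opt`, is then at most `(3/2 + ε) ALG + psi + 1` (`sum_le_of_good`). Otherwise the order
yields a threshold `1 - δ` between the big items of mixed bins and all other big items
(`Valid.exists_threshold`). With suitable weights every covered bin of any solution weighs at least
`2` (`two_le_binSum_weight`), whereas a pair weighs `2`, a mixed bin at most `3` and a single `1`,
up to one extra unit for the uncovered bin with small items (`Valid.sum_weight_le`). Hence `2 opt ≤
3 ALG - chi + 1 ≤ 3 ALG + 4`.

Migration. An item smaller than `ε` joins the fullest uncovered bin and nothing else moves; the `-ε`
in `psi` pays for the bin that it may turn from single to mixed. A larger item may move a constant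
volume, at most `8`: freeing the small items of uncovered bins costs `1`, rebalancing pairs against
singles costs `3`, placing a big item costs `4` (`prepare_spec`). Rebalancing leaves `chi ≥ -1` and
`psi ≤ 1/2`, which is enough room for the new item and for the reinsertion of the pool, whose volume
bounds the later growth of `psi` (`Extends`).

Running time. The program simulates the whole run and recomputes loads by scanning all items. Every
loop counts over items, so a polynomial time bound can be read off the syntax (`Program.time`), and
correctness is a Hoare-style argument with `Runs`. -/

/-- Big items have size at least `1 / 2`. -/
def Big (x : ℝ) : Prop := 1 ≤ x + x

/-- The sum of `f` over the items with label `k`. -/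
def binSum {M : Type*} [AddCommMonoid M] (f : ℕ → M) (n : ℕ) (P : ℕ → ℕ) (k : ℕ) : M :=
  ∑ i ∈ range n, if P i = k then f i else 0

/-- The indicator function of the big items. -/
def bigInd (sz : ℕ → ℝ) (i : ℕ) : ℕ := if Big (sz i) then 1 else 0

/-- The load of label `k`. -/
abbrev ld (sz : ℕ → ℝ) (n : ℕ) (P : ℕ → ℕ) (k : ℕ) : ℝ := binSum sz n P k

/-- The number of big items with label `k`. -/
abbrev nb (sz : ℕ → ℝ) (n : ℕ) (P : ℕ → ℕ) (k : ℕ) : ℕ := binSum (bigInd sz) n P k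

/-- `pick C K n` is `i + 1` for an `i < n` that maximizes `K i` subject to `C i`, and `0` if there
is none. -/
def pick (C : ℕ → Prop) (K : ℕ → ℝ) : ℕ → ℕ
  | 0 => 0
  | j + 1 => if C j ∧ ¬ (1 ≤ pick C K j ∧ K j ≤ K (pick C K j - 1)) then j + 1 else pick C K j

/-- A state: the labels of the items and a fresh label. Label `0` marks items without a bin. -/
abbrev State := (ℕ → ℕ) × ℕ

/-- Take the small items out of the uncovered bins. -/
def freeOpen (sz : ℕ → ℝ) (n : ℕ) (P : ℕ → ℕ) : ℕ → ℕ :=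
  fun i => if i < n ∧ ¬ Big (sz i) ∧ ld sz n P (P i) < 1 then 0 else P i

/-- The smallest big item that is alone in an uncovered bin, except `e - 1`. -/
def pickSingle (sz : ℕ → ℝ) (n : ℕ) (P : ℕ → ℕ) (e : ℕ) : ℕ :=
  pick (fun i => Big (sz i) ∧ ld sz n P (P i) < 1 ∧ i + 1 ≠ e) (fun i => 1 - sz i) n

/-- The largest item in a bin with two big items. -/
def pickPaired (sz : ℕ → ℝ) (n : ℕ) (P : ℕ → ℕ) : ℕ :=
  pick (fun i => Big (sz i) ∧ 2 ≤ nb sz n P (P i)) sz n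

/-- The smallest big item in a covered bin with a single big item. -/
def pickMixed (sz : ℕ → ℝ) (n : ℕ) (P : ℕ → ℕ) : ℕ :=
  pick (fun i => Big (sz i) ∧ nb sz n P (P i) ≤ 1 ∧ 1 ≤ ld sz n P (P i)) (fun i => 1 - sz i) n

/-- An item in a covered bin of small items. -/
def pickSmall (sz : ℕ → ℝ) (n : ℕ) (P : ℕ → ℕ) : ℕ :=
  pick (fun i => P i ≠ 0 ∧ nb sz n P (P i) = 0 ∧ 1 ≤ ld sz n P (P i)) sz n

/-- An item in the uncovered bin with the largest load. -/
def pickOpen (sz : ℕ → ℝ) (n : ℕ) (P : ℕ → ℕ) : ℕ :=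
  pick (fun i => P i ≠ 0 ∧ ld sz n P (P i) < 1) (fun i => ld sz n P (P i)) n

/-- The number of big items in uncovered bins. -/
def numSingle (sz : ℕ → ℝ) (n : ℕ) (P : ℕ → ℕ) : ℕ :=
  ∑ i ∈ range n, if Big (sz i) ∧ ld sz n P (P i) < 1 then 1 else 0

/-- The number of big items in bins with two big items. -/
def numPaired (sz : ℕ → ℝ) (n : ℕ) (P : ℕ → ℕ) : ℕ :=
  ∑ i ∈ range n, if Big (sz i) ∧ 2 ≤ nb sz n P (P i) then 1 else 0

/-- Put the two smallest single big items into one bin. -/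
def pairUp (sz : ℕ → ℝ) (n : ℕ) (P : ℕ → ℕ) : ℕ → ℕ :=
  update P (pickSingle sz n P 0 - 1) (P (pickSingle sz n P (pickSingle sz n P 0) - 1))

/-- Exchange the labels of `i - 1` and the single item `j`, if `i - 1` is larger. -/
def exchange (sz : ℕ → ℝ) (P : ℕ → ℕ) (i j : ℕ) : ℕ → ℕ :=
  if 1 ≤ i ∧ sz j < sz (i - 1) then update (update P (i - 1) (P j)) j (P (i - 1)) else P

/-- Open a bin with two big items so that the two largest of the paired items become single. -/
def breakUp (sz : ℕ → ℝ) (n : ℕ) (P : ℕ → ℕ) (fr : ℕ) : ℕ → ℕ :=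
  let Q := update P (pickPaired sz n P - 1) fr
  exchange sz Q (pickPaired sz n Q) (pickSingle sz n Q 0 - 1)

/-- Keep the numbers of single big items and of pairs of big items close to each other. -/
def rebalance (sz : ℕ → ℝ) (n : ℕ) (s : State) : State :=
  -- `numPaired` counts items, hence each pair twice; the two tests read `chi ≤ -2` and `chi ≥ 2`.
  if numPaired sz n s.1 + 4 ≤ numSingle sz n s.1 + numSingle sz n s.1 then (pairUp sz n s.1, s.2)
  else if numSingle sz n s.1 + numSingle sz n s.1 + 4 ≤ numPaired sz n s.1 then
    (breakUp sz n s.1 s.2, s.2 + 1)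
  else s

/-- Take small items `i < j` out of the bin `k` as long as it stays covered. -/
def trim (sz : ℕ → ℝ) (n k : ℕ) (P : ℕ → ℕ) : ℕ → ℕ → ℕ
  | 0 => P
  | j + 1 =>
    if trim sz n k P j j = k ∧ ¬ Big (sz j) ∧ 1 ≤ ld sz n (trim sz n k P j) k - sz j then
      update (trim sz n k P j) j 0
    else trim sz n k P j

/-- The new big item `t` takes the place of the paired item `i - 1` if that is larger. -/
def placePaired (sz : ℕ → ℝ) (t i : ℕ) (P : ℕ → ℕ) : (ℕ → ℕ) × ℕ :=
  if 1 ≤ i ∧ sz t < sz (i - 1) then (update P t (P (i - 1)), i - 1) else (P, t)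

/-- The bin for the item `c`, and the state after `y - 1` has left this bin. -/
def host (sz : ℕ → ℝ) (w y c : ℕ) (s : State) : State × ℕ :=
  if 1 ≤ w then (s, s.1 (w - 1))
  else if 1 ≤ y ∧ sz (y - 1) < sz c then ((update s.1 (y - 1) s.2, s.2 + 1), s.1 (y - 1))
  else ((s.1, s.2 + 1), s.2)

/-- Find a place for the new big item `t`. -/
def place (sz : ℕ → ℝ) (t w : ℕ) (s : State) : State :=
  let q := placePaired sz t (pickPaired sz t s.1) s.1
  let h := host sz w (pickMixed sz t s.1) q.2 (q.1, s.2)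
  (trim sz (t + 1) h.2 (update h.1.1 q.2 h.2) (t + 1), h.1.2)

/-- Put the item `i` into a bin if it is in none. -/
def insertItem (sz : ℕ → ℝ) (n i : ℕ) (s : State) : State :=
  if s.1 i = 0 then
    if pickOpen sz n s.1 = 0 then (update s.1 i s.2, s.2 + 1)
    else (update s.1 i (s.1 (pickOpen sz n s.1 - 1)), s.2)
  else s

/-- Insert the items `i < j` that are in no bin. -/
def insertUpTo (sz : ℕ → ℝ) (n : ℕ) (s : State) : ℕ → State
  | 0 => s
  | j + 1 => insertItem sz n j (insertUpTo sz n s j)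

/-- Prepare the state for the item `t` of size at least `ε`. -/
def prepare (sz : ℕ → ℝ) (t : ℕ) (s : State) : State :=
  let P := freeOpen sz t s.1
  let w := pickSmall sz t P
  let s' := if w = 0 then rebalance sz t (P, s.2) else (P, s.2)
  if Big (sz t) then place sz t w s' else s'

/-- The arrival of item `t`. -/
def arrive (ε : ℝ) (sz : ℕ → ℝ) (t : ℕ) (s : State) : State :=
  insertUpTo sz (t + 1) (if ε ≤ sz t then prepare sz t s else s) (t + 1)

/-- The state after the arrival of `t` items. -/
def run (ε : ℝ) (sz : ℕ → ℝ) : ℕ → State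
  | 0 => (fun _ => 0, 1)
  | t + 1 => arrive ε sz t (run ε sz t)

/-! ## Basic facts -/

variable {M : Type*} {sz : ℕ → ℝ} {n i j k a : ℕ} {P Q : ℕ → ℕ}

theorem pick_cases (C : ℕ → Prop) (K : ℕ → ℝ) (n : ℕ) :
    (pick C K n = 0 ∧ ∀ j < n, ¬ C j) ∨
      ∃ i < n, pick C K n = i + 1 ∧ C i ∧ ∀ j < n, C j → K j ≤ K i := by
  induction n with
  | zero => left; exact ⟨rfl, by simp⟩
  | succ n ih =>
    rw [pick]
    split_ifs with h
    · right
      refine ⟨n, by omega, rfl, h.1, fun j hj hC => ?_⟩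
      rcases Nat.lt_succ_iff_lt_or_eq.1 hj with hj | rfl
      · rcases ih with ih | ⟨i, hi, e, hCi, hm⟩
        · exact absurd hC (ih.2 j hj)
        · have := h.2
          rw [e] at this
          simp only [not_and, not_le] at this
          exact (hm j hj hC).trans (this (by omega)).le
      · exact le_rfl
    · rcases ih with ih | ⟨i, hi, e, hCi, hm⟩
      · left
        refine ⟨ih.1, fun j hj hC => ?_⟩
        rcases Nat.lt_succ_iff_lt_or_eq.1 hj with hj | rfl
        · exact ih.2 j hj hC
        · exact h ⟨hC, by rw [ih.1]; omega⟩
      · right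
        refine ⟨i, by omega, e, hCi, fun j hj hC => ?_⟩
        rcases Nat.lt_succ_iff_lt_or_eq.1 hj with hj | rfl
        · exact hm j hj hC
        · by_contra hlt
          refine h ⟨hC, fun hh => hlt ?_⟩
          simpa [e] using hh.2

theorem pick_eq_zero {C : ℕ → Prop} {K : ℕ → ℝ} (h : pick C K n = 0) : ∀ j < n, ¬ C j := by
  rcases pick_cases C K n with ⟨_, h'⟩ | ⟨i, _, e, _⟩
  · exact h'
  · omega

theorem pick_pos {C : ℕ → Prop} {K : ℕ → ℝ} (h : pick C K n ≠ 0) :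
    pick C K n - 1 < n ∧ C (pick C K n - 1) ∧ ∀ j < n, C j → K j ≤ K (pick C K n - 1) := by
  rcases pick_cases C K n with ⟨h', _⟩ | ⟨i, hi, e, h1, h2⟩
  · exact absurd h' h
  · simp only [e, Nat.add_sub_cancel]
    exact ⟨hi, h1, h2⟩

theorem binSum_congr [AddCommMonoid M] {f : ℕ → M} (h : ∀ i < n, P i = k ↔ Q i = k) :
    binSum f n P k = binSum f n Q k :=
  sum_congr rfl fun i hi => by simp [h i (mem_range.1 hi)]

/-- Stated without subtraction, so that it serves real loads and natural counts alike. -/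
theorem binSum_update [AddCommMonoid M] (f : ℕ → M) (P : ℕ → ℕ) (hi : i < n) (a k : ℕ) :
    binSum f n (update P i a) k + (if P i = k then f i else 0) =
      binSum f n P k + (if a = k then f i else 0) := by
  have h : ∀ Q : ℕ → ℕ, binSum f n Q k = (if Q i = k then f i else 0) +
      ∑ j ∈ (range n).erase i, if Q j = k then f j else 0 := fun Q =>
    (add_sum_erase _ _ (mem_range.2 hi)).symm
  rw [h P, h (update P i a), update_self]
  have : ∑ j ∈ (range n).erase i, (if update P i a j = k then f j else 0) =
      ∑ j ∈ (range n).erase i, if P j = k then f j else 0 :=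
    sum_congr rfl fun j hj => by rw [update_of_ne (ne_of_mem_erase hj)]
  rw [this]
  abel

theorem binSum_update_of_ne [AddCommMonoid M] (f : ℕ → M) (P : ℕ → ℕ) (h1 : P i ≠ k)
    (h2 : a ≠ k) : binSum f n (update P i a) k = binSum f n P k :=
  binSum_congr fun j _ => by
    by_cases hj : j = i
    · subst hj; simp [h1, h2]
    · simp [hj]

theorem binSum_put [AddCommMonoid M] (f : ℕ → M) (hi : i < n) (h : P i ≠ k) :
    binSum f n (update P i k) k = binSum f n P k + f i := by
  simpa [h] using binSum_update f P hi k k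

theorem binSum_take [AddCommMonoid M] (f : ℕ → M) (hi : i < n) (h : a ≠ P i) :
    binSum f n (update P i a) (P i) + f i = binSum f n P (P i) := by
  simpa [h] using binSum_update f P hi a (P i)

theorem binSum_succ [AddCommMonoid M] (f : ℕ → M) (h : P n ≠ k) :
    binSum f (n + 1) P k = binSum f n P k := by
  simp [binSum, sum_range_succ, h]

theorem binSum_empty [AddCommMonoid M] (f : ℕ → M) (h : ∀ i < n, P i ≠ k) :
    binSum f n P k = 0 :=
  sum_eq_zero fun i hi => by simp [h i (mem_range.1 hi)]

theorem le_ld (h0 : ∀ i < n, 0 < sz i) (hi : i < n) (h : P i = k) : sz i ≤ ld sz n P k := by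
  have := single_le_sum (f := fun i => if P i = k then sz i else 0) (s := range n)
    (fun j hj => by
      have := h0 j (mem_range.1 hj)
      split_ifs <;> linarith) (mem_range.2 hi)
  simpa [h, binSum] using this

theorem ld_nonneg (h0 : ∀ i < n, 0 < sz i) (k : ℕ) : 0 ≤ ld sz n P k :=
  sum_nonneg fun j hj => by
    have := h0 j (mem_range.1 hj)
    split_ifs <;> linarith

theorem add_le_ld (h0 : ∀ i < n, 0 < sz i) (hi : i < n) (hj : j < n) (hij : i ≠ j) (h : P i = k)
    (h' : P j = k) : sz i + sz j ≤ ld sz n P k := by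
  -- The label `k + 1` only serves to remove `i` from the bin `k`.
  have h1 := le_ld (P := update P i (k + 1)) (k := k) h0 hj (by simp [hij.symm, h'])
  have h2 := binSum_take sz (P := P) (a := k + 1) hi (by omega)
  simp only [h] at h2
  unfold ld at *
  linarith

theorem bigInd_of_big (h : Big (sz i)) : bigInd sz i = 1 := if_pos h

theorem bigInd_of_small (h : ¬ Big (sz i)) : bigInd sz i = 0 := if_neg h

theorem one_le_nb (hi : i < n) (h : P i = k) (hb : Big (sz i)) : 1 ≤ nb sz n P k := by
  have := single_le_sum (f := fun i => if P i = k then bigInd sz i else 0) (s := range n)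
    (fun j hj => Nat.zero_le _) (mem_range.2 hi)
  simpa [h, bigInd_of_big hb, binSum] using this

theorem two_le_nb (hi : i < n) (hj : j < n) (hij : i ≠ j) (h : P i = k) (h' : P j = k)
    (hb : Big (sz i)) (hb' : Big (sz j)) : 2 ≤ nb sz n P k := by
  have h1 := one_le_nb (P := update P i (k + 1)) (k := k) hj (by simp [hij.symm, h']) hb'
  have h2 := binSum_take (bigInd sz) (P := P) (a := k + 1) hi (by omega)
  simp only [h, bigInd_of_big hb] at h2
  unfold nb at *
  omega

theorem exists_big (h : nb sz n P k ≠ 0) : ∃ i < n, P i = k ∧ Big (sz i) := by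
  obtain ⟨i, hi, h'⟩ := exists_ne_zero_of_sum_ne_zero h
  refine ⟨i, mem_range.1 hi, ?_⟩
  simpa [bigInd] using h'

theorem exists_big_ne (h : 2 ≤ nb sz n P k) (hi : i < n) (hP : P i = k) :
    ∃ j < n, j ≠ i ∧ P j = k ∧ Big (sz j) := by
  have h2 := binSum_take (bigInd sz) (P := P) (a := k + 1) hi (by omega)
  have h3 : bigInd sz i ≤ 1 := by unfold bigInd; split_ifs <;> simp
  rw [hP] at h2
  obtain ⟨j, hj, h4, h5⟩ := exists_big (sz := sz) (n := n) (P := update P i (k + 1)) (k := k)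
    (by unfold nb at *; omega)
  have : j ≠ i := by
    rintro rfl
    simp at h4
  exact ⟨j, hj, this, by simpa [this] using h4, h5⟩

theorem one_le_ld_of_nb (h0 : ∀ i < n, 0 < sz i) (h : 2 ≤ nb sz n P k) : 1 ≤ ld sz n P k := by
  obtain ⟨i, hi, hP, hb⟩ := exists_big (sz := sz) (n := n) (P := P) (k := k) (by omega)
  obtain ⟨j, hj, hij, hP', hb'⟩ := exists_big_ne h hi hP
  have := add_le_ld h0 hj hi hij hP' hP
  unfold Big at *
  linarith

theorem exists_mem_of_ld (h : ld sz n P k ≠ 0) : ∃ i < n, P i = k := by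
  by_contra hc
  push Not at hc
  exact h (binSum_empty sz hc)

end

noncomputable section

/-! ## The invariants -/

/-- The admissible contents of a bin: a bin with two big items contains nothing else, and a covered
bin with small items becomes uncovered when some small item is removed. -/
def LabelOK (sz : ℕ → ℝ) (n : ℕ) (P : ℕ → ℕ) (k : ℕ) : Prop :=
  -- The strict bound `sz i < 1` makes the partner of a removed item uncovered, and it makes the
  -- threshold `δ` of the weight argument positive.
  nb sz n P k ≤ 2 ∧ (nb sz n P k = 2 → ∀ i < n, P i = k → Big (sz i) ∧ sz i < 1) ∧
    (nb sz n P k ≤ 1 → 1 ≤ ld sz n P k → (∀ i < n, P i = k → Big (sz i)) ∨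
      ∃ i < n, P i = k ∧ ¬ Big (sz i) ∧ ld sz n P k - sz i < 1)

/-- The rank of a bin with a big item. -/
def rank (sz : ℕ → ℝ) (n : ℕ) (P : ℕ → ℕ) (k : ℕ) : ℕ :=
  if nb sz n P k = 2 then 0 else if ld sz n P k < 1 then 1 else 2

/-- The structural invariants of the states of the algorithm. -/
structure Valid (sz : ℕ → ℝ) (n : ℕ) (P : ℕ → ℕ) (fr : ℕ) : Prop where
  lt : ∀ i, P i < fr
  out : ∀ i, n ≤ i → P i = 0
  ok : ∀ k, k ≠ 0 → LabelOK sz n P k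
  order : ∀ i < n, ∀ j < n, Big (sz i) → Big (sz j) → P i ≠ 0 → P j ≠ 0 →
    rank sz n P (P j) < rank sz n P (P i) → sz j ≤ sz i
  -- With `i` a small item, this confines the small items to one uncovered bin, whose big item
  -- dominates all other singles. If that bin has no big item, no other uncovered bin is in use.
  opn : ∀ i < n, ∀ j < n, ¬ Big (sz i) → P i ≠ 0 → P j ≠ 0 → ld sz n P (P i) < 1 →
    ld sz n P (P j) < 1 → P j ≠ P i →
    Big (sz j) ∧ ∃ b < n, Big (sz b) ∧ P b = P i ∧ sz j ≤ sz b
  closed : ∀ k, k ≠ 0 → nb sz n P k = 0 → 1 ≤ ld sz n P k →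
    ∀ j < n, Big (sz j) → P j ≠ 0 → 1 ≤ ld sz n P (P j)

/-- No big item is alone in an uncovered bin. -/
def NoSingle (sz : ℕ → ℝ) (n : ℕ) (P : ℕ → ℕ) : Prop :=
  ∀ j < n, Big (sz j) → P j ≠ 0 → 1 ≤ ld sz n P (P j)

/-- The contribution of a bin to the number of pairs minus the number of single items. -/
def chi (L : ℝ) (b : ℕ) : ℤ := if b = 2 then 1 else if b = 1 ∧ L < 1 then -1 else 0

/-- The contribution of a bin to the volume potential. -/
def psi (ε L : ℝ) (b : ℕ) : ℝ :=
  -- For covered bins with a big item, `psi` bounds load minus `3/2 + ε`: a pair has load at most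
  -- `2`, and a mixed bin gives equality. The value `-1/2` of a single makes `psi ≤ chi / 2`
  -- binwise.
  if b = 2 then 1 / 2 else if b = 1 then (if L < 1 then -1 / 2 else L - 3 / 2 - ε) else 0

/-- The sum of a function of load and number of big items over the bins. -/
def labelSum {M : Type*} [AddCommMonoid M] (g : ℝ → ℕ → M) (sz : ℕ → ℝ) (n : ℕ) (P : ℕ → ℕ)
    (F : ℕ) : M := ∑ k ∈ Ico 1 F, g (ld sz n P k) (nb sz n P k)

variable {M : Type*} {sz : ℕ → ℝ} {n i j k a l F F' fr : ℕ} {P Q : ℕ → ℕ} {ε : ℝ}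

theorem LabelOK.congr (h : LabelOK sz n P k) (hPQ : ∀ i < n, Q i = k ↔ P i = k) :
    LabelOK sz n Q k := by
  unfold LabelOK nb ld at *
  rw [binSum_congr hPQ, binSum_congr hPQ]
  refine ⟨h.1, fun h2 i hi hP => h.2.1 h2 i hi ((hPQ i hi).1 hP), fun h2 h3 => ?_⟩
  rcases h.2.2 h2 h3 with h4 | ⟨i, hi, h4, h5⟩
  · exact Or.inl fun i hi hP => h4 i hi ((hPQ i hi).1 hP)
  · exact Or.inr ⟨i, hi, (hPQ i hi).2 h4, h5⟩

theorem labelOK_of_forall_ne (h : ∀ i < n, P i ≠ k) : LabelOK sz n P k := by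
  have := binSum_empty (bigInd sz) h
  unfold LabelOK nb
  rw [this]
  exact ⟨by simp, by simp, fun _ _ => Or.inl fun i hi hP => absurd hP (h i hi)⟩

/-- A covered bin without a pair is either one big item of size `1` or drops below `1` when some
item smaller than `1/2` is removed. -/
theorem LabelOK.ld_lt (h : LabelOK sz n P k) (h1 : ∀ i < n, sz i ≤ 1)
    (hb : nb sz n P k ≤ 1) : ld sz n P k < 3 / 2 := by
  by_cases hc : 1 ≤ ld sz n P k
  · rcases h.2.2 hb hc with h2 | ⟨i, hi, h2, h3, h4⟩
    · obtain ⟨i, hi, hP⟩ := exists_mem_of_ld (sz := sz) (n := n) (P := P) (k := k) (by linarith)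
      have : ld sz n P k = sz i := by
        have : ∀ j ∈ range n, j ≠ i → (if P j = k then sz j else 0) = 0 := fun j hj hji => by
          split_ifs with hjk
          · have := two_le_nb hi (mem_range.1 hj) (Ne.symm hji) hP hjk (h2 i hi hP)
              (h2 j (mem_range.1 hj) hjk)
            omega
          · rfl
        unfold ld binSum
        rw [sum_eq_single_of_mem i (mem_range.2 hi) this, if_pos hP]
      linarith [h1 i hi]
    · unfold Big at h3
      linarith
  · linarith

theorem ld_eq_of_forall (hi : i < n) (hP : P i = k) (h : ∀ j < n, P j = k → j = i) :
    ld sz n P k = sz i := by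
  unfold ld binSum
  rw [sum_eq_single_of_mem i (mem_range.2 hi), if_pos hP]
  intro j hj hji
  exact if_neg fun hjk => hji (h j (mem_range.1 hj) hjk)

/-- Label `0` is exempt from the hypothesis because the pool does not enter the sum: a move between
the pool and `l` changes a single term. -/
theorem labelSum_congr [AddCommGroup M] (g : ℝ → ℕ → M) (hl : l ∈ Ico 1 F)
    (h : ∀ i < n, ∀ k, k ≠ 0 → k ≠ l → (Q i = k ↔ P i = k)) :
    labelSum g sz n Q F =
      labelSum g sz n P F + (g (ld sz n Q l) (nb sz n Q l) - g (ld sz n P l) (nb sz n P l)) := by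
  unfold labelSum
  rw [← add_sum_erase _ _ hl, ← add_sum_erase (Ico 1 F)
    (fun k => g (ld sz n P k) (nb sz n P k)) hl]
  have : ∑ k ∈ (Ico 1 F).erase l, g (ld sz n Q k) (nb sz n Q k) =
      ∑ k ∈ (Ico 1 F).erase l, g (ld sz n P k) (nb sz n P k) := by
    refine sum_congr rfl fun k hk => ?_
    have hk' := mem_erase.1 hk
    have hk2 := mem_Ico.1 hk'.2
    have h2 : ∀ i < n, (Q i = k ↔ P i = k) := fun i hi => h i hi k (by omega) hk'.1
    unfold ld nb
    rw [binSum_congr h2, binSum_congr h2]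
  rw [this]
  abel

theorem labelSum_extend [AddCommMonoid M] (g : ℝ → ℕ → M) (hg : g 0 0 = 0) (h1 : 1 ≤ F)
    (h : ∀ i < n, P i < F) (hF : F ≤ F') : labelSum g sz n P F' = labelSum g sz n P F := by
  unfold labelSum
  rw [← sum_Ico_consecutive _ h1 hF]
  rw [sum_eq_zero (s := Ico F F'), add_zero]
  intro k hk
  have : ∀ i < n, P i ≠ k := fun i hi => by
    have := h i hi
    have := (mem_Ico.1 hk).1
    omega
  unfold ld nb
  rw [binSum_empty _ this, binSum_empty _ this, hg]

theorem chi_zero : chi 0 0 = 0 := by simp [chi]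

theorem psi_zero : psi ε 0 0 = 0 := by simp [psi]

theorem nb_le_one (h0 : ∀ i < n, 0 < sz i) (h : ld sz n P k < 1) : nb sz n P k ≤ 1 := by
  by_contra hc
  have := one_le_ld_of_nb h0 (P := P) (k := k) (by omega)
  linarith

theorem eq_of_nb_le_one (h : nb sz n P k ≤ 1) (hi : i < n) (hj : j < n) (hP : P i = k)
    (hP' : P j = k) (hb : Big (sz i)) (hb' : Big (sz j)) : i = j := by
  by_contra hc
  have := two_le_nb hi hj hc hP hP' hb hb'
  omega

/-! ## Insertion of a small item -/

/-- The bin `l` is the uncovered bin with the largest load. -/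
structure IsTarget (sz : ℕ → ℝ) (n : ℕ) (P : ℕ → ℕ) (l : ℕ) : Prop where
  ne : l ≠ 0
  lt : ld sz n P l < 1
  max : ∀ j < n, P j ≠ 0 → ld sz n P (P j) < 1 → ld sz n P (P j) ≤ ld sz n P l

/-- If the target contains a small item this is the invariant `opn`. Otherwise the target consists
of one big item, and the maximality of its load gives the comparison of sizes. This is why small
items go to the fullest uncovered bin: the largest single is covered first. -/
theorem Valid.exists_target_big (h0 : ∀ i < n, 0 < sz i) (hV : Valid sz n P fr)
    (hl : IsTarget sz n P l) (hj : j < n) (h1 : P j ≠ 0) (h2 : ld sz n P (P j) < 1)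
    (h3 : P j ≠ l) : Big (sz j) ∧ ∃ b < n, Big (sz b) ∧ P b = l ∧ sz j ≤ sz b := by
  by_cases hs : ∃ s < n, P s = l ∧ ¬ Big (sz s)
  · obtain ⟨s, hs, rfl, hb⟩ := hs
    exact hV.opn s hs j hj hb hl.ne h1 hl.lt h2 h3
  · push Not at hs
    have h4 := hl.max j hj h1 h2
    have h5 := le_ld h0 hj (rfl : P j = P j)
    have h6 := h0 j hj
    obtain ⟨a, ha, hal⟩ := exists_mem_of_ld (sz := sz) (n := n) (P := P) (k := l) (by linarith)
    have h7 : ld sz n P l = sz a := ld_eq_of_forall ha hal fun b hb hbl =>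
      (eq_of_nb_le_one (nb_le_one h0 hl.lt) ha hb hal hbl (hs a ha hal) (hs b hb hbl)).symm
    -- If `j` were small, its bin would also contain a big item at least as large as `a`, and so
    -- would have a larger load than the target.
    have hbj : Big (sz j) := by
      by_contra hbj
      obtain ⟨_, b, hb, hbb, hbP, hle⟩ := hV.opn j hj a ha hbj h1 (hal ▸ hl.ne) h2
        (hal ▸ hl.lt) (by rw [hal]; exact h3.symm)
      have := add_le_ld h0 hb hj (fun h => hbj (h ▸ hbb)) hbP rfl
      linarith
    exact ⟨hbj, a, ha, hs a ha hal, hal, by linarith⟩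

/-- Only covering a single can raise `psi`, from `-1/2` to `L + z - 3/2 - ε`. The change `L + z - 1
- ε` is less than `z - ε`. -/
theorem psi_add_sub {L z : ℝ} {b : ℕ} (hb : b ≤ 1) (hL : L < 1) (hz : 0 < z) (hε : 0 ≤ ε) :
    psi ε (L + z) b - psi ε L b ≤ z ∧ (z < ε → psi ε (L + z) b - psi ε L b ≤ 0) ∧
      (b = 0 → psi ε (L + z) b - psi ε L b ≤ 0) := by
  interval_cases b
  · simp [psi, hz.le]
  · simp only [psi, if_pos hL, OfNat.one_ne_ofNat, if_false, if_true, one_ne_zero,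
      IsEmpty.forall_iff, and_true]
    exact ⟨by split_ifs <;> linarith, fun h => by split_ifs <;> linarith⟩

section
variable (h0 : ∀ i < n, 0 < sz i) (hV : Valid sz n P fr) (hl : IsTarget sz n P l)
  (hi : i < n) (hs : ¬ Big (sz i)) (hp : P i = 0)

theorem update_iff (P : ℕ → ℕ) (hp : P i = 0) (l : ℕ) (j k : ℕ) (hk : k ≠ 0) (hkl : k ≠ l) :
    update P i l j = k ↔ P j = k := by
  by_cases hj : j = i
  · subst hj
    simp only [update_self, hp]
    omega
  · rw [update_of_ne hj]

include hl hi hp in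
theorem IsTarget.ld_update : ld sz n (update P i l) l = ld sz n P l + sz i :=
  binSum_put sz hi (by rw [hp]; exact hl.ne.symm)

include hl hi hp hs in
theorem IsTarget.nb_update : nb sz n (update P i l) l = nb sz n P l := by
  have := binSum_put (bigInd sz) hi (P := P) (k := l) (by rw [hp]; exact hl.ne.symm)
  rwa [bigInd_of_small hs, add_zero] at this

include hp in
theorem ld_update_of_ne' (hk : k ≠ 0) (hkl : k ≠ l) : ld sz n (update P i l) k = ld sz n P k :=
  binSum_congr fun j _ => update_iff P hp l j k hk hkl

include hp in
theorem nb_update_of_ne' (hk : k ≠ 0) (hkl : k ≠ l) : nb sz n (update P i l) k = nb sz n P k :=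
  binSum_congr fun j _ => update_iff P hp l j k hk hkl

-- Only the load of the target grows, so at most its rank changes, from single to mixed. By
-- `Valid.exists_target_big` its big item, if any, is at least as large as every other single, hence
-- the order survives.
include h0 hV hl hi hs hp in
theorem Valid.insert (hlt : l < fr) : Valid sz n (update P i l) fr := by
  have hL := hl.ld_update hi hp
  have hN := hl.nb_update hi hs hp
  have hN1 := nb_le_one h0 hl.lt
  have hz := h0 i hi
  have hLo : ∀ k, k ≠ 0 → k ≠ l → ld sz n (update P i l) k = ld sz n P k :=
    fun k hk hkl => ld_update_of_ne' hp hk hkl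
  have hNo : ∀ k, k ≠ 0 → nb sz n (update P i l) k = nb sz n P k := fun k hk => by
    by_cases hkl : k = l
    · rw [hkl, hN]
    · exact nb_update_of_ne' hp hk hkl
  have hLge : ∀ k, k ≠ 0 → ld sz n P k ≤ ld sz n (update P i l) k := fun k hk => by
    by_cases hkl : k = l
    · rw [hkl, hL]; linarith
    · rw [hLo k hk hkl]
  have hbig : ∀ j, Big (sz j) → update P i l j = P j := fun j hj =>
    update_of_ne (by rintro rfl; exact hs hj) _ _
  refine ⟨fun j => ?_, fun j hj => ?_, fun k hk => ?_, ?_, ?_, ?_⟩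
  · by_cases hj : j = i
    · subst hj; simpa using hlt
    · simpa [hj] using hV.lt j
  · rw [update_of_ne (by omega)]
    exact hV.out j hj
  · by_cases hkl : k = l
    · subst hkl
      refine ⟨by omega, by omega, fun _ _ => Or.inr ⟨i, hi, by simp, hs, ?_⟩⟩
      rw [hL]
      linarith [hl.lt]
    · exact (hV.ok k hk).congr fun j _ => update_iff P hp l j k hk hkl
  · intro a ha b hb hba hbb h1 h2 hr
    rw [hbig a hba] at h1 hr
    rw [hbig b hbb] at h2 hr
    have hro : ∀ k, k ≠ 0 → k ≠ l → rank sz n (update P i l) k = rank sz n P k :=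
      fun k hk hkl => by simp only [rank, hLo k hk hkl, hNo k hk]
    have hrl : rank sz n P l = 1 := by
      unfold rank
      rw [if_neg (by omega), if_pos hl.lt]
    have hrl' : 1 ≤ rank sz n (update P i l) l := by
      unfold rank
      rw [hN, if_neg (by omega)]
      split_ifs <;> omega
    by_cases hal : P a = l
    · by_cases hbl : P b = l
      · rw [hal, hbl] at hr
        omega
      · rw [hro _ h2 hbl] at hr
        by_cases hlt : rank sz n P (P b) < 1
        · exact hV.order a ha b hb hba hbb h1 h2 (by rw [hal, hrl]; exact hlt)
        · have : ld sz n P (P b) < 1 := by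
            by_contra hc
            have : rank sz n (update P i l) (P a) ≤ 2 := by
              unfold rank; split_ifs <;> omega
            unfold rank at hr hlt
            split_ifs at hr hlt <;> omega
          obtain ⟨_, b', hb', hbb', hP', hle⟩ := hV.exists_target_big h0 hl hb h2 this hbl
          rwa [eq_of_nb_le_one hN1 ha hb' hal hP' hba hbb']
    · rw [hro _ h1 hal] at hr
      refine hV.order a ha b hb hba hbb h1 h2 (lt_of_le_of_lt ?_ hr)
      by_cases hbl : P b = l
      · rw [hbl, hrl]
        exact hrl'
      · rw [hro _ h2 hbl]
  · intro a ha b hb hsa h1 h2 h3 h4 h5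
    have hback : ∀ j, update P i l j ≠ 0 → update P i l j ≠ l →
        j ≠ i ∧ P j ≠ 0 ∧ P j ≠ l ∧ update P i l j = P j := fun j hj hjl => by
      have : j ≠ i := by
        rintro rfl
        simp at hjl
      rw [update_of_ne this] at hj hjl ⊢
      exact ⟨this, hj, hjl, rfl⟩
    by_cases hal : update P i l a = l
    · rw [hal] at h5 ⊢
      obtain ⟨_, h6, h7, h8⟩ := hback b h2 h5
      rw [h8, hLo _ h6 h7] at h4
      obtain ⟨h9, b', hb', hbb', hP', hle⟩ := hV.exists_target_big h0 hl hb h6 h4 h7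
      exact ⟨h9, b', hb', hbb', by rw [hbig b' hbb', hP'], hle⟩
    · obtain ⟨_, h6, h7, h8⟩ := hback a h1 hal
      rw [h8, hLo _ h6 h7] at h3
      by_cases hbl : update P i l b = l
      · exact absurd (hV.exists_target_big h0 hl ha h6 h3 h7).1 hsa
      · obtain ⟨_, h6', h7', h8'⟩ := hback b h2 hbl
        rw [h8', hLo _ h6' h7'] at h4
        rw [h8, h8'] at h5
        obtain ⟨h9, b', hb', hbb', hP', hle⟩ := hV.opn a ha b hb hsa h6 h6' h3 h4 h5
        exact ⟨h9, b', hb', hbb', by rw [hbig b' hbb', hP', h8], hle⟩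
  · intro k hk h1 h2 j hj hbj h3
    rw [hbig j hbj] at h3 ⊢
    refine le_trans ?_ (hLge _ h3)
    rw [hNo k hk] at h1
    -- If the target has no big item, a single elsewhere would force a big item into it by
    -- `Valid.exists_target_big`.
    by_cases hkl : k = l
    · subst hkl
      by_contra hc
      push Not at hc
      have h4 : P j ≠ k := fun h => by
        have := one_le_nb hj h hbj
        omega
      obtain ⟨_, b', hb', hbb', hP', hle⟩ := hV.exists_target_big h0 hl hj h3 hc h4
      have := one_le_nb hb' hP' hbb'
      omega
    · rw [hLo k hk hkl] at h2
      exact hV.closed k hk h1 h2 j hj hbj h3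

include h0 hl hi hs hp in
theorem NoSingle.insert (h : NoSingle sz n P) : NoSingle sz n (update P i l) := by
  intro j hj hb h1
  have hij : j ≠ i := by
    rintro rfl
    exact hs hb
  rw [update_of_ne hij] at h1 ⊢
  have := h j hj hb h1
  by_cases hjl : P j = l
  · rw [hjl, hl.ld_update hi hp]
    rw [hjl] at this
    linarith [h0 i hi]
  · rwa [ld_update_of_ne' hp h1 hjl]

include h0 hl hi hs hp in
theorem labelSum_chi_insert (hlt : l < F) :
    labelSum chi sz n P F ≤ labelSum chi sz n (update P i l) F := by
  rw [labelSum_congr (P := P) (Q := update P i l) chi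
    (mem_Ico.2 ⟨Nat.one_le_iff_ne_zero.2 hl.ne, hlt⟩)
    fun j _ k hk hkl => update_iff P hp l j k hk hkl]
  rw [hl.nb_update hi hs hp]
  have := nb_le_one h0 hl.lt
  have := hl.lt
  unfold chi
  split_ifs <;> first | omega | grind

include h0 hl hi hs hp in
theorem labelSum_psi_insert (hlt : l < F) (hε : 0 ≤ ε) :
    labelSum (psi ε) sz n (update P i l) F ≤ labelSum (psi ε) sz n P F + sz i ∧
    (sz i < ε → labelSum (psi ε) sz n (update P i l) F ≤ labelSum (psi ε) sz n P F) ∧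
    (NoSingle sz n P → labelSum (psi ε) sz n (update P i l) F ≤ labelSum (psi ε) sz n P F) := by
  rw [labelSum_congr (P := P) (Q := update P i l) (psi ε)
    (mem_Ico.2 ⟨Nat.one_le_iff_ne_zero.2 hl.ne, hlt⟩)
    fun j _ k hk hkl => update_iff P hp l j k hk hkl]
  rw [hl.nb_update hi hs hp, hl.ld_update hi hp]
  have h1 := nb_le_one h0 hl.lt
  have h2 := hl.lt
  have h3 := h0 i hi
  have h4 : NoSingle sz n P → nb sz n P l = 0 := fun h => by
    by_contra hc
    obtain ⟨j, hj, hP, hb⟩ := exists_big hc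
    have := h j hj hb (hP ▸ hl.ne)
    rw [hP] at this
    linarith
  obtain ⟨h5, h6, h7⟩ := psi_add_sub (ε := ε) h1 h2 h3 hε
  exact ⟨by linarith, fun h => by linarith [h6 h], fun h => by linarith [h7 (h4 h)]⟩
end

end

/-! ### Insertion of all items of the pool. -/

noncomputable section

variable {sz : ℕ → ℝ} {n i j k a l F F' fr : ℕ} {P Q : ℕ → ℕ} {ε : ℝ} {s s' s'' : State}

/-- The state `s'` arises from `s` by insertions of small items. -/
structure Extends (ε : ℝ) (sz : ℕ → ℝ) (n : ℕ) (s s' : State) : Prop where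
  valid : Valid sz n s'.1 s'.2
  keep : ∀ i, s.1 i ≠ 0 → s'.1 i = s.1 i
  chi : labelSum chi sz n s.1 s.2 ≤ labelSum chi sz n s'.1 s'.2
  -- The volume that leaves the pool pays for the growth of `psi`. The last two fields are the
  -- situations in which `psi` does not grow at all.
  psi : labelSum (psi ε) sz n s'.1 s'.2 + ld sz n s'.1 0 ≤
    labelSum (psi ε) sz n s.1 s.2 + ld sz n s.1 0
  noSingle : NoSingle sz n s.1 → NoSingle sz n s'.1 ∧
    labelSum (BinCovering.psi ε) sz n s'.1 s'.2 ≤ labelSum (BinCovering.psi ε) sz n s.1 s.2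
  tiny : (∀ i < n, s.1 i = 0 → sz i < ε) →
    labelSum (BinCovering.psi ε) sz n s'.1 s'.2 ≤ labelSum (BinCovering.psi ε) sz n s.1 s.2

theorem Extends.refl (h : Valid sz n s.1 s.2) : Extends ε sz n s s :=
  ⟨h, fun _ _ => rfl, le_rfl, le_rfl, fun h => ⟨h, le_rfl⟩, fun _ => le_rfl⟩

theorem Extends.trans (h : Extends ε sz n s s') (h' : Extends ε sz n s' s'') :
    Extends ε sz n s s'' where
  valid := h'.valid
  keep i hi := by rw [h'.keep i (by rw [h.keep i hi]; exact hi), h.keep i hi]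
  chi := h.chi.trans h'.chi
  psi := h'.psi.trans h.psi
  noSingle hs := ⟨(h'.noSingle (h.noSingle hs).1).1,
    (h'.noSingle (h.noSingle hs).1).2.trans (h.noSingle hs).2⟩
  tiny ht := (h'.tiny fun i hi h0 => ht i hi (by
    by_contra hc
    rw [h.keep i hc] at h0
    exact hc h0)).trans (h.tiny ht)

theorem Valid.one_le (h : Valid sz n P fr) : 1 ≤ fr := by
  have := h.lt n
  omega

theorem Valid.mono (h : Valid sz n P fr) (hF : fr ≤ F) : Valid sz n P F :=
  ⟨fun i => (h.lt i).trans_le hF, h.out, h.ok, h.order, h.opn, h.closed⟩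

/-- If no uncovered bin is in use, the fresh label is itself a target, of load `0`; both branches
are thereby treated alike. -/
theorem insertItem_eq (hV : Valid sz n P fr) (hp : P i = 0) :
    ∃ l fr', insertItem sz n i (P, fr) = (update P i l, fr') ∧ IsTarget sz n P l ∧ l < fr' ∧
      fr ≤ fr' := by
  unfold insertItem
  simp only [hp, if_true]
  split_ifs with h
  · refine ⟨fr, fr + 1, rfl, ⟨?_, ?_, ?_⟩, by omega, by omega⟩
    · have := hV.one_le
      omega
    · have : ld sz n P fr = 0 := binSum_empty _ fun j hj => (hV.lt j).ne
      rw [this]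
      exact one_pos
    · intro j hj h1 h2
      exact absurd ⟨h1, h2⟩ (pick_eq_zero h j hj)
  · obtain ⟨h1, ⟨h2, h3⟩, h4⟩ := pick_pos h
    exact ⟨_, fr, rfl, ⟨h2, h3, fun j hj h5 h6 => h4 j hj ⟨h5, h6⟩⟩, hV.lt _, le_rfl⟩

theorem extends_insertItem (h0 : ∀ i < n, 0 < sz i) (hε : 0 ≤ ε) (hV : Valid sz n s.1 s.2)
    (hi : i < n) (hs : s.1 i = 0 → ¬ Big (sz i)) :
    Extends ε sz n s (insertItem sz n i s) ∧ (insertItem sz n i s).1 i ≠ 0 := by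
  obtain ⟨P, fr⟩ := s
  by_cases hp : P i = 0
  · obtain ⟨l, fr', he, hl, hlt, hfr⟩ := insertItem_eq hV hp
    have hs' := hs hp
    rw [he]
    have hX : labelSum chi sz n P fr' = labelSum chi sz n P fr :=
      labelSum_extend chi chi_zero hV.one_le (fun i _ => hV.lt i) hfr
    have hY : labelSum (psi ε) sz n P fr' = labelSum (psi ε) sz n P fr :=
      labelSum_extend (psi ε) psi_zero hV.one_le (fun i _ => hV.lt i) hfr
    obtain ⟨h1, h2, h3⟩ := labelSum_psi_insert h0 hl hi hs' hp hlt hε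
    have hpool := binSum_take sz hi (P := P) (a := l) (by rw [hp]; exact hl.ne)
    rw [hp] at hpool
    refine ⟨⟨(hV.mono hfr).insert h0 hl hi hs' hp hlt, ?_, ?_, ?_, ?_, ?_⟩, by simpa using hl.ne⟩
    · intro j hj
      refine update_of_ne ?_ _ _
      rintro rfl
      exact hj hp
    · dsimp only
      rw [← hX]
      exact labelSum_chi_insert h0 hl hi hs' hp hlt
    · dsimp only [ld] at *
      linarith
    · intro h
      refine ⟨h.insert h0 hl hi hs' hp, ?_⟩
      dsimp only
      linarith [h3 h]
    · intro h
      dsimp only at *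
      linarith [h2 (h i hi hp)]
  · unfold insertItem
    rw [if_neg hp]
    exact ⟨.refl hV, hp⟩

theorem extends_insertUpTo (h0 : ∀ i < n, 0 < sz i) (hε : 0 ≤ ε) (hV : Valid sz n s.1 s.2)
    (hs : ∀ i < n, s.1 i = 0 → ¬ Big (sz i)) (hj : j ≤ n) :
    Extends ε sz n s (insertUpTo sz n s j) ∧ ∀ i < j, (insertUpTo sz n s j).1 i ≠ 0 := by
  induction j with
  | zero => exact ⟨.refl hV, by simp⟩
  | succ j ih =>
    obtain ⟨h1, h2⟩ := ih (by omega)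
    obtain ⟨h3, h4⟩ := extends_insertItem (i := j) h0 hε h1.valid (by omega) fun h => hs j (by omega)
      (by
        by_contra hc
        rw [h1.keep j hc] at h
        exact hc h)
    refine ⟨h1.trans h3, fun i hi => ?_⟩
    rcases Nat.lt_succ_iff_lt_or_eq.1 hi with hi | rfl
    · have := h2 i hi
      have h5 := h3.keep i this
      rw [insertUpTo, h5]
      exact this
    · exact h4

end

noncomputable section

variable {sz : ℕ → ℝ} {n i j k a b c l F F' fr fr' : ℕ} {P Q : ℕ → ℕ} {ε : ℝ} {s s' s'' : State}

/-! ## Moving big items -/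

/-- The invariants of single bins, in a state where uncovered bins contain no small items. -/
structure Tidy (sz : ℕ → ℝ) (n : ℕ) (P : ℕ → ℕ) (fr : ℕ) : Prop where
  lt : ∀ i, P i < fr
  out : ∀ i, n ≤ i → P i = 0
  ok : ∀ k, k ≠ 0 → LabelOK sz n P k
  pure : ∀ i < n, ¬ Big (sz i) → P i ≠ 0 → 1 ≤ ld sz n P (P i)

/-- Big items in bins of higher rank are larger. -/
def Ordered (sz : ℕ → ℝ) (n : ℕ) (P : ℕ → ℕ) : Prop :=
  ∀ i < n, ∀ j < n, Big (sz i) → Big (sz j) → P i ≠ 0 → P j ≠ 0 →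
    rank sz n P (P j) < rank sz n P (P i) → sz j ≤ sz i

/-- Some covered bin contains only small items. -/
def HasSmall (sz : ℕ → ℝ) (n : ℕ) (P : ℕ → ℕ) : Prop :=
  ∃ k, k ≠ 0 ∧ nb sz n P k = 0 ∧ 1 ≤ ld sz n P k

theorem Tidy.valid (h : Tidy sz n P fr) (ho : Ordered sz n P)
    (hc : HasSmall sz n P → NoSingle sz n P) : Valid sz n P fr :=
  ⟨h.lt, h.out, h.ok, ho, fun i hi _ _ hb h1 _ h2 => absurd (h.pure i hi hb h1) (not_le.2 h2),
    fun k hk h1 h2 => hc ⟨k, hk, h1, h2⟩⟩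

theorem Tidy.one_le (h : Tidy sz n P fr) : 1 ≤ fr := by
  have := h.lt n
  omega

/-- The contents of the bins other than `l` are the same. -/
def SameOff (n l : ℕ) (P Q : ℕ → ℕ) : Prop :=
  ∀ i < n, ∀ k, k ≠ 0 → k ≠ l → (Q i = k ↔ P i = k)

theorem SameOff.binSum {M : Type*} [AddCommMonoid M] (h : SameOff n l P Q) (f : ℕ → M)
    (hk : k ≠ 0) (hkl : k ≠ l) : binSum f n Q k = binSum f n P k :=
  binSum_congr fun i hi => h i hi k hk hkl

theorem SameOff.rank (h : SameOff n l P Q) (hk : k ≠ 0) (hkl : k ≠ l) :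
    rank sz n Q k = rank sz n P k := by
  unfold BinCovering.rank ld nb
  rw [h.binSum _ hk hkl, h.binSum _ hk hkl]

theorem sameOff_put (hp : P i = 0) : SameOff n l P (update P i l) :=
  fun j _ k hk hkl => update_iff P hp l j k hk hkl

theorem sameOff_take : SameOff n (P i) P (update P i 0) := fun j _ k hk hkl => by
  by_cases hj : j = i
  · subst hj
    simp only [update_self]
    omega
  · rw [update_of_ne hj]

theorem Tidy.change (h : Tidy sz n P fr) (hs : SameOff n l P Q) (hlt : ∀ i, Q i < fr')
    (hout : ∀ i, n ≤ i → Q i = 0) (hok : LabelOK sz n Q l)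
    (hpure : ∀ i < n, ¬ Big (sz i) → Q i = l → 1 ≤ ld sz n Q l) : Tidy sz n Q fr' := by
  refine ⟨hlt, hout, fun k hk => ?_, fun i hi hb h1 => ?_⟩
  · by_cases hkl : k = l
    · rwa [hkl]
    · exact (h.ok k hk).congr fun i hi => hs i hi k hk hkl
  · by_cases hkl : Q i = l
    · rw [hkl]
      exact hpure i hi hb hkl
    · have h2 := (hs i hi _ h1 hkl).1 rfl
      have h3 := h.pure i hi hb (by rw [h2]; exact h1)
      rw [h2] at h3
      rwa [ld, hs.binSum sz h1 hkl]

theorem update_lt (h : ∀ i, P i < fr) (hl : l < fr') (hF : fr ≤ fr') (j : ℕ) :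
    update P i l j < fr' := by
  by_cases hj : j = i
  · subst hj; simpa using hl
  · rw [update_of_ne hj]
    exact (h j).trans_le hF

theorem update_out (h : ∀ i, n ≤ i → P i = 0) (hi : i < n) (j : ℕ) (hj : n ≤ j) :
    update P i l j = 0 := by
  rw [update_of_ne (by omega)]
  exact h j hj

/-- The result of moving a big item: the change of the potentials and the ranks of the bins of
the big items. -/
structure Moved (sz : ℕ → ℝ) (n : ℕ) (P Q : ℕ → ℕ) (fr fr' : ℕ) (x : ℤ) (y : ℝ) (r : ℕ → ℕ) :
    Prop where
  tidy : Tidy sz n Q fr'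
  small : HasSmall sz n Q → HasSmall sz n P
  chi : labelSum chi sz n Q fr' = labelSum chi sz n P fr + x
  psi : ∀ ε, 0 ≤ ε → labelSum (psi ε) sz n Q fr' ≤ labelSum (psi ε) sz n P fr + y
  rank : ∀ i < n, Big (sz i) → Q i ≠ 0 → rank sz n Q (Q i) = r i

/-- Every elementary move alters one bin `l`, so all effects can be read off there. The hypothesis
`hsm` excludes that the move creates a covered bin of small items. -/
theorem Moved.of_tidy (h : Tidy sz n Q fr') (hP : ∀ i, P i < fr) (hF : fr ≤ fr')
    (hs : SameOff n l P Q) (hl : l ≠ 0) (hlt : l < fr') {x : ℤ} {y : ℝ} {r : ℕ → ℕ}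
    (hsm : nb sz n Q l = 0 → ld sz n Q l = 0)
    (hx : BinCovering.chi (ld sz n Q l) (nb sz n Q l) =
      BinCovering.chi (ld sz n P l) (nb sz n P l) + x)
    (hy : ∀ ε, 0 ≤ ε → BinCovering.psi ε (ld sz n Q l) (nb sz n Q l) ≤
      BinCovering.psi ε (ld sz n P l) (nb sz n P l) + y)
    (hr : ∀ i < n, Big (sz i) → Q i = l → BinCovering.rank sz n Q l = r i)
    (hr' : ∀ i < n, Big (sz i) → Q i ≠ 0 → Q i ≠ l → BinCovering.rank sz n P (P i) = r i) :
    Moved sz n P Q fr fr' x y r := by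
  have h1 : 1 ≤ fr := by
    have := hP 0
    omega
  have hl' : l ∈ Ico 1 fr' := mem_Ico.2 ⟨by omega, hlt⟩
  refine ⟨h, ?_, ?_, fun ε hε => ?_, fun i hi hb h2 => ?_⟩
  · rintro ⟨k, hk, h2, h3⟩
    by_cases hkl : k = l
    · rw [hkl] at h2 h3
      linarith [hsm h2]
    · rw [nb, hs.binSum _ hk hkl] at h2
      rw [ld, hs.binSum _ hk hkl] at h3
      exact ⟨k, hk, h2, h3⟩
  · rw [labelSum_congr BinCovering.chi hl' hs,
      labelSum_extend BinCovering.chi chi_zero h1 (fun i _ => hP i) hF]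
    linarith
  · rw [labelSum_congr (BinCovering.psi ε) hl' hs,
      labelSum_extend (BinCovering.psi ε) psi_zero h1 (fun i _ => hP i) hF]
    linarith [hy ε hε]
  · by_cases h3 : Q i = l
    · rw [h3, hr i hi hb h3]
    · rw [← hr' i hi hb h2 h3, hs.rank h2 h3, (hs i hi _ h2 h3).1 rfl]

/-- A big item without a bin is put into a new bin. -/
theorem Tidy.putNew (h : Tidy sz n P fr) (hc : c < n) (hb : Big (sz c)) (hp : P c = 0)
    (hl : l ≠ 0) (he : ∀ i < n, P i ≠ l) (hlt : l < fr') (hF : fr ≤ fr') (h1 : sz c ≤ 1) :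
    Moved sz n P (update P c l) fr fr' (if sz c < 1 then -1 else 0) (-1 / 2)
      (fun a => if a = c then (if sz c < 1 then 1 else 2) else rank sz n P (P a)) := by
  have hL : ld sz n (update P c l) l = sz c := by
    rw [ld, binSum_put sz hc (by omega), binSum_empty sz he, zero_add]
  have hN : nb sz n (update P c l) l = 1 := by
    rw [nb, binSum_put _ hc (by omega), binSum_empty _ he, bigInd_of_big hb]
  have hall : ∀ i < n, update P c l i = l → i = c := fun i hi hP => by
    by_contra hic
    rw [update_of_ne hic] at hP
    exact he i hi hP
  refine .of_tidy (l := l) (h.change (sameOff_put hp) (update_lt h.lt hlt hF) (update_out h.out hc)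
    ⟨by omega, by omega, fun _ _ => Or.inl fun i hi hP => ?_⟩ fun i hi hs hP => ?_)
    h.lt hF (sameOff_put hp) hl hlt (by omega) ?_ ?_ ?_ ?_
  · rwa [hall i hi hP]
  · rw [hall i hi hP] at hs
    exact absurd hb hs
  · rw [hL, hN, ld, nb, binSum_empty _ he, binSum_empty _ he]
    simp [chi]
  · intro ε hε
    rw [hL, hN, ld, nb, binSum_empty _ he, binSum_empty _ he]
    simp only [psi, OfNat.one_ne_ofNat, if_false, if_true]
    simp only [OfNat.zero_ne_ofNat, if_false, zero_ne_one]
    -- An item of size `1` covers its new bin and contributes `-1/2 - ε`; all other big items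
    -- contribute `-1/2`.
    split_ifs <;> linarith
  · intro i hi _ hP
    rw [rank, hN, hL, hall i hi hP]
    simp
  · intro i hi _ h2 h3
    rw [if_neg (by rintro rfl; simp at h3)]

/-- A big item leaves its bin with two big items. -/
theorem Tidy.takePaired (h : Tidy sz n P fr) (hc : c < n)
    (hp : P c ≠ 0) (hN : nb sz n P (P c) = 2) :
    Moved sz n P (update P c 0) fr fr (-2) (-1)
      (fun a => if P a = P c then 1 else rank sz n P (P a)) := by
  have hok := h.ok (P c) hp
  have hb := (hok.2.1 hN c hc rfl).1
  have hN' : nb sz n (update P c 0) (P c) = 1 := by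
    have := binSum_take (bigInd sz) hc (P := P) (a := 0) hp.symm
    rw [bigInd_of_big hb] at this
    unfold nb at *
    omega
  -- The partner `z` stays behind alone and becomes a single because `sz z < 1`.
  obtain ⟨z, hz, hzc, hPz, hbz⟩ := exists_big_ne (sz := sz) (P := P) hN.ge hc rfl
  have hall : ∀ i < n, update P c 0 i = P c → i = z := fun i hi hP => by
    by_contra hiz
    have hic : i ≠ c := by
      rintro rfl
      rw [update_self] at hP
      exact hp hP.symm
    rw [update_of_ne hic] at hP
    have h3 := two_le_nb (P := update P c 0) hi hz hiz (by rw [update_of_ne hic, hP])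
      (by rw [update_of_ne hzc, hPz]) (hok.2.1 hN i hi hP).1 hbz
    omega
  have hL : ld sz n (update P c 0) (P c) = sz z :=
    ld_eq_of_forall hz (by rw [update_of_ne hzc, hPz]) hall
  have hz1 := (hok.2.1 hN z hz hPz).2
  refine .of_tidy (l := P c) (h.change sameOff_take (update_lt h.lt h.one_le le_rfl)
    (update_out h.out hc) ⟨by omega, by omega, fun _ _ => Or.inl fun i hi hP => ?_⟩
    fun i hi hs hP => ?_) h.lt le_rfl sameOff_take hp (h.lt c) (by omega) ?_ ?_ ?_ ?_
  · rwa [hall i hi hP]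
  · rw [hall i hi hP] at hs
    exact absurd hbz hs
  · rw [hL, hN', hN]
    simp [chi, hz1]
  · intro ε hε
    rw [hL, hN', hN]
    simp only [psi, OfNat.one_ne_ofNat, if_false, if_true, hz1]
    norm_num
  · intro i hi _ hP
    have hic : i ≠ c := by
      rintro rfl
      rw [update_self] at hP
      exact hp hP.symm
    rw [update_of_ne hic] at hP
    rw [rank, hN', hL, if_neg (by omega), if_pos hz1, if_pos hP]
  · intro i hi _ h2 h3
    have hic : i ≠ c := by
      rintro rfl
      simp at h2
    rw [update_of_ne hic] at h3
    rw [if_neg h3]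

/-- In a tidy state an uncovered bin has no small items, and two big items would cover it. -/
theorem Tidy.eq_of_uncovered (h : Tidy sz n P fr) (h0 : ∀ i < n, 0 < sz i) (hc : c < n)
    (hi : i < n) (hp : P c ≠ 0) (hL : ld sz n P (P c) < 1) (hP : P i = P c) :
    Big (sz i) ∧ i = c := by
  have hb : ∀ i < n, P i = P c → Big (sz i) := fun i hi hP => by
    by_contra hb
    have := h.pure i hi hb (by rwa [hP])
    rw [hP] at this
    linarith
  exact ⟨hb i hi hP, eq_of_nb_le_one (nb_le_one h0 hL) hi hc hP rfl (hb i hi hP) (hb c hc rfl)⟩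

theorem Tidy.single (h : Tidy sz n P fr) (h0 : ∀ i < n, 0 < sz i) (hc : c < n)
    (hp : P c ≠ 0) (hL : ld sz n P (P c) < 1) :
    nb sz n P (P c) = 1 ∧ ld sz n P (P c) = sz c ∧ sz c < 1 := by
  have h1 := one_le_nb (P := P) hc rfl (h.eq_of_uncovered h0 hc hc hp hL rfl).1
  have h2 := nb_le_one h0 hL
  have h3 := ld_eq_of_forall (sz := sz) hc rfl fun i hi hP =>
    (h.eq_of_uncovered h0 hc hi hp hL hP).2
  exact ⟨by omega, h3, by linarith⟩

/-- A single big item leaves its bin. -/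
theorem Tidy.takeSingle (h : Tidy sz n P fr) (h0 : ∀ i < n, 0 < sz i) (hc : c < n)
    (hp : P c ≠ 0) (hL : ld sz n P (P c) < 1) :
    Moved sz n P (update P c 0) fr fr 1 (1 / 2) (fun a => rank sz n P (P a)) ∧
      ∀ i < n, update P c 0 i ≠ P c := by
  obtain ⟨hN, hLc, hc1⟩ := h.single h0 hc hp hL
  have hall : ∀ i < n, update P c 0 i ≠ P c := fun i hi hP => by
    by_cases hic : i = c
    · subst hic
      rw [update_self] at hP
      exact hp hP.symm
    · rw [update_of_ne hic] at hP
      exact hic (h.eq_of_uncovered h0 hc hi hp hL hP).2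
  refine ⟨.of_tidy (l := P c) (h.change sameOff_take (update_lt h.lt h.one_le le_rfl)
    (update_out h.out hc) (labelOK_of_forall_ne hall)
    fun i hi hs hP => absurd hP (hall i hi)) h.lt le_rfl sameOff_take hp (h.lt c)
    (fun _ => binSum_empty _ hall) ?_ ?_ ?_ ?_, hall⟩
  · rw [hN, hLc, ld, nb, binSum_empty _ hall, binSum_empty _ hall]
    simp [chi, hc1]
  · intro ε hε
    rw [hN, hLc, ld, nb, binSum_empty _ hall, binSum_empty _ hall]
    simp only [psi, OfNat.one_ne_ofNat, if_false, if_true, hc1]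
    norm_num
  · intro i hi _ hP
    exact absurd hP (hall i hi)
  · intro i hi _ h2 h3
    rfl

/-- A big item without a bin is put to a single big item. -/
theorem Tidy.join (h : Tidy sz n P fr) (h0 : ∀ i < n, 0 < sz i) (hc : c < n) (hb : Big (sz c))
    (hp : P c = 0) (hc1 : sz c < 1) (hj : j < n) (hp' : P j ≠ 0) (hL : ld sz n P (P j) < 1) :
    Moved sz n P (update P c (P j)) fr fr 2 1
      (fun a => if a = c ∨ a = j then 0 else rank sz n P (P a)) := by
  obtain ⟨hN, hLj, hj1⟩ := h.single h0 hj hp' hL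
  have hbj := (h.eq_of_uncovered h0 hj hj hp' hL rfl).1
  have hL' : ld sz n (update P c (P j)) (P j) = sz j + sz c := by
    rw [ld, binSum_put sz hc (by omega), ← hLj]
  have hN' : nb sz n (update P c (P j)) (P j) = 2 := by
    have := binSum_put (bigInd sz) hc (P := P) (k := P j) (by omega)
    rw [bigInd_of_big hb] at this
    unfold nb at *
    omega
  have hall : ∀ i < n, update P c (P j) i = P j → i = c ∨ i = j := fun i hi hP => by
    by_cases hic : i = c
    · exact Or.inl hic
    · rw [update_of_ne hic] at hP
      exact Or.inr (h.eq_of_uncovered h0 hj hi hp' hL hP).2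
  refine .of_tidy (l := P j) (h.change (sameOff_put hp) (update_lt h.lt (h.lt j) le_rfl)
    (update_out h.out hc)
    ⟨by omega, fun _ i hi hP => ?_, by omega⟩ fun i hi hs hP => ?_)
    h.lt le_rfl (sameOff_put hp) hp' (h.lt j) (by omega) ?_ ?_ ?_ ?_
  · rcases hall i hi hP with rfl | rfl
    · exact ⟨hb, hc1⟩
    · exact ⟨hbj, hj1⟩
  · rcases hall i hi hP with rfl | rfl
    · exact absurd hb hs
    · exact absurd hbj hs
  · rw [hN, hN']
    simp [chi, hL]
  · intro ε hε
    rw [hN, hN']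
    simp only [psi, OfNat.one_ne_ofNat, if_false, if_true, hL]
    norm_num
  · intro i hi _ hP
    rw [rank, hN', if_pos rfl, if_pos (hall i hi hP)]
  · intro i hi _ h2 h3
    have hic : i ≠ c := by
      rintro rfl
      simp at h3
    have hij : i ≠ j := by
      rintro rfl
      rw [update_of_ne hic] at h3
      exact h3 rfl
    simp [hic, hij]

end

noncomputable section

variable {sz : ℕ → ℝ} {n i j k a b c l F F' fr fr' : ℕ} {P Q R : ℕ → ℕ} {ε : ℝ} {s s' s'' : State}

theorem Moved.trans {f f' f'' : ℕ} {x x' : ℤ} {y y' : ℝ} {r r' r'' : ℕ → ℕ}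
    (h : Moved sz n P Q f f' x y r) (h' : Moved sz n Q R f' f'' x' y' r')
    (hr : ∀ i < n, Big (sz i) → R i ≠ 0 → r' i = r'' i) :
    Moved sz n P R f f'' (x + x') (y + y') r'' where
  tidy := h'.tidy
  small hs := h.small (h'.small hs)
  chi := by rw [h'.chi, h.chi, add_assoc]
  psi ε hε := by linarith [h.psi ε hε, h'.psi ε hε]
  rank i hi hb hR := by rw [h'.rank i hi hb hR, hr i hi hb hR]

theorem rank_paired (h : nb sz n P k = 2) : rank sz n P k = 0 := if_pos h

theorem rank_uncovered (h0 : ∀ i < n, 0 < sz i) (h : ld sz n P k < 1) : rank sz n P k = 1 := by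
  have := nb_le_one h0 h
  rw [rank, if_neg (by omega), if_pos h]

/-- A paired item and a single item exchange their places. -/
theorem Tidy.swap (h : Tidy sz n P fr) (h0 : ∀ i < n, 0 < sz i) (hi : i < n) (hj : j < n)
    (hPi : P i ≠ 0) (hPj : P j ≠ 0) (hN : nb sz n P (P i) = 2) (hL : ld sz n P (P j) < 1) :
    Moved sz n P (update (update P i (P j)) j (P i)) fr fr 0 0
      (fun a => if a = j then 0 else if a = i then 1 else rank sz n P (P a)) := by
  have hne : P i ≠ P j := fun h1 => by
    rw [h1] at hN
    have := nb_le_one h0 hL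
    omega
  have hij : i ≠ j := fun h1 => hne (h1 ▸ rfl)
  obtain ⟨hbi, hi1⟩ := (h.ok _ hPi).2.1 hN i hi rfl
  obtain ⟨z, hz, hzi, hPz, hbz⟩ := exists_big_ne (sz := sz) (P := P) hN.ge hi rfl
  have hzj : z ≠ j := by
    rintro rfl
    exact hne hPz.symm
  obtain ⟨-, -, hj1⟩ := h.single h0 hj hPj hL
  have hbj := (h.eq_of_uncovered h0 hj hj hPj hL rfl).1
  -- The exchange is composed of four elementary moves: `i` leaves its pair, `j` leaves its bin, `j`
  -- joins the partner `z`, and `i` enters the emptied bin of `j`. The changes `-2 + 1 + 2 - 1` of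
  -- `chi` and `-1 + 1/2 + 1 - 1/2` of `psi` cancel.
  have m1 := h.takePaired hi hPi hN
  set A := update P i 0 with hA
  have hAj : A j = P j := update_of_ne hij.symm _ _
  have hAz : A z = P i := by rw [hA, update_of_ne hzi, hPz]
  have hLA : ld sz n A (A j) < 1 := by
    rw [hAj, ld, (sameOff_take (P := P) (i := i)).binSum sz hPj hne.symm]
    exact hL
  obtain ⟨m2, he⟩ := m1.tidy.takeSingle h0 hj (by rwa [hAj]) hLA
  set B := update A j 0 with hB
  have hBz : B z = P i := by rw [hB, update_of_ne hzj, hAz]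
  have hLB : ld sz n B (B z) < 1 := by
    have h1 : rank sz n A (A z) = 1 := by
      rw [m1.rank z hz hbz (by rw [hAz]; exact hPi), if_pos hPz]
    have h2 : rank sz n B (B z) = 1 := by
      rw [m2.rank z hz hbz (by rw [hBz]; exact hPi), h1]
    unfold rank at h2
    by_contra hc
    split_ifs at h2
    omega
  have m3 := m2.tidy.join h0 hj hbj (update_self _ _ _) hj1 hz (by rwa [hBz]) hLB
  rw [hBz] at m3
  set C := update B j (P i) with hC
  have hCi : C i = 0 := by rw [hC, update_of_ne hij, hB, update_of_ne hij, hA, update_self]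
  have heC : ∀ a < n, C a ≠ P j := fun a ha => by
    by_cases haj : a = j
    · rw [haj, hC, update_self]
      exact hne
    · rw [hC, update_of_ne haj]
      have := he a ha
      rwa [hAj] at this
  have m4 := m3.tidy.putNew hi hbi hCi hPj heC (h.lt j) le_rfl hi1.le
  have hR : update C i (P j) = update (update P i (P j)) j (P i) := by
    funext a
    by_cases haj : a = j
    · rw [haj, update_of_ne hij.symm, hC, update_self, update_self]
    · by_cases hai : a = i
      · rw [hai, update_self, update_of_ne hij, update_self]
      · rw [update_of_ne hai, update_of_ne haj, update_of_ne hai, hC, update_of_ne haj, hB,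
          update_of_ne haj, hA, update_of_ne hai]
  rw [hR] at m4
  rw [if_pos hi1] at m4
  have m := ((m1.trans m2 fun _ _ _ _ => rfl).trans m3 fun _ _ _ _ => rfl).trans m4
    (r'' := fun a => if a = j then 0 else if a = i then 1 else rank sz n P (P a)) ?_
  · convert m using 1 <;> norm_num
  intro a ha hb hRa
  have hzr : rank sz n C (P i) = 0 := by
    have h1 := m3.rank z hz hbz
    rw [hC, update_of_ne hzj, hBz, ← hC] at h1
    rw [h1 hPi, if_pos (Or.inr rfl)]
  by_cases haj : a = j
  · rw [if_neg (by omega), if_pos haj, haj, hC, update_self, ← hC, hzr]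
  · rw [if_neg haj]
    by_cases hai : a = i
    · simp [hai, hi1]
    · rw [if_neg hai, if_neg hai]
      rw [update_of_ne haj, update_of_ne hai] at hRa
      have hAa : A a = P a := by rw [hA, update_of_ne hai]
      have hBa : B a = P a := by rw [hB, update_of_ne haj, hAa]
      have hCa : C a = P a := by rw [hC, update_of_ne haj, hBa]
      rw [hCa]
      by_cases haP : P a = P i
      · rw [haP, hzr, rank_paired hN]
      · have haz : a ≠ z := by
          rintro rfl
          exact haP hPz
        have h3 := m3.rank a ha hb (by rwa [hCa])
        have h2 := m2.rank a ha hb (by rwa [hBa])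
        have h1 := m1.rank a ha hb (by rwa [hAa])
        rw [hCa, if_neg (by omega)] at h3
        rw [if_neg haP] at h1
        rw [h3, h2, h1]

/-! ## Rebalancing -/

/-- At most one of the two counted indices is the excluded one. The shift by one matches `pick`, so
that `e = 0` excludes nothing. -/
theorem exists_of_two_le_sum {C : ℕ → Prop} [DecidablePred C]
    (h : 2 ≤ ∑ i ∈ range n, if C i then 1 else 0) (e : ℕ) :
    ∃ i < n, C i ∧ i + 1 ≠ e := by
  by_contra hc
  push Not at hc
  have : ∑ i ∈ range n, (if C i then 1 else 0) ≤ ∑ i ∈ range n, if i = e - 1 then 1 else 0 := by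
    refine sum_le_sum fun i hi => ?_
    split_ifs with h1 h2
    · exact le_rfl
    · have := hc i (mem_range.1 hi) h1
      omega
    · exact Nat.zero_le _
    · exact le_rfl
  rw [sum_ite_eq'] at this
  split_ifs at this <;> omega

/-- Double counting of the big items by item and by bin; a pair contains two of them, whence the
factor `2`. -/
theorem two_mul_labelSum_chi (h0 : ∀ i < n, 0 < sz i) (hT : Tidy sz n P fr)
    (hp : ∀ i < n, P i = 0 → ¬ Big (sz i)) :
    2 * labelSum chi sz n P fr = numPaired sz n P - 2 * numSingle sz n P := by
  let g : ℕ → ℤ := fun k =>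
    (if 2 ≤ nb sz n P k then 1 else 0) - 2 * (if ld sz n P k < 1 then 1 else 0)
  have h1 : (numPaired sz n P - 2 * numSingle sz n P : ℤ) =
      ∑ i ∈ range n, if Big (sz i) then g (P i) else 0 := by
    unfold numPaired numSingle
    push_cast
    rw [mul_sum, ← sum_sub_distrib]
    refine sum_congr rfl fun i _ => ?_
    by_cases hb : Big (sz i) <;> simp [hb, g]
  have h2 : ∀ i ∈ range n, (if Big (sz i) then g (P i) else 0) =
      ∑ k ∈ Ico 1 fr, (if P i = k then (bigInd sz i : ℤ) else 0) * g k := fun i hi => by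
    simp only [ite_mul, zero_mul]
    rw [sum_ite_eq]
    by_cases hb : Big (sz i)
    · have : P i ≠ 0 := fun h => hp i (mem_range.1 hi) h hb
      rw [if_pos hb, if_pos (mem_Ico.2 ⟨by omega, hT.lt i⟩), bigInd_of_big hb]
      simp
    · simp [hb, bigInd_of_small hb]
  rw [h1, sum_congr rfl h2, sum_comm, labelSum, mul_sum]
  refine sum_congr rfl fun k hk => ?_
  rw [← sum_mul]
  have h3 : ∑ i ∈ range n, (if P i = k then (bigInd sz i : ℤ) else 0) = nb sz n P k := by
    simp [nb, binSum]
  rw [h3]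
  have hk' := mem_Ico.1 hk
  have h4 := (hT.ok k (by omega)).1
  have h5 := @one_le_ld_of_nb sz n k P h0
  dsimp only [g]
  unfold chi
  generalize nb sz n P k = b at *
  interval_cases b
  · simp
  · split_ifs <;> simp_all
  · simp [h5 le_rfl]

/-- Pairs and singles give equality, and a mixed bin contributes a nonpositive amount since its load
is below `3/2`. -/
theorem two_mul_labelSum_psi (h1 : ∀ i < n, sz i ≤ 1) (hε : 0 ≤ ε)
    (hT : Tidy sz n P fr) : 2 * labelSum (psi ε) sz n P fr ≤ labelSum chi sz n P fr := by
  unfold labelSum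
  push_cast
  rw [mul_sum]
  refine sum_le_sum fun k hk => ?_
  have hk' := mem_Ico.1 hk
  have h4 := (hT.ok k (by omega)).1
  have h5 := (hT.ok k (by omega)).ld_lt h1
  unfold psi chi
  generalize nb sz n P k = b at *
  interval_cases b
  · simp
  · simp only [OfNat.one_ne_ofNat, if_false, if_true, true_and]
    have := h5 le_rfl
    split_ifs
    · norm_num
    · push_cast
      linarith
  · simp

theorem pickSingle_pos {e : ℕ} (h : pickSingle sz n P e ≠ 0) :
    pickSingle sz n P e - 1 < n ∧ Big (sz (pickSingle sz n P e - 1)) ∧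
      ld sz n P (P (pickSingle sz n P e - 1)) < 1 ∧ pickSingle sz n P e ≠ e ∧
      ∀ j < n, Big (sz j) → ld sz n P (P j) < 1 → j + 1 ≠ e →
        sz (pickSingle sz n P e - 1) ≤ sz j := by
  obtain ⟨h1, ⟨h2, h3, h4⟩, h5⟩ := pick_pos h
  refine ⟨h1, h2, h3, ?_, fun j hj hb hL he => ?_⟩
  · unfold pickSingle at *
    omega
  · have h6 := h5 j hj ⟨hb, hL, he⟩
    unfold pickSingle
    linarith

theorem rank_pair_cases (h0 : ∀ i < n, 0 < sz i) (hT : Tidy sz n P fr) (hk : k ≠ 0) :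
    (rank sz n P k = 0 ∧ nb sz n P k = 2 ∧ 1 ≤ ld sz n P k) ∨
      (rank sz n P k = 1 ∧ ld sz n P k < 1) ∨
      (rank sz n P k = 2 ∧ nb sz n P k ≤ 1 ∧ 1 ≤ ld sz n P k) := by
  have h1 := (hT.ok k hk).1
  have h2 := @one_le_ld_of_nb sz n k P h0
  unfold rank
  split_ifs with h3 h4
  · exact Or.inl ⟨rfl, h3, h2 (by omega)⟩
  · exact Or.inr (Or.inl ⟨rfl, h4⟩)
  · exact Or.inr (Or.inr ⟨rfl, by omega, by linarith⟩)

/-- The order survives because the two smallest singles are the ones that become paired. Two terms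
`-1` of `chi` turn into one term `1`, whence the change `3`. -/
theorem pairUp_spec (h0 : ∀ i < n, 0 < sz i) (hT : Tidy sz n P fr) (ho : Ordered sz n P)
    (hp : ∀ i < n, P i = 0 → ¬ Big (sz i)) (h2 : 2 ≤ numSingle sz n P) :
    (∃ r, Moved sz n P (pairUp sz n P) fr fr 3 (3 / 2) r) ∧ Ordered sz n (pairUp sz n P) ∧
      ∃ j < n, ∃ l ≠ 0, P j ≠ 0 ∧ pairUp sz n P = update P j l := by
  have hj1 : pickSingle sz n P 0 ≠ 0 := fun h => by
    obtain ⟨i, hi, ⟨h3, h4⟩, h5⟩ := exists_of_two_le_sum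
      (C := fun i => Big (sz i) ∧ ld sz n P (P i) < 1) h2 0
    exact pick_eq_zero h i hi ⟨h3, h4, h5⟩
  have hj2 : pickSingle sz n P (pickSingle sz n P 0) ≠ 0 := fun h => by
    obtain ⟨i, hi, ⟨h3, h4⟩, h5⟩ := exists_of_two_le_sum
      (C := fun i => Big (sz i) ∧ ld sz n P (P i) < 1) h2 (pickSingle sz n P 0)
    exact pick_eq_zero h i hi ⟨h3, h4, h5⟩
  obtain ⟨hi, hbi, hLi, -, hmi⟩ := pickSingle_pos hj1
  obtain ⟨hj, hbj, hLj, hne, hmj⟩ := pickSingle_pos hj2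
  unfold pairUp
  generalize hii : pickSingle sz n P 0 = i at *
  generalize hjj : pickSingle sz n P i = j at *
  obtain ⟨i, rfl⟩ := Nat.exists_eq_add_one_of_ne_zero hj1
  obtain ⟨j, rfl⟩ := Nat.exists_eq_add_one_of_ne_zero hj2
  simp only [Nat.add_sub_cancel] at *
  have hij : i ≠ j := by omega
  have hPi : P i ≠ 0 := fun h => hp i hi h hbi
  have hPj : P j ≠ 0 := fun h => hp j hj h hbj
  obtain ⟨m1, -⟩ := hT.takeSingle h0 hi hPi hLi
  obtain ⟨-, -, hi1⟩ := hT.single h0 hi hPi hLi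
  have hAj : update P i 0 j = P j := update_of_ne hij.symm _ _
  have hPne : P j ≠ P i := fun h => hij (hT.eq_of_uncovered h0 hi hj hPi hLi h).2.symm
  have hLA : ld sz n (update P i 0) (update P i 0 j) < 1 := by
    rw [hAj, ld, (sameOff_take (P := P) (i := i)).binSum sz hPj hPne]
    exact hLj
  have m2 := m1.tidy.join h0 hi hbi (update_self _ _ _) hi1 hj (by rwa [hAj]) hLA
  rw [hAj, update_idem] at m2
  have m := m1.trans m2 (r'' := fun a => if a = i ∨ a = j then 0 else rank sz n P (P a)) (by
    intro a ha hb h3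
    split_ifs with h4
    · rfl
    · have hai : a ≠ i := fun h => h4 (Or.inl h)
      rw [m1.rank a ha hb]
      rw [update_of_ne hai]
      rwa [update_of_ne hai] at h3)
  refine ⟨⟨_, by convert m using 1 <;> norm_num⟩, ?_, i, hi, P j, hPj, hPi, rfl⟩
  intro a ha b hb hba hbb h3 h4 h5
  rw [m.rank a ha hba h3, m.rank b hb hbb h4] at h5
  have hPa : P a ≠ 0 := fun h => hp a ha h hba
  have hPb : P b ≠ 0 := fun h => hp b hb h hbb
  by_cases h6 : a = i ∨ a = j
  · rw [if_pos h6] at h5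
    omega
  · rw [if_neg h6] at h5
    push Not at h6
    by_cases h7 : b = i ∨ b = j
    · rw [if_pos h7] at h5
      have hr : rank sz n P (P b) = 1 := by
        rcases h7 with rfl | rfl
        · exact rank_uncovered h0 hLi
        · exact rank_uncovered h0 hLj
      rcases rank_pair_cases h0 hT hPa with h8 | h8 | h8
      · omega
      · rcases h7 with rfl | rfl
        · exact hmi a ha hba h8.2 (by omega)
        · exact hmj a ha hba h8.2 (by omega)
      · exact ho a ha b hb hba hbb hPa hPb (by omega)
    · rw [if_neg h7] at h5
      exact ho a ha b hb hba hbb hPa hPb h5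

end

noncomputable section

variable {sz : ℕ → ℝ} {n i j k a b c l F F' fr fr' : ℕ} {P Q R : ℕ → ℕ} {ε : ℝ} {s s' s'' : State}

theorem pickPaired_pos (hT : Tidy sz n P fr) (hp : ∀ i < n, P i = 0 → ¬ Big (sz i))
    (h : pickPaired sz n P ≠ 0) :
    pickPaired sz n P - 1 < n ∧ Big (sz (pickPaired sz n P - 1)) ∧ P (pickPaired sz n P - 1) ≠ 0 ∧
      nb sz n P (P (pickPaired sz n P - 1)) = 2 ∧
      ∀ j < n, Big (sz j) → rank sz n P (P j) = 0 → sz j ≤ sz (pickPaired sz n P - 1) := by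
  obtain ⟨h1, ⟨h2, h3⟩, h4⟩ := pick_pos h
  have h5 : P (pickPaired sz n P - 1) ≠ 0 := fun h => hp _ h1 h h2
  refine ⟨h1, h2, h5, le_antisymm (hT.ok _ h5).1 h3, fun j hj hb hr => h4 j hj ⟨hb, ?_⟩⟩
  unfold rank at hr
  split_ifs at hr
  omega

/-- The largest paired item may become single, but its former partner may be smaller than other
paired items. Exchanging the smallest single with the largest remaining paired item repairs this one
violation. The exchange is neutral for both potentials, so the change is that of turning a pair into
two singles. -/
theorem breakUp_spec (h0 : ∀ i < n, 0 < sz i) (h1 : ∀ i < n, sz i ≤ 1) (hT : Tidy sz n P fr)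
    (ho : Ordered sz n P) (hp : ∀ i < n, P i = 0 → ¬ Big (sz i)) (h2 : 2 ≤ numPaired sz n P) :
    (∃ r, Moved sz n P (breakUp sz n P fr) fr (fr + 1) (-3) (-3 / 2) r) ∧
      Ordered sz n (breakUp sz n P fr) ∧ (∀ i, breakUp sz n P fr i = 0 ↔ P i = 0) ∧
      ∃ i < n, ∃ j < n, ∃ k < n, ∀ a, a ≠ i → a ≠ j → a ≠ k → breakUp sz n P fr a = P a := by
  have hfr := hT.one_le
  have hi0 : pickPaired sz n P ≠ 0 := fun h => by
    obtain ⟨i, hi, h3, -⟩ := exists_of_two_le_sum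
      (C := fun i => Big (sz i) ∧ 2 ≤ nb sz n P (P i)) h2 0
    exact pick_eq_zero h i hi h3
  obtain ⟨hi, hbi, hPi, hNi, hmi⟩ := pickPaired_pos hT hp hi0
  unfold breakUp
  dsimp only
  generalize pickPaired sz n P - 1 = i at *
  have m1 := hT.takePaired hi hPi hNi
  have m2 := m1.tidy.putNew (l := fr) (fr' := fr + 1) hi hbi (update_self _ _ _) (by omega)
    (fun a _ => (m1.tidy.lt a).ne) (by omega) (by omega) (h1 i hi)
  rw [update_idem, if_pos ((hT.ok _ hPi).2.1 hNi i hi rfl).2] at m2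
  have m := m1.trans m2
    (r'' := fun a => if a = i ∨ P a = P i then 1 else rank sz n P (P a)) (by
    intro a ha hb h3
    by_cases hai : a = i
    · simp [hai, ((hT.ok _ hPi).2.1 hNi i hi rfl).2]
    · rw [update_of_ne hai] at h3
      have := m1.rank a ha hb (by rwa [update_of_ne hai])
      simp only [hai, if_false, false_or]
      rw [this])
  set Q := update P i fr with hQ
  have hQ0 : ∀ a, Q a = 0 ↔ P a = 0 := fun a => by
    by_cases hai : a = i
    · rw [hai, hQ, update_self]
      omega
    · rw [hQ, update_of_ne hai]
  have hpQ : ∀ i < n, Q i = 0 → ¬ Big (sz i) := fun a ha h => hp a ha ((hQ0 a).1 h)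
  have hrQ : ∀ a < n, Big (sz a) →
      rank sz n Q (Q a) = if a = i ∨ P a = P i then 1 else rank sz n P (P a) :=
    fun a ha hb => m.rank a ha hb fun h => hpQ a ha h hb
  have hP0 : ∀ a < n, Big (sz a) → P a ≠ 0 := fun a ha hb h => hp a ha h hb
  have hj0 : pickSingle sz n Q 0 ≠ 0 := fun h => by
    refine pick_eq_zero h i hi ⟨hbi, ?_, by omega⟩
    have h3 := hrQ i hi hbi
    rw [if_pos (Or.inl rfl)] at h3
    unfold rank at h3
    by_contra hc
    split_ifs at h3
    omega
  obtain ⟨hj, hbj, hLj, -, hmj⟩ := pickSingle_pos hj0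
  have hi2 := pickPaired_pos m.tidy hpQ
  have hi2z : pickPaired sz n Q = 0 → ∀ b < n, Big (sz b) → rank sz n Q (Q b) ≠ 0 :=
    fun h b hb hbb hr => by
      refine pick_eq_zero h b hb ⟨hbb, ?_⟩
      unfold rank at hr
      split_ifs at hr
      omega
  generalize pickSingle sz n Q 0 - 1 = j at *
  generalize pickPaired sz n Q = i2 at *
  have hr2 : ∀ a < n, ∀ b < n, Big (sz a) → Big (sz b) → rank sz n Q (Q a) = 2 →
      rank sz n Q (Q b) < 2 → sz b ≤ sz a := fun a ha b hb hba hbb h3 h4 => by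
    rw [hrQ a ha hba] at h3
    rw [hrQ b hb hbb] at h4
    by_cases h5 : a = i ∨ P a = P i
    · rw [if_pos h5] at h3
      omega
    rw [if_neg h5] at h3
    refine ho a ha b hb hba hbb (hP0 a ha hba) (hP0 b hb hbb) ?_
    by_cases h6 : b = i ∨ P b = P i
    · rcases h6 with rfl | h6
      · rw [rank_paired hNi]; omega
      · rw [h6, rank_paired hNi]; omega
    · rw [if_neg h6] at h4
      omega
  have hL1 : ∀ a < n, Big (sz a) → rank sz n Q (Q a) = 1 → ld sz n Q (Q a) < 1 :=
    fun a ha hba h => by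
      rcases rank_pair_cases h0 m.tidy (fun h => hpQ a ha h hba) with h3 | h3 | h3
      · omega
      · exact h3.2
      · omega
  unfold exchange
  by_cases hex : 1 ≤ i2 ∧ sz j < sz (i2 - 1)
  · rw [if_pos hex]
    obtain ⟨hi2n, hbi2, hQi2, hNi2, hmi2⟩ := hi2 (by omega)
    have hlt := hex.2
    generalize i2 - 1 = e at *
    have hQj : Q j ≠ 0 := fun h => hpQ j hj h hbj
    have ms := m.tidy.swap h0 hi2n hj hQi2 hQj hNi2 hLj
    have hej : e ≠ j := by
      rintro rfl
      linarith
    refine ⟨⟨_, by convert m.trans ms fun _ _ _ _ => rfl using 1 <;> norm_num⟩, ?_, fun a => ?_,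
      i, hi, j, hj, e, hi2n, fun a h3 h4 h5 => ?_⟩
    · intro a ha b hb hba hbb h3 h4 h5
      rw [ms.rank a ha hba h3, ms.rank b hb hbb h4] at h5
      have hle : rank sz n Q (Q a) ≤ 2 := by unfold rank; split_ifs <;> omega
      have hje := rank_uncovered h0 hLj
      have hee := rank_paired hNi2
      by_cases haj : a = j
      · rw [if_pos haj] at h5
        omega
      rw [if_neg haj] at h5
      by_cases hae : a = e
      · rw [if_pos hae] at h5
        by_cases hbj : b = j
        · rw [hbj, hae]
          exact hlt.le
        · rw [if_neg hbj] at h5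
          by_cases hbe : b = e
          · rw [hbe, hae]
          · rw [if_neg hbe] at h5
            rw [hae]
            exact hmi2 b hb hbb (by omega)
      rw [if_neg hae] at h5
      by_cases hr : rank sz n Q (Q a) = 2
      · refine hr2 a ha b hb hba hbb hr ?_
        by_cases hbj : b = j
        · rw [hbj, hje]; omega
        · by_cases hbe : b = e
          · rw [hbe, hee]; omega
          · rw [if_neg hbj, if_neg hbe] at h5
            omega
      have hr1 : rank sz n Q (Q a) = 1 := by omega
      have hLa := hL1 a ha hba hr1
      by_cases hbj' : b = j
      · rw [hbj']
        exact hmj a ha hba hLa (by omega)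
      rw [if_neg hbj'] at h5
      by_cases hbe : b = e
      · rw [if_pos hbe] at h5
        omega
      rw [if_neg hbe] at h5
      have hrb : rank sz n Q (Q b) = 0 := by omega
      have hlow : ∀ x < n, Big (sz x) → rank sz n Q (Q x) = 0 → rank sz n P (P x) = 0 :=
        fun x hx hbx h => by
          rw [hrQ x hx hbx] at h
          split_ifs at h
          exact h
      have hPb := hlow b hb hbb hrb
      have hPe := hlow e hi2n hbi2 hee
      by_cases hai : a = i
      · rw [hai]
        exact hmi b hb hbb hPb
      rw [hrQ a ha hba] at hr1
      by_cases haz : P a = P i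
      -- Here `a` is the partner left behind. The smallest single `j` is smaller than the paired
      -- item `e`; if `j` were another item than `a`, it would be `i` or an old single, and both
      -- kinds are at least as large as `e`.
      · exfalso
        have hji : j = i ∨ rank sz n P (P j) = 1 := by
          by_contra hc
          push Not at hc
          rw [hrQ j hj hbj] at hje
          have hPj : P j = P i := by
            by_contra hc'
            rw [if_neg (by tauto)] at hje
            exact hc.2 hje
          exact haj ((m.tidy.eq_of_uncovered h0 hj ha hQj hLj (by
            rw [hQ, update_of_ne hai, update_of_ne hc.1, haz, hPj])).2)
        rcases hji with rfl | hji
        · linarith [hmi e hi2n hbi2 hPe]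
        · linarith [ho j hj e hi2n hbj hbi2 (hP0 j hj hbj) (hP0 e hi2n hbi2) (by omega)]
      · rw [if_neg (by tauto)] at hr1
        exact ho a ha b hb hba hbb (hP0 a ha hba) (hP0 b hb hbb) (by omega)
    · rw [← hQ0]
      by_cases haj : a = j
      · rw [haj, update_self]
        exact iff_of_false hQi2 hQj
      · rw [update_of_ne haj]
        by_cases hae : a = e
        · rw [hae, update_self]
          exact iff_of_false hQj hQi2
        · rw [update_of_ne hae]
    · rw [update_of_ne h4, update_of_ne h5, hQ, update_of_ne h3]
  · rw [if_neg hex]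
    refine ⟨⟨_, by convert m using 1 <;> norm_num⟩, ?_, hQ0,
      i, hi, i, hi, i, hi, fun a h3 _ _ => by rw [hQ, update_of_ne h3]⟩
    intro a ha b hb hba hbb h3 h4 h5
    by_cases hr : rank sz n Q (Q a) = 2
    · exact hr2 a ha b hb hba hbb hr (by omega)
    · have hle : rank sz n Q (Q a) ≤ 2 := by unfold rank; split_ifs <;> omega
      have hr1 : rank sz n Q (Q a) = 1 := by omega
      have hrb : rank sz n Q (Q b) = 0 := by omega
      have hne : i2 ≠ 0 := by
        intro h
        exact hi2z h b hb hbb hrb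
      have h6 := (hi2 hne).2.2.2.2 b hb hbb hrb
      have h7 := hmj a ha hba (hL1 a ha hba hr1) (by omega)
      have h8 : ¬ sz j < sz (i2 - 1) := fun h => hex ⟨by omega, h⟩
      linarith

end

/-! ### Migrated volume; bounds for rebalancing, freeing and trimming. -/

noncomputable section

variable {sz : ℕ → ℝ} {n t i j k a b c l F F' fr fr' : ℕ} {P Q R : ℕ → ℕ} {ε : ℝ} {s s' s'' : State}

/-- The total size of the items `i < n` with different labels. -/
def moved (sz : ℕ → ℝ) (n : ℕ) (P Q : ℕ → ℕ) : ℝ := ∑ i ∈ range n, if P i ≠ Q i then sz i else 0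

theorem moved_triangle (h0 : ∀ i < n, 0 < sz i) (P Q R : ℕ → ℕ) :
    moved sz n P R ≤ moved sz n P Q + moved sz n Q R := by
  unfold moved
  rw [← sum_add_distrib]
  refine sum_le_sum fun i hi => ?_
  have := h0 i (mem_range.1 hi)
  by_cases h1 : P i = Q i <;> by_cases h2 : Q i = R i
  · simp [h1, h2]
  · simp [h1]
  · simp [h2]
  · simp only [ne_eq, h1, not_false_eq_true, if_true, h2]
    split_ifs <;> linarith

theorem moved_le_card (h1 : ∀ i < n, sz i ≤ 1) {T : Finset ℕ}
    (h : ∀ a < n, a ∉ T → Q a = P a) : moved sz n P Q ≤ T.card := by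
  have : moved sz n P Q ≤ ∑ i ∈ range n, if i ∈ T then (1 : ℝ) else 0 := by
    refine sum_le_sum fun i hi => ?_
    by_cases hT : i ∈ T
    · rw [if_pos hT]
      have := h1 i (mem_range.1 hi)
      split_ifs <;> linarith
    · simp [h i (mem_range.1 hi) hT, hT]
  refine this.trans ?_
  rw [← sum_filter, sum_const, nsmul_eq_mul, mul_one]
  exact_mod_cast card_le_card fun i hi => (mem_filter.1 hi).2

/-- Pairing up turns `chi` in `{-3, -2}` into `0` or `1`; breaking up turns `chi ≥ 2` into at least
`-1` and lowers `psi` by `3/2`. Without a break-up the final `chi` is at most `1`, and `psi ≤ chi /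
2` gives the bound `1/2`. A break-up relabels at most three items. -/
theorem rebalance_spec (h0 : ∀ i < n, 0 < sz i) (h1 : ∀ i < n, sz i ≤ 1) (hε : 0 ≤ ε)
    (hT : Tidy sz n P fr) (ho : Ordered sz n P) (hp : ∀ i < n, P i = 0 → ¬ Big (sz i))
    (hs : ¬ HasSmall sz n P) (hX : -3 ≤ labelSum chi sz n P fr)
    (hY : labelSum (psi ε) sz n P fr ≤ 2) {P' : ℕ → ℕ} {fr' : ℕ}
    (he : rebalance sz n (P, fr) = (P', fr')) :
    Tidy sz n P' fr' ∧ Ordered sz n P' ∧ ¬ HasSmall sz n P' ∧ (∀ i, P' i = 0 ↔ P i = 0) ∧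
      -1 ≤ labelSum chi sz n P' fr' ∧ labelSum (psi ε) sz n P' fr' ≤ 1 / 2 ∧
      moved sz n P P' ≤ 3 := by
  have h2 := two_mul_labelSum_chi h0 hT hp
  unfold rebalance at he
  dsimp only at he
  split_ifs at he with h3 h4
  · obtain ⟨⟨r, m⟩, h5, j, hj, l, hl, hPj, hu⟩ := pairUp_spec h0 hT ho hp (by omega)
    obtain ⟨rfl, rfl⟩ := Prod.mk.inj he
    have h6 := two_mul_labelSum_psi h1 hε m.tidy
    have h7 := m.chi
    have h8 : labelSum chi sz n (pairUp sz n P) fr ≤ 1 := by omega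
    have h9 : ((labelSum chi sz n (pairUp sz n P) fr : ℤ) : ℝ) ≤ 1 := by exact_mod_cast h8
    refine ⟨m.tidy, h5, fun h => hs (m.small h), fun i => ?_, by omega, by linarith, ?_⟩
    · rw [hu]
      by_cases hij : i = j
      · rw [hij, update_self]
        exact iff_of_false hl hPj
      · rw [update_of_ne hij]
    · refine (moved_le_card h1 (T := {j}) fun a _ ha => ?_).trans (by simp)
      rw [hu, update_of_ne (by simpa using ha)]
  · obtain ⟨⟨r, m⟩, h5, h6, i, hi, j, hj, k, hk, hu⟩ := breakUp_spec h0 h1 hT ho hp (by omega)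
    obtain ⟨rfl, rfl⟩ := Prod.mk.inj he
    have h7 := m.chi
    have h8 := m.psi ε hε
    refine ⟨m.tidy, h5, fun h => hs (m.small h), h6, by omega, by linarith, ?_⟩
    refine (moved_le_card h1 (T := {i, j, k}) fun a _ ha => ?_).trans ?_
    · simp only [mem_insert, mem_singleton, not_or] at ha
      exact hu a ha.1 ha.2.1 ha.2.2
    · exact_mod_cast card_le_three
  · obtain ⟨rfl, rfl⟩ := Prod.mk.inj he
    have h6 := two_mul_labelSum_psi h1 hε hT
    have h8 : labelSum chi sz n P fr ≤ 1 := by omega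
    have h9 : ((labelSum chi sz n P fr : ℤ) : ℝ) ≤ 1 := by exact_mod_cast h8
    refine ⟨hT, ho, hs, fun _ => Iff.rfl, by omega, by linarith, ?_⟩
    exact (moved_le_card h1 (T := ∅) fun a _ ha => rfl).trans (by simp)

/-- By `opn` all freed items come from the same uncovered bin, so their volume is below `1`. -/
theorem freeOpen_spec (h0 : ∀ i < n, 0 < sz i) (hV : Valid sz n P fr) (hP : ∀ i < n, P i ≠ 0)
    (hQ : freeOpen sz n P = Q) :
    Tidy sz n Q fr ∧ Ordered sz n Q ∧ (HasSmall sz n Q → NoSingle sz n Q) ∧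
      (∀ i < n, Q i = 0 → ¬ Big (sz i)) ∧ labelSum chi sz n Q fr = labelSum chi sz n P fr ∧
      labelSum (psi ε) sz n Q fr = labelSum (psi ε) sz n P fr ∧ ld sz n Q 0 < 1 ∧
      moved sz n P Q ≤ 1 := by
  have hQi : ∀ i, Q i = 0 ∨ Q i = P i := fun i => by
    rw [← hQ, freeOpen]
    split_ifs <;> simp
  have hbig : ∀ i, Big (sz i) → Q i = P i := fun i hb => by
    rw [← hQ, freeOpen, if_neg (by tauto)]
  have hcov : ∀ k, k ≠ 0 → 1 ≤ ld sz n P k → ∀ i, Q i = k ↔ P i = k := fun k hk hL i => by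
    rw [← hQ, freeOpen]
    split_ifs with h
    · refine iff_of_false hk.symm ?_
      rintro rfl
      linarith [h.2.2]
    · rfl
  have hunc : ∀ i < n, ld sz n P (P i) < 1 → Q i ≠ 0 → Big (sz i) := fun i hi hL h => by
    by_contra hb
    rw [← hQ, freeOpen, if_pos ⟨hi, hb, hL⟩] at h
    exact h rfl
  have hN : ∀ k, k ≠ 0 → nb sz n Q k = nb sz n P k := fun k hk => by
    refine sum_congr rfl fun i hi => ?_
    by_cases hb : Big (sz i)
    · rw [hbig i hb]
    · simp [bigInd_of_small hb]
  have hLle : ∀ k, k ≠ 0 → ld sz n Q k ≤ ld sz n P k := fun k hk => by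
    refine sum_le_sum fun i hi => ?_
    have := h0 i (mem_range.1 hi)
    rcases hQi i with h | h
    · rw [if_neg (by omega)]
      split_ifs <;> linarith
    · rw [h]
  have hLeq : ∀ k, k ≠ 0 → 1 ≤ ld sz n P k → ld sz n Q k = ld sz n P k :=
    fun k hk hL => binSum_congr fun i _ => hcov k hk hL i
  have hlt : ∀ k, k ≠ 0 → (ld sz n Q k < 1 ↔ ld sz n P k < 1) := fun k hk => by
    refine ⟨fun h => ?_, fun h => (hLle k hk).trans_lt h⟩
    by_contra hc
    rw [hLeq k hk (by linarith)] at h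
    exact hc h
  have hr : ∀ k, k ≠ 0 → rank sz n Q k = rank sz n P k := fun k hk => by
    unfold rank
    rw [hN k hk]
    simp only [hlt k hk]
  have hg : ∀ k, k ≠ 0 → ∀ i, Q i = k → P i = k := fun k hk i h => by
    rcases hQi i with h' | h'
    · omega
    · omega
  have hpool : ∀ i < n, Q i = 0 → ¬ Big (sz i) := fun i hi h hb => by
    rw [hbig i hb] at h
    exact hP i hi h
  have hL0 : ld sz n Q 0 < 1 := by
    by_cases he : ∃ a < n, Q a = 0
    · obtain ⟨a, ha, hQa⟩ := he
      have hfree : ∀ i < n, Q i = 0 → ¬ Big (sz i) ∧ ld sz n P (P i) < 1 := fun i hi h => by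
        refine ⟨hpool i hi h, ?_⟩
        by_contra hc
        rw [← hQ, freeOpen, if_neg (by tauto)] at h
        exact hP i hi h
      refine lt_of_le_of_lt (sum_le_sum fun i hi => ?_) (hfree a ha hQa).2
      have hi' := mem_range.1 hi
      have := h0 i hi'
      by_cases hQi : Q i = 0
      · have h1 : P i = P a := by
          by_contra hc
          have h2 := hfree a ha hQa
          have h3 := hfree i hi' hQi
          exact h3.1 (hV.opn a ha i hi' h2.1 (hP a ha) (hP i hi') h2.2 h3.2 hc).1
        rw [if_pos hQi, if_pos h1]
      · rw [if_neg hQi]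
        split_ifs <;> linarith
    · push Not at he
      rw [ld, binSum_empty sz he]
      exact one_pos
  -- Both potentials see the load of an uncovered bin only through its being below `1`, and freeing
  -- changes no covered bin.
  have hsum : ∀ {M : Type} [AddCommMonoid M] (g : ℝ → ℕ → M),
      (∀ L L' b, (L < 1 ↔ L' < 1) → (1 ≤ L' → L = L') → g L b = g L' b) →
      labelSum g sz n Q fr = labelSum g sz n P fr := fun g hg => by
    refine sum_congr rfl fun k hk => ?_
    have hk' : k ≠ 0 := by
      have := mem_Ico.1 hk
      omega
    rw [hN k hk']
    exact hg _ _ _ (hlt k hk') (hLeq k hk')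
  refine ⟨⟨fun i => ?_, fun i hi => ?_, fun k hk => ?_, fun i hi hb h => ?_⟩, ?_, ?_, hpool,
    hsum _ fun L L' b h h' => ?_, hsum _ fun L L' b h h' => ?_, hL0, ?_⟩
  · rcases hQi i with h | h
    · have := hV.lt i
      omega
    · rw [h]
      exact hV.lt i
  · rcases hQi i with h | h
    · exact h
    · rw [h]
      exact hV.out i hi
  · by_cases hL : 1 ≤ ld sz n P k
    · exact (hV.ok k hk).congr fun i _ => hcov k hk hL i
    · refine ⟨?_, fun h2 i hi h => ?_, fun _ h => ?_⟩
      · rw [hN k hk]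
        exact (hV.ok k hk).1
      · rw [hN k hk] at h2
        exact (hV.ok k hk).2.1 h2 i hi (hg k hk i h)
      · have := (hlt k hk).2 (not_le.1 hL)
        linarith
  · by_contra hc
    have h1 := (hlt _ h).1 (not_le.1 hc)
    rw [← hg _ h i rfl] at h1
    exact hb (hunc i hi h1 h)
  · intro i hi j hj hb hb' h1 h2 h3
    rw [hr _ h1, hr _ h2, hbig i hb, hbig j hb'] at h3
    exact hV.order i hi j hj hb hb' (hP i hi) (hP j hj) h3
  · rintro ⟨k, hk, h1, h2⟩ j hj hb h3
    rw [hN k hk] at h1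
    have h4 := hV.closed k hk h1 (h2.trans (hLle k hk)) j hj hb (hP j hj)
    rw [hbig j hb, hLeq _ (hP j hj) h4]
    exact h4
  · unfold chi
    simp only [h]
  · unfold psi
    by_cases hL : L' < 1
    · simp only [h, hL, if_true]
    · rw [h' (not_lt.1 hL)]
  · refine le_trans (sum_le_sum fun i hi => ?_) hL0.le
    have := h0 i (mem_range.1 hi)
    rcases hQi i with h | h
    · rw [if_pos h]
      split_ifs <;> linarith
    · simp only [h, ne_eq, not_true_eq_false, if_false]
      split_ifs <;> linarith

/-- One pass suffices: the load only decreases, so an item that could not be removed earlier cannot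
be removed later. What leaves the bin enters the pool, which gives both the volume identity and the
migration bound. -/
theorem trim_spec (h0 : ∀ i < n, 0 < sz i) (hk : k ≠ 0) (hL : 1 ≤ ld sz n P k) (hj : j ≤ n) :
    (∀ i, trim sz n k P j i = P i ∨ P i = k ∧ i < n ∧ ¬ Big (sz i) ∧ trim sz n k P j i = 0) ∧
      1 ≤ ld sz n (trim sz n k P j) k ∧
      ld sz n (trim sz n k P j) 0 + ld sz n (trim sz n k P j) k = ld sz n P 0 + ld sz n P k ∧
      (∀ i < j, trim sz n k P j i = k → ¬ Big (sz i) →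
        ld sz n (trim sz n k P j) k - sz i < 1) ∧
      moved sz n P (trim sz n k P j) ≤ ld sz n P k - ld sz n (trim sz n k P j) k := by
  induction j with
  | zero => exact ⟨fun i => Or.inl rfl, hL, rfl, by simp, by simp [trim, moved]⟩
  | succ j ih =>
    obtain ⟨h1, h2, h3, h4, h5⟩ := ih (by omega)
    have hjn : j < n := by omega
    rw [trim]
    generalize trim sz n k P j = T at *
    split_ifs with h
    · obtain ⟨hT, hb, hge⟩ := h
      have e1 := binSum_take sz (P := T) (a := 0) hjn (by omega)
      rw [hT] at e1
      have e2 := binSum_put sz (P := T) (k := 0) hjn (by omega)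
      have hPj : P j = k := by
        rcases h1 j with h | h
        · omega
        · omega
      refine ⟨fun i => ?_, by unfold ld at *; linarith, by unfold ld at *; linarith,
        fun i hi hTi hbi => ?_, ?_⟩
      · by_cases hij : i = j
        · subst hij
          exact Or.inr ⟨hPj, hjn, hb, update_self _ _ _⟩
        · rw [update_of_ne hij]
          exact h1 i
      · by_cases hij : i = j
        · subst hij
          rw [update_self] at hTi
          omega
        · rw [update_of_ne hij] at hTi
          have := h4 i (by omega) hTi hbi
          have := h0 j hjn
          unfold ld at *
          linarith
      · have h6 := moved_triangle h0 P T (update T j 0)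
        have h7 : moved sz n T (update T j 0) ≤ sz j := by
          have : ∀ i ∈ range n, (if T i ≠ update T j 0 i then sz i else 0) ≤
              if i = j then sz i else 0 := fun i hi => by
            have := h0 i (mem_range.1 hi)
            by_cases hij : i = j
            · simp only [hij, if_true]
              have := h0 j hjn
              split_ifs <;> linarith
            · simp [hij]
          refine (sum_le_sum this).trans ?_
          rw [sum_ite_eq', if_pos (mem_range.2 hjn)]
        unfold ld at *
        linarith
    · refine ⟨h1, h2, h3, fun i hi hTi hbi => ?_, h5⟩
      rcases Nat.lt_succ_iff_lt_or_eq.1 hi with hi | rfl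
      · exact h4 i hi hTi hbi
      · by_contra hc
        exact h ⟨hTi, hbi, not_lt.1 hc⟩

end

noncomputable section

variable {sz : ℕ → ℝ} {n t i j k a b c l y F F' fr fr' : ℕ} {P Q R : ℕ → ℕ} {ε : ℝ} {s s' s'' : State}

/-! ## Placing a big item -/

theorem Tidy.succ (h : Tidy sz t P fr) : Tidy sz (t + 1) P fr ∧
    (∀ k, k ≠ 0 → ld sz (t + 1) P k = ld sz t P k) ∧
    (∀ k, k ≠ 0 → nb sz (t + 1) P k = nb sz t P k) := by
  have ht := h.out t le_rfl
  have hL : ∀ k, k ≠ 0 → ld sz (t + 1) P k = ld sz t P k := fun k hk =>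
    binSum_succ sz (by omega)
  have hN : ∀ k, k ≠ 0 → nb sz (t + 1) P k = nb sz t P k := fun k hk =>
    binSum_succ (bigInd sz) (by omega)
  have hi : ∀ i, i < t + 1 → P i ≠ 0 → i < t := fun i hi hP => by
    rcases Nat.lt_succ_iff_lt_or_eq.1 hi with hi | rfl
    · exact hi
    · exact absurd ht hP
  refine ⟨⟨h.lt, fun i hi => h.out i (by omega), fun k hk => ?_, fun i hit hb hP => ?_⟩, hL, hN⟩
  · obtain ⟨h1, h2, h3⟩ := h.ok k hk
    unfold LabelOK
    rw [hL k hk, hN k hk]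
    refine ⟨h1, fun h4 i hit hP => h2 h4 i (hi i hit (by omega)) hP, fun h4 h5 => ?_⟩
    rcases h3 h4 h5 with h6 | ⟨i, hi, h6⟩
    · exact Or.inl fun i hit hP => h6 i (hi i hit (by omega)) hP
    · exact Or.inr ⟨i, by omega, h6⟩
  · rw [hL _ hP]
    exact h.pure i (hi i hit hP) hb hP

theorem Tidy.rank_succ (h : Tidy sz t P fr) (hk : k ≠ 0) :
    rank sz (t + 1) P k = rank sz t P k := by
  unfold rank
  rw [h.succ.2.1 k hk, h.succ.2.2 k hk]

theorem Tidy.labelSum_succ {M : Type*} [AddCommMonoid M] (h : Tidy sz t P fr) (g : ℝ → ℕ → M) :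
    labelSum g sz (t + 1) P F = labelSum g sz t P F := by
  refine sum_congr rfl fun k hk => ?_
  have := mem_Ico.1 hk
  rw [h.succ.2.1 k (by omega), h.succ.2.2 k (by omega)]

/-- The state `P` in which the big item `c` has no bin yet arises from the state `P₀` of the items
`i < t`. -/
structure Pending (sz : ℕ → ℝ) (t : ℕ) (P₀ : ℕ → ℕ) (fr : ℕ) (P : ℕ → ℕ) (c : ℕ) : Prop where
  tidy : Tidy sz (t + 1) P fr
  lt : c < t + 1
  big : Big (sz c)
  eq_zero : P c = 0
  pool : ∀ i < t + 1, P i = 0 → i = c ∨ ¬ Big (sz i)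
  order : Ordered sz (t + 1) P
  paired : ∀ b < t + 1, Big (sz b) → P b ≠ 0 → rank sz (t + 1) P (P b) = 0 → sz b ≤ sz c
  same : ∀ a < t, a ≠ c → P a = P₀ a
  rank : ∀ a < t, a ≠ c → Big (sz a) → BinCovering.rank sz (t + 1) P (P a) =
    BinCovering.rank sz t P₀ (P₀ a)
  -- If `c` is not the new item, then `t` sits in the pair that `c` has left.
  rank_new : c ≠ t → BinCovering.rank sz (t + 1) P (P t) = 0
  fiber : ∀ k, k ≠ 0 → BinCovering.rank sz t P₀ k = 2 → ld sz (t + 1) P k = ld sz t P₀ k ∧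
    nb sz (t + 1) P k = nb sz t P₀ k
  small : HasSmall sz (t + 1) P → HasSmall sz t P₀
  chi : labelSum chi sz (t + 1) P fr = labelSum chi sz t P₀ fr
  psi : ∀ ε, 0 ≤ ε → labelSum (psi ε) sz (t + 1) P fr ≤ labelSum (psi ε) sz t P₀ fr
  volume : ld sz (t + 1) P 0 = ld sz t P₀ 0 + sz c

/-- Replacing the largest paired item by a smaller new item changes no rank of the other items, and
the displaced item is at least as large as every paired item. If there is no larger paired item, the
new item itself has this property. -/
theorem placePaired_spec (h0 : ∀ i < t + 1, 0 < sz i) (h1 : sz t ≤ 1) (hT : Tidy sz t P fr)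
    (ho : Ordered sz t P) (hp : ∀ i < t, P i = 0 → ¬ Big (sz i)) (hb : Big (sz t)) {q : ℕ → ℕ}
    (he : placePaired sz t (pickPaired sz t P) P = (q, c)) :
    Pending sz t P fr (update q c 0) c ∧ ∀ a, a ≠ t → q a = P a := by
  have ht := hT.out t le_rfl
  obtain ⟨hT', hLs, hNs⟩ := hT.succ
  have h0' : ∀ i < t, 0 < sz i := fun i hi => h0 i (by omega)
  have hvol : ld sz (t + 1) P 0 = ld sz t P 0 + sz t := by
    simp [ld, binSum, sum_range_succ, ht]
  have hPn : ∀ a, P a ≠ 0 → a < t := fun a ha => by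
    by_contra hc
    exact ha (hT.out a (by omega))
  have hoS : Ordered sz (t + 1) P := fun a _ b _ hba hbb h2 h3 h4 => by
    rw [hT.rank_succ h2, hT.rank_succ h3] at h4
    exact ho a (hPn a h2) b (hPn b h3) hba hbb h2 h3 h4
  unfold placePaired at he
  split_ifs at he with h
  · obtain ⟨rfl, rfl⟩ := Prod.mk.inj he
    obtain ⟨hi, hbi, hPi, hNi, hmi⟩ := pickPaired_pos hT hp (by omega)
    have hlt := h.2
    generalize pickPaired sz t P - 1 = i at *
    have hit : i ≠ t := by omega
    have hNi' : nb sz (t + 1) P (P i) = 2 := by rw [hNs _ hPi, hNi]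
    have hi1 := ((hT.ok _ hPi).2.1 hNi i hi rfl).2
    obtain ⟨z, hz, hzi, hPz, hbz⟩ := exists_big_ne (sz := sz) (P := P) hNi'.ge (by omega) rfl
    have hzt : z ≠ t := by
      rintro rfl
      omega
    have m1 := hT'.takePaired (by omega) hPi hNi'
    have hAz : update P i 0 z = P i := by rw [update_of_ne hzi, hPz]
    have hrz : rank sz (t + 1) (update P i 0) (P i) = 1 := by
      rw [← hAz, m1.rank z hz hbz (by rwa [hAz]), if_pos hPz]
    have hLA : ld sz (t + 1) (update P i 0) (P i) < 1 := by
      unfold rank at hrz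
      by_contra hc
      split_ifs at hrz
      omega
    -- The pair is opened and closed again, so the changes of both potentials cancel.
    have m2 := m1.tidy.join h0 (c := t) (by omega) hb (by rw [update_of_ne hit.symm, ht])
      (by linarith) hz (by rwa [hAz]) (by rwa [hAz])
    rw [hAz, update_comm hit] at m2
    have hq : ∀ a, a ≠ t → update P t (P i) a = P a := fun a ha => update_of_ne ha _ _
    set Q := update (update P t (P i)) i 0 with hQ
    have hQt : Q t = P i := by rw [hQ, update_of_ne hit.symm, update_self]
    have hQa : ∀ a, a ≠ i → a ≠ t → Q a = P a := fun a hai hat => by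
      rw [hQ, update_of_ne hai, update_of_ne hat]
    have hrt : rank sz (t + 1) Q (P i) = 0 := by
      rw [← hQt, m2.rank t (by omega) hb (by rwa [hQt]), if_pos (Or.inl rfl)]
    have hrank : ∀ a, a ≠ i → a ≠ t → Big (sz a) → P a ≠ 0 →
        rank sz (t + 1) Q (Q a) = rank sz t P (P a) := fun a hai hat hba hPa => by
      have hat' := hPn a hPa
      rw [hQa a hai hat]
      by_cases hPai : P a = P i
      · rw [hPai, hrt, rank_paired hNi]
      · have haz : a ≠ z := by
          rintro rfl
          exact hPai hPz
        have h2 := m2.rank a (by omega) hba (by rwa [hQa a hai hat])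
        have h3 := m1.rank a (by omega) hba (by rwa [update_of_ne hai])
        rw [hQa a hai hat, if_neg (by tauto)] at h2
        rw [h2, h3, if_neg hPai, hT.rank_succ hPa]
    have hoff : SameOff (t + 1) (P i) P Q := fun a _ k hk hkl => by
      by_cases hai : a = i
      · rw [hai, hQ, update_self]
        omega
      · by_cases hat : a = t
        · rw [hat, hQt, ht]
          omega
        · rw [hQa a hai hat]
    have hr0 := rank_paired hNi
    refine ⟨⟨m2.tidy, by omega, hbi, update_self _ _ _, fun a ha h2 => ?_, ?_, ?_, ?_,
      ?_, ?_, ?_, ?_, ?_, ?_, ?_⟩, hq⟩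
    · by_cases hai : a = i
      · exact Or.inl hai
      · right
        have hat : a ≠ t := by
          rintro rfl
          rw [hQt] at h2
          exact hPi h2
        rw [hQa a hai hat] at h2
        exact hp a (by omega) h2
    · intro a ha b hb' hba hbb h2 h3 h4
      have hai : a ≠ i := by
        rintro rfl
        simp [hQ] at h2
      have hbi' : b ≠ i := by
        rintro rfl
        simp [hQ] at h3
      have hat : a ≠ t := by
        rintro rfl
        rw [hQt, hrt] at h4
        omega
      rw [hQa a hai hat] at h2
      rw [hrank a hai hat hba h2] at h4
      by_cases hbt : b = t
      · rw [hbt] at h4 ⊢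
        rw [hQt, hrt] at h4
        have := ho a (hPn a h2) i hi hba hbi h2 hPi (by omega)
        linarith
      · rw [hQa b hbi' hbt] at h3
        rw [hrank b hbi' hbt hbb h3] at h4
        exact ho a (hPn a h2) b (hPn b h3) hba hbb h2 h3 h4
    · intro b hb' hbb h3 h4
      have hbi' : b ≠ i := by
        rintro rfl
        simp [hQ] at h3
      by_cases hbt : b = t
      · rw [hbt]
        exact hlt.le
      · rw [hQa b hbi' hbt] at h3
        rw [hrank b hbi' hbt hbb h3] at h4
        exact hmi b (hPn b h3) hbb h4
    · exact fun a ha hai => hQa a hai (by omega)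
    · exact fun a ha hai hba => hrank a hai (by omega) hba (fun h => hp a ha h hba)
    · exact fun _ => by rw [hQt, hrt]
    · intro k hk hr
      have hki : k ≠ P i := by
        rintro rfl
        omega
      rw [ld, nb, hoff.binSum _ hk hki, hoff.binSum _ hk hki]
      exact ⟨hLs k hk, hNs k hk⟩
    · intro h2
      obtain ⟨k, hk, h3, h4⟩ := m1.small (m2.small h2)
      rw [hNs k hk] at h3
      rw [hLs k hk] at h4
      exact ⟨k, hk, h3, h4⟩
    · rw [m2.chi, m1.chi, hT.labelSum_succ]
      ring
    · intro ε hε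
      have h2 := m1.psi ε hε
      have h3 := m2.psi ε hε
      rw [hT.labelSum_succ] at h2
      linarith
    · have e1 := binSum_take sz (P := P) (n := t + 1) (i := t) (a := P i) (by omega) (by omega)
      rw [ht] at e1
      have e2 := binSum_put sz (P := update P t (P i)) (n := t + 1) (i := i) (k := 0) (by omega)
        (by rwa [update_of_ne hit])
      unfold ld at *
      rw [e2]
      linarith
  · obtain ⟨rfl, rfl⟩ := Prod.mk.inj he
    have hPt : update P t 0 = P := by
      rw [← ht, update_eq_self]
    rw [hPt]
    refine ⟨⟨hT', by omega, hb, ht, fun a ha h2 => ?_, hoS, fun b hb' hbb h3 h4 => ?_,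
      fun _ _ _ => rfl, fun a ha _ hba => hT.rank_succ (fun h => hp a ha h hba),
      fun h => absurd rfl h,
      fun k hk _ => ⟨hLs k hk, hNs k hk⟩, ?_, hT.labelSum_succ _, fun ε _ => ?_, hvol⟩,
      fun _ _ => rfl⟩
    · rcases Nat.lt_succ_iff_lt_or_eq.1 ha with ha | rfl
      · exact Or.inr (hp a ha h2)
      · exact Or.inl rfl
    · rw [hT.rank_succ h3] at h4
      have hbt := hPn b h3
      have hne : pickPaired sz t P ≠ 0 := fun hz => by
        refine pick_eq_zero hz b hbt ⟨hbb, ?_⟩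
        unfold rank at h4
        split_ifs at h4
        omega
      have h5 := (pickPaired_pos hT hp hne).2.2.2.2 b hbt hbb h4
      have h6 : ¬ sz t < sz (pickPaired sz t P - 1) := fun h' => h ⟨by omega, h'⟩
      linarith
    · rintro ⟨k, hk, h2, h3⟩
      rw [hNs k hk] at h2
      rw [hLs k hk] at h3
      exact ⟨k, hk, h2, h3⟩
    · rw [hT.labelSum_succ]

end

noncomputable section

variable {sz : ℕ → ℝ} {n t i j k a b c l y w F F' fr fr' : ℕ} {P P₀ Q R : ℕ → ℕ} {ε : ℝ}

theorem Tidy.noSingle_iff (h0 : ∀ i < n, 0 < sz i) (hT : Tidy sz n P fr) :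
    NoSingle sz n P ↔ ∀ j < n, Big (sz j) → P j ≠ 0 → rank sz n P (P j) ≠ 1 := by
  refine forall₄_congr fun j _ _ hP => ?_
  rcases rank_pair_cases h0 hT hP with h | h | h
  · exact iff_of_true h.2.2 (by omega)
  · exact iff_of_false (by linarith [h.2]) (by omega)
  · exact iff_of_true h.2.2 (by omega)

theorem Pending.noSingle (h : Pending sz t P₀ fr P c) (h0 : ∀ i < t + 1, 0 < sz i)
    (hT : Tidy sz t P₀ fr) (hs : NoSingle sz t P₀) : NoSingle sz (t + 1) P := by
  rw [hT.noSingle_iff (fun i hi => h0 i (by omega))] at hs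
  rw [h.tidy.noSingle_iff h0]
  intro j hj hb hP
  have hjc : j ≠ c := by
    rintro rfl
    exact hP h.eq_zero
  rcases Nat.lt_succ_iff_lt_or_eq.1 hj with hj | rfl
  · rw [h.rank j hj hjc hb]
    exact hs j hj hb (by rwa [← h.same j hj hjc])
  · rw [h.rank_new hjc.symm]
    omega

theorem trim_eq_self (h : ∀ i < n, P i = k → Big (sz i)) (hj : j ≤ n) : trim sz n k P j = P := by
  induction j with
  | zero => rfl
  | succ j ih =>
    rw [trim, ih (by omega), if_neg]
    rintro ⟨h1, h2, -⟩
    exact h2 (h j (by omega) h1)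

theorem moved_succ_le (h0 : ∀ i < t + 1, 0 < sz i) : moved sz t P Q ≤ moved sz (t + 1) P Q := by
  unfold moved
  rw [sum_range_succ]
  have := h0 t (by omega)
  split_ifs <;> linarith

/-- The outcome of placing a big item. -/
structure Placed (ε : ℝ) (sz : ℕ → ℝ) (t : ℕ) (P₀ : ℕ → ℕ) (fr : ℕ) (Q : ℕ → ℕ) (fr' : ℕ) :
    Prop where
  valid : Valid sz (t + 1) Q fr'
  pool : ∀ i < t + 1, Q i = 0 → ¬ Big (sz i)
  small : HasSmall sz t P₀ → NoSingle sz (t + 1) Q ∧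
    labelSum chi sz (t + 1) Q fr' = labelSum chi sz t P₀ fr ∧
    labelSum (psi ε) sz (t + 1) Q fr' ≤ labelSum (psi ε) sz t P₀ fr
  mixed : ¬ HasSmall sz t P₀ → labelSum chi sz t P₀ fr - 1 ≤ labelSum chi sz (t + 1) Q fr' ∧
    labelSum (psi ε) sz (t + 1) Q fr' + ld sz (t + 1) Q 0 ≤
      labelSum (psi ε) sz t P₀ fr + ld sz t P₀ 0
  moved : moved sz t P₀ Q ≤ 4

section
variable (h0 : ∀ i < t + 1, 0 < sz i) (h1 : ∀ i < t + 1, sz i ≤ 1) (hε : 0 ≤ ε)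
  (hT : Tidy sz t P₀ fr) (h : Pending sz t P₀ fr P c)

-- The bin of small items becomes mixed; its `chi` stays `0`, and its `psi` becomes negative because
-- trimming keeps the load below `3/2`. With no singles present, the order only requires that `c` be
-- at least as large as the paired items.
include h0 h1 hε hT h in
theorem placed_small (hs : NoSingle sz t P₀) (hl : l ≠ 0) (hN : nb sz t P₀ l = 0)
    (hL : 1 ≤ ld sz t P₀ l) :
    Placed ε sz t P₀ fr (trim sz (t + 1) l (update P c l) (t + 1)) fr := by
  have hr : rank sz t P₀ l = 2 := by
    unfold rank
    rw [if_neg (by omega), if_neg (by linarith)]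
  obtain ⟨hLP, hNP⟩ := h.fiber l hl hr
  have hlt : l < fr := by
    obtain ⟨i, -, rfl⟩ := exists_mem_of_ld (sz := sz) (n := t) (P := P₀) (k := l) (by linarith)
    exact hT.lt i
  have hLR : ld sz (t + 1) (update P c l) l = ld sz (t + 1) P l + sz c :=
    binSum_put sz h.lt (by rw [h.eq_zero]; exact hl.symm)
  have hNR : nb sz (t + 1) (update P c l) l = nb sz (t + 1) P l + 1 := by
    rw [nb, binSum_put _ h.lt (by rw [h.eq_zero]; exact hl.symm), bigInd_of_big h.big]
  have hc0 := h0 c h.lt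
  obtain ⟨t1, t2, t3, t4, t5⟩ := trim_spec h0 (P := update P c l) hl
    (by rw [hLR]; linarith) le_rfl
  set R := update P c l with hR
  set T := trim sz (t + 1) l R (t + 1) with hTT
  have hRb : ∀ i, Big (sz i) → T i = R i := fun i hb => by
    rcases t1 i with h | h
    · exact h
    · exact absurd hb h.2.2.1
  have hoff : SameOff (t + 1) l P T := fun i hi k hk hkl => by
    rw [← sameOff_put h.eq_zero i hi k hk hkl, ← hR]
    rcases t1 i with h | h
    · rw [h]
    · rw [h.2.2.2, h.1]
      omega
  have hNT : nb sz (t + 1) T l = 1 := by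
    have : nb sz (t + 1) T l = nb sz (t + 1) R l := sum_congr rfl fun i _ => by
      by_cases hb : Big (sz i)
      · rw [hRb i hb]
      · simp [bigInd_of_small hb]
    omega
  have hTc : T c = l := by rw [hRb c h.big, hR, update_self]
  have hall : ∀ i < t + 1, Big (sz i) → T i = l → i = c := fun i hi hb hP =>
    eq_of_nb_le_one hNT.le hi h.lt hP hTc hb h.big
  have hok : LabelOK sz (t + 1) T l := by
    refine ⟨by omega, by omega, fun _ _ => ?_⟩
    by_contra hc
    push Not at hc
    obtain ⟨⟨i, hi, hP, hb⟩, h2⟩ := hc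
    linarith [h2 i hi hP hb, t4 i hi hP hb]
  have hTT : Tidy sz (t + 1) T fr := by
    refine h.tidy.change hoff (fun i => ?_) (fun i hi => ?_) hok (fun _ _ _ _ => t2)
    · have h2 := update_lt h.tidy.lt hlt le_rfl (i := c) i
      rcases t1 i with h3 | h3
      · rwa [h3]
      · have := hT.one_le
        omega
    · rcases t1 i with h3 | h3
      · rw [h3]
        exact update_out h.tidy.out h.lt i hi
      · omega
  have hrl : rank sz (t + 1) T l = 2 := by
    unfold rank
    rw [if_neg (by omega), if_neg (by linarith)]
  have hother : ∀ i, Big (sz i) → i ≠ c → T i = P i := fun i hb hic => by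
    rw [hRb i hb, hR, update_of_ne hic]
  have hrank : ∀ i < t + 1, Big (sz i) → i ≠ c → P i ≠ 0 →
      rank sz (t + 1) T (T i) = rank sz (t + 1) P (P i) := fun i hi hb hic hP => by
    rw [hother i hb hic]
    refine hoff.rank hP fun hPl => hic (hall i hi hb ?_)
    rw [hother i hb hic, hPl]
  have hnsP := (h.tidy.noSingle_iff h0).1 (h.noSingle h0 hT hs)
  have hns : NoSingle sz (t + 1) T := by
    rw [hTT.noSingle_iff h0]
    intro i hi hb hP
    by_cases hic : i = c
    · rw [hic, hTc, hrl]
      omega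
    · rw [hother i hb hic] at hP
      rw [hrank i hi hb hic hP]
      exact hnsP i hi hb hP
  have hord : Ordered sz (t + 1) T := by
    intro a ha b hb hba hbb h2 h3 h4
    have hbc : b ≠ c := by
      rintro rfl
      rw [hTc, hrl] at h4
      have : rank sz (t + 1) T (T a) ≤ 2 := by unfold rank; split_ifs <;> omega
      omega
    rw [hother b hbb hbc] at h3
    rw [hrank b hb hbb hbc h3] at h4
    by_cases hac : a = c
    · rw [hac]
      rw [hac, hTc, hrl] at h4
      have := hnsP b hb hbb h3
      exact h.paired b hb hbb h3 (by omega)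
    · rw [hother a hba hac] at h2
      rw [hrank a ha hba hac h2] at h4
      exact h.order a ha b hb hba hbb h2 h3 h4
  have hL32 := hok.ld_lt h1 (by omega)
  have hlI : l ∈ Ico 1 fr := mem_Ico.2 ⟨by omega, hlt⟩
  refine ⟨hTT.valid hord fun _ => hns, fun i hi hTi => ?_, fun _ => ⟨hns, ?_, ?_⟩,
    fun hc => absurd ⟨l, hl, hN, hL⟩ hc, ?_⟩
  · intro hb
    by_cases hic : i = c
    · rw [hic, hTc] at hTi
      exact hl hTi
    · rw [hother i hb hic] at hTi
      rcases h.pool i hi hTi with h2 | h2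
      · exact hic h2
      · exact h2 hb
  · rw [labelSum_congr chi hlI hoff, h.chi, hNT, hNP, hN]
    simp [chi, t2]
  · rw [labelSum_congr (psi ε) hlI hoff, hNT, hNP, hN]
    have := h.psi ε hε
    simp only [psi, OfNat.one_ne_ofNat, if_false, if_true, OfNat.zero_ne_ofNat, zero_ne_one]
    rw [if_neg (by linarith)]
    linarith
  · have h2 := moved_triangle (fun i hi => h0 i (by omega) : ∀ i < t, 0 < sz i) P₀ R T
    have h3 := moved_succ_le h0 (P := R) (Q := T)
    have h4 : moved sz t P₀ R ≤ ({c} : Finset ℕ).card :=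
      moved_le_card (fun i hi => h1 i (by omega)) fun a ha hac => by
        have hac' : a ≠ c := by simpa using hac
        rw [hR, update_of_ne hac', h.same a ha hac']
    have h5 := (hT.ok l hl).ld_lt (fun i hi => h1 i (by omega)) (by omega)
    have h6 := h1 c h.lt
    simp only [card_singleton, Nat.cast_one] at h4
    -- The trimmed volume is at most the old load plus `sz c` minus `1`, hence below `3/2`.
    rw [hLR, hLP] at t5
    linarith

-- The item `c` takes over the small items of the smallest big item `y` of the mixed bins, and `y`
-- becomes single. As `y` was in a mixed bin it is at least as large as all singles and pairs, and
-- by minimality it is at most the items that stay in mixed bins.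
include h0 h1 hε hT h in
theorem placed_mixed (hs : ¬ HasSmall sz t P₀) (hy : y < t) (hby : Big (sz y))
    (hry : rank sz t P₀ (P₀ y) = 2) (hPy : P₀ y ≠ 0) (hyc : sz y < sz c)
    (hmin : ∀ a < t, Big (sz a) → rank sz t P₀ (P₀ a) = 2 → sz y ≤ sz a) :
    Placed ε sz t P₀ fr (trim sz (t + 1) (P₀ y) (update (update P y fr) c (P₀ y)) (t + 1))
      (fr + 1) := by
  have h0' : ∀ i < t, 0 < sz i := fun i hi => h0 i (by omega)
  have hfr := hT.one_le
  obtain ⟨hLP, hNP⟩ := h.fiber _ hPy hry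
  have hyc' : y ≠ c := by
    rintro rfl
    exact lt_irrefl _ hyc
  have hPPy : P y = P₀ y := h.same y hy hyc'
  have hcov : nb sz t P₀ (P₀ y) = 1 ∧ 1 ≤ ld sz t P₀ (P₀ y) := by
    rcases rank_pair_cases h0' hT hPy with h2 | h2 | h2
    · omega
    · omega
    · have := one_le_nb (P := P₀) hy rfl hby
      exact ⟨by omega, h2.2.2⟩
  have hlt : P₀ y < fr := hT.lt y
  have hlne : P₀ y ≠ fr := hlt.ne
  generalize P₀ y = l at *
  have hl := hPy
  have hc0 := h0 c h.lt
  set S := update P y fr with hS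
  have hSc : S c = 0 := by rw [hS, update_of_ne hyc'.symm, h.eq_zero]
  have eL := binSum_take sz (P := P) (n := t + 1) (i := y) (a := fr) (by omega) (by omega)
  have eN := binSum_take (bigInd sz) (P := P) (n := t + 1) (i := y) (a := fr) (by omega) (by omega)
  rw [← hS, hPPy] at eL eN
  rw [bigInd_of_big hby] at eN
  have hLR : ld sz (t + 1) (update S c l) l = ld sz (t + 1) S l + sz c :=
    binSum_put sz h.lt (by rw [hSc]; exact hl.symm)
  have hNR : nb sz (t + 1) (update S c l) l = nb sz (t + 1) S l + 1 := by
    rw [nb, binSum_put _ h.lt (by rw [hSc]; exact hl.symm), bigInd_of_big h.big]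
  have hLR' : ld sz (t + 1) (update S c l) l = ld sz t P₀ l - sz y + sz c := by
    unfold ld at *
    linarith
  have hNR' : nb sz (t + 1) (update S c l) l = 1 := by
    unfold nb at *
    omega
  have hL0 : ld sz (t + 1) (update S c l) 0 = ld sz t P₀ 0 := by
    have e1 := binSum_take sz (P := S) (n := t + 1) (i := c) (a := l) h.lt (by rwa [hSc])
    rw [hSc, hS, binSum_update_of_ne sz P (by omega) (by omega), ← hS] at e1
    have := h.volume
    unfold ld at *
    linarith
  obtain ⟨t1, t2, t3, t4, t5⟩ := trim_spec h0 (P := update S c l) hl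
    (by rw [hLR']; linarith [hcov.2]) le_rfl
  set R := update S c l with hR
  set T := trim sz (t + 1) l R (t + 1) with hTdef
  have hRb : ∀ i, Big (sz i) → T i = R i := fun i hb => by
    rcases t1 i with h | h
    · exact h
    · exact absurd hb h.2.2.1
  have hTc : T c = l := by rw [hRb c h.big, hR, update_self]
  have hTy : T y = fr := by rw [hRb y hby, hR, update_of_ne hyc', hS, update_self]
  -- Keeping `y` in the pool for a moment splits the step into a change of the single bin `l` and a
  -- `Tidy.putNew`.
  set M := update T y 0 with hM
  have hMne : ∀ i, i ≠ y → M i = T i := fun i hi => update_of_ne hi _ _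
  have hMy : M y = 0 := update_self _ _ _
  have hMl : ∀ i < t + 1, M i = l ↔ T i = l := fun i _ => by
    by_cases hiy : i = y
    · rw [hiy, hMy, hTy]
      omega
    · rw [hMne i hiy]
  have hLM : ld sz (t + 1) M l = ld sz (t + 1) T l := binSum_congr hMl
  have hNM : nb sz (t + 1) M l = 1 := by
    have h2 : nb sz (t + 1) M l = nb sz (t + 1) T l := binSum_congr hMl
    have : nb sz (t + 1) T l = nb sz (t + 1) R l := sum_congr rfl fun i _ => by
      by_cases hb : Big (sz i)
      · rw [hRb i hb]
      · simp [bigInd_of_small hb]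
    omega
  have hoff : SameOff (t + 1) l P M := fun i hi k hk hkl => by
    by_cases hiy : i = y
    · rw [hiy, hMy, hPPy]
      omega
    · rw [hMne i hiy]
      by_cases hic : i = c
      · rw [hic, hTc, h.eq_zero]
        omega
      · have hRi : R i = P i := by rw [hR, update_of_ne hic, hS, update_of_ne hiy]
        rcases t1 i with h2 | h2
        · rw [h2, hRi]
        · rw [h2.2.2.2, ← hRi, h2.1]
          omega
  have hMc : M c = l := by rw [hMne c hyc'.symm, hTc]
  have hall : ∀ i < t + 1, Big (sz i) → M i = l → i = c := fun i hi hb hP =>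
    eq_of_nb_le_one hNM.le hi h.lt hP hMc hb h.big
  have hok : LabelOK sz (t + 1) M l := by
    refine ⟨by omega, by omega, fun _ _ => ?_⟩
    by_contra hc
    push Not at hc
    obtain ⟨⟨i, hi, hP, hb⟩, h2⟩ := hc
    have h3 := h2 i hi hP hb
    rw [hLM] at h3
    linarith [t4 i hi ((hMl i hi).1 hP) hb]
  have hMT : Tidy sz (t + 1) M fr := by
    refine h.tidy.change hoff (fun i => ?_) (fun i hi => ?_) hok (fun _ _ _ _ => by rw [hLM]; exact t2)
    · by_cases hiy : i = y
      · rw [hiy, hMy]; omega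
      · rw [hMne i hiy]
        rcases t1 i with h3 | h3
        · rw [h3]
          by_cases hic : i = c
          · rw [hic, hR, update_self]
            exact hlt
          · rw [hR, update_of_ne hic, hS, update_of_ne hiy]
            exact h.tidy.lt i
        · omega
    · have h3 := h.lt
      rw [hMne i (by omega)]
      rcases t1 i with h3 | h3
      · rw [h3, hR, update_of_ne (by omega), hS, update_of_ne (by omega)]
        exact h.tidy.out i hi
      · omega
  have hrl : rank sz (t + 1) M l = 2 := by
    unfold rank
    rw [if_neg (by omega), if_neg (by linarith)]
  have hother : ∀ i, Big (sz i) → i ≠ c → i ≠ y → M i = P i := fun i hb hic hiy => by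
    rw [hMne i hiy, hRb i hb, hR, update_of_ne hic, hS, update_of_ne hiy]
  have hy1 : sz y < 1 := by linarith [h1 c h.lt]
  have m := hMT.putNew (c := y) (l := fr) (fr' := fr + 1) (by omega) hby hMy (by omega)
    (fun a _ => (hMT.lt a).ne) (by omega) (by omega) hy1.le
  have hMT' : update M y fr = T := by
    rw [hM, update_idem, ← hTy, update_eq_self]
  rw [hMT', if_pos hy1] at m
  have hrc : rank sz (t + 1) T (T c) = 2 := by
    rw [m.rank c h.lt h.big (by rwa [hTc]), if_neg hyc'.symm, hMc, hrl]
  have hry' : rank sz (t + 1) T (T y) = 1 := by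
    rw [m.rank y (by omega) hby (by omega), if_pos rfl, if_pos hy1]
  have hrank : ∀ i < t + 1, Big (sz i) → i ≠ c → i ≠ y → P i ≠ 0 →
      rank sz (t + 1) T (T i) = rank sz (t + 1) P (P i) := fun i hi hb hic hiy hP => by
    have h2 := hother i hb hic hiy
    rw [m.rank i hi hb (by rw [← hMne i hiy, h2]; exact hP), if_neg hiy, h2]
    exact hoff.rank hP fun hPl => hic (hall i hi hb (by rw [h2, hPl]))
  have hryP : rank sz (t + 1) P (P y) = 2 := by
    rw [h.rank y hy hyc' hby]
    rw [← hPPy] at hry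
    rw [← h.same y hy hyc']
    exact hry
  have hord : Ordered sz (t + 1) T := by
    intro a ha b hb hba hbb h2 h3 h4
    have hle : rank sz (t + 1) T (T a) ≤ 2 := by unfold rank; split_ifs <;> omega
    have hbc : b ≠ c := by
      rintro rfl
      omega
    have hactive : ∀ i, Big (sz i) → i ≠ c → i ≠ y → T i ≠ 0 → P i ≠ 0 := fun i hb hic hiy h => by
      rwa [← hother i hb hic hiy, hMne i hiy]
    by_cases hby' : b = y
    · rw [hby', hry'] at h4
      by_cases hac : a = c
      · rw [hac, hby']
        exact hyc.le
      · have hay : a ≠ y := by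
          rintro rfl
          omega
        have hPa := hactive a hba hac hay h2
        rw [hrank a ha hba hac hay hPa] at h4
        rw [hby']
        have hat : a < t := by
          rcases Nat.lt_succ_iff_lt_or_eq.1 ha with h5 | rfl
          · exact h5
          · rw [h.rank_new (Ne.symm hac)] at h4
            omega
        refine hmin a hat hba ?_
        rw [← h.rank a hat hac hba]
        have : rank sz (t + 1) P (P a) ≤ 2 := by unfold rank; split_ifs <;> omega
        omega
    · have hPb := hactive b hbb hbc hby' h3
      have hrb := hrank b hb hbb hbc hby' hPb
      rw [hrb] at h4
      by_cases hac : a = c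
      · rw [hac] at h4 ⊢
        rw [hrc] at h4
        by_cases h5 : rank sz (t + 1) P (P b) = 0
        · exact h.paired b hb hbb hPb h5
        · have := h.order y (by omega) b hb hby hbb (by rwa [hPPy]) hPb (by omega)
          linarith
      · by_cases hay : a = y
        · rw [hay] at h4 ⊢
          rw [hry'] at h4
          exact h.order y (by omega) b hb hby hbb (by rwa [hPPy]) hPb (by omega)
        · have hPa := hactive a hba hac hay h2
          rw [hrank a ha hba hac hay hPa] at h4
          exact h.order a ha b hb hba hbb hPa hPb h4
  have hsT : ¬ HasSmall sz (t + 1) T := fun h2 => by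
    obtain ⟨k, hk, h3, h4⟩ := m.small h2
    have hkl : k ≠ l := by
      rintro rfl
      omega
    rw [nb, hoff.binSum _ hk hkl] at h3
    rw [ld, hoff.binSum _ hk hkl] at h4
    exact hs (h.small ⟨k, hk, h3, h4⟩)
  have hlI : l ∈ Ico 1 fr := mem_Ico.2 ⟨by omega, hlt⟩
  refine ⟨m.tidy.valid hord fun h => absurd h hsT, fun i hi hTi => ?_, fun h => absurd h hs,
    fun _ => ⟨?_, ?_⟩, ?_⟩
  · intro hb
    by_cases hic : i = c
    · rw [hic, hTc] at hTi
      exact hl hTi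
    · by_cases hiy : i = y
      · rw [hiy, hTy] at hTi
        omega
      · rw [← hMne i hiy, hother i hb hic hiy] at hTi
        rcases h.pool i hi hTi with h2 | h2
        · exact hic h2
        · exact h2 hb
  · rw [m.chi, labelSum_congr chi hlI hoff, h.chi, hNM, hNP, hcov.1, hLM, hLP]
    simp [chi, not_lt.2 t2, not_lt.2 hcov.2, sub_eq_add_neg]
  · have h2 := m.psi ε hε
    rw [labelSum_congr (psi ε) hlI hoff, hNM, hNP, hcov.1, hLM, hLP] at h2
    have h3 := h.psi ε hε
    have h4 : psi ε (ld sz (t + 1) T l) 1 = ld sz (t + 1) T l - 3 / 2 - ε := by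
      simp only [psi, OfNat.one_ne_ofNat, if_false, if_true]
      rw [if_neg (by linarith)]
    have h5 : psi ε (ld sz t P₀ l) 1 = ld sz t P₀ l - 3 / 2 - ε := by
      simp only [psi, OfNat.one_ne_ofNat, if_false, if_true]
      rw [if_neg (by linarith [hcov.2])]
    -- By the volume identity of `trim_spec`, `psi` plus pool volume changes by at most `sz c - sz y
    -- - 1/2`, which is nonpositive since `sz c ≤ 1` and `y` is big.
    rw [h4, h5] at h2
    have h6 := h1 c h.lt
    unfold Big at hby
    linarith
  · have h2 := moved_triangle h0' P₀ R T
    have h3 := moved_succ_le h0 (P := R) (Q := T)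
    have h4 : moved sz t P₀ R ≤ ({c, y} : Finset ℕ).card :=
      moved_le_card (fun i hi => h1 i (by omega)) fun a ha hac => by
        simp only [mem_insert, mem_singleton, not_or] at hac
        rw [hR, update_of_ne hac.1, hS, update_of_ne hac.2, h.same a ha hac.1]
    have h5 := (hT.ok l hl).ld_lt (fun i hi => h1 i (by omega)) (by omega)
    have h6 := h1 c h.lt
    have h7 : ((({c, y} : Finset ℕ).card : ℕ) : ℝ) ≤ 2 := by exact_mod_cast card_le_two
    have h8 := h0 y (by omega)
    rw [hLR'] at t5
    linarith

-- Here `c` is at least as large as every paired item and at most as large as every item of a mixed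
-- bin, so it may become single. If its size is `1` it covers the new bin alone, which the order
-- allows because no item is larger.
include h0 h1 hε hT h in
theorem placed_new (hs : ¬ HasSmall sz t P₀)
    (hmin : ∀ a < t, Big (sz a) → rank sz t P₀ (P₀ a) = 2 → sz c ≤ sz a) :
    Placed ε sz t P₀ fr (trim sz (t + 1) fr (update P c fr) (t + 1)) (fr + 1) := by
  have hfr := hT.one_le
  rw [trim_eq_self (fun i hi hP => ?_) le_rfl]
  swap
  · by_cases hic : i = c
    · rw [hic]
      exact h.big
    · rw [update_of_ne hic] at hP
      exact absurd hP (h.tidy.lt i).ne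
  have hc1 := h1 c h.lt
  have m := h.tidy.putNew (l := fr) (fr' := fr + 1) h.lt h.big h.eq_zero (by omega)
    (fun a _ => (h.tidy.lt a).ne) (by omega) (by omega) hc1
  set T := update P c fr with hT
  have hother : ∀ i, i ≠ c → T i = P i := fun i hic => update_of_ne hic _ _
  have hord : Ordered sz (t + 1) T := by
    intro a ha b hb hba hbb h2 h3 h4
    rw [m.rank a ha hba h2, m.rank b hb hbb h3] at h4
    by_cases hac : a = c
    · rw [hac]
      have hbc : b ≠ c := by
        rintro rfl
        rw [if_pos rfl, if_pos hac] at h4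
        omega
      rw [if_pos hac, if_neg hbc] at h4
      rw [hother b hbc] at h3
      by_cases hlt : sz c < 1
      · rw [if_pos hlt] at h4
        exact h.paired b hb hbb h3 (by omega)
      · linarith [h1 b hb]
    · rw [if_neg hac] at h4
      rw [hother a hac] at h2
      by_cases hbc : b = c
      · rw [if_pos hbc] at h4
        rw [hbc]
        have hle : rank sz (t + 1) P (P a) ≤ 2 := by unfold rank; split_ifs <;> omega
        have h5 : rank sz (t + 1) P (P a) = 2 := by
          split_ifs at h4 <;> omega
        have hat : a < t := by
          rcases Nat.lt_succ_iff_lt_or_eq.1 ha with h6 | rfl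
          · exact h6
          · rw [h.rank_new (Ne.symm hac)] at h5
            omega
        exact hmin a hat hba (by rw [← h.rank a hat hac hba, h5])
      · rw [if_neg hbc] at h4
        rw [hother b hbc] at h3
        exact h.order a ha b hb hba hbb h2 h3 h4
  refine ⟨m.tidy.valid hord fun h2 => absurd (h.small (m.small h2)) hs, fun i hi hTi hb => ?_,
    fun h => absurd h hs, fun _ => ⟨?_, ?_⟩, ?_⟩
  · by_cases hic : i = c
    · rw [hic, hT, update_self] at hTi
      omega
    · rw [hother i hic] at hTi
      rcases h.pool i hi hTi with h2 | h2
      · exact hic h2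
      · exact h2 hb
  · rw [m.chi, h.chi]
    split_ifs <;> omega
  · have h2 := m.psi ε hε
    have h3 := h.psi ε hε
    have e1 := binSum_take sz (P := P) (n := t + 1) (i := c) (a := fr) h.lt
      (by rw [h.eq_zero]; omega)
    rw [h.eq_zero] at e1
    have := h.volume
    unfold ld at *
    linarith
  · refine (moved_le_card (T := {c}) (fun i hi => h1 i (by omega)) fun a ha hac => ?_).trans
      (by norm_num)
    have hac' : a ≠ c := by simpa using hac
    rw [hother a hac', h.same a ha hac']

end

end

noncomputable section

variable {sz : ℕ → ℝ} {n t i j k a b c l y w F F' fr fr' : ℕ} {P P₀ Q R : ℕ → ℕ} {ε : ℝ}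
  {s s' : State}

theorem pickSmall_eq_zero (h : pickSmall sz t P = 0) : ¬ HasSmall sz t P := by
  rintro ⟨k, hk, h1, h2⟩
  obtain ⟨i, hi, rfl⟩ := exists_mem_of_ld (sz := sz) (n := t) (P := P) (k := k) (by linarith)
  exact pick_eq_zero h i hi ⟨hk, h1, h2⟩

theorem place_spec (h0 : ∀ i < t + 1, 0 < sz i) (h1 : ∀ i < t + 1, sz i ≤ 1) (hε : 0 ≤ ε)
    (hT : Tidy sz t P fr) (ho : Ordered sz t P) (hp : ∀ i < t, P i = 0 → ¬ Big (sz i))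
    (hs : HasSmall sz t P → NoSingle sz t P) (hb : Big (sz t)) :
    Placed ε sz t P fr (place sz t (pickSmall sz t P) (P, fr)).1
      (place sz t (pickSmall sz t P) (P, fr)).2 := by
  obtain ⟨q, c, hq⟩ : ∃ q c, placePaired sz t (pickPaired sz t P) P = (q, c) := ⟨_, _, rfl⟩
  obtain ⟨h, hqa⟩ := placePaired_spec h0 (h1 t (by omega)) hT ho hp hb hq
  have hfr := hT.one_le
  unfold place
  dsimp only
  rw [hq]
  dsimp only
  unfold host
  split_ifs with hw hy
  · dsimp only
    obtain ⟨h2, ⟨h3, h4, h5⟩, -⟩ := pick_pos (show pickSmall sz t P ≠ 0 by omega)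
    have := placed_small h0 h1 hε hT h (hs ⟨_, h3, h4, h5⟩) h3 h4 h5
    rw [update_idem] at this
    change pickSmall sz t P - 1 < t at h2
    rwa [hqa _ (by omega)]
  · have hs' := pickSmall_eq_zero (sz := sz) (t := t) (P := P) (by omega)
    dsimp only
    obtain ⟨h2, ⟨h3, h4, h5⟩, h6⟩ := pick_pos (show pickMixed sz t P ≠ 0 by omega)
    have hlt := hy.2
    change pickMixed sz t P - 1 < t at h2
    unfold pickMixed at *
    set y := pick (fun i => Big (sz i) ∧ nb sz t P (P i) ≤ 1 ∧ 1 ≤ ld sz t P (P i))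
      (fun i => 1 - sz i) t - 1 with hydef
    have hyc : y ≠ c := by
      rintro h
      rw [h] at hlt
      exact lt_irrefl _ hlt
    have hPy : P y ≠ 0 := fun h => hp y h2 h h3
    have hr : rank sz t P (P y) = 2 := by
      unfold rank
      rw [if_neg (by omega), if_neg (by linarith)]
    have := placed_mixed h0 h1 hε hT h hs' h2 h3 hr hPy hlt fun a ha hba hra => by
      have h7 := h6 a ha ⟨hba, ?_⟩
      · linarith
      · rcases rank_pair_cases (fun i hi => h0 i (by omega)) hT (fun h => hp a ha h hba) with
          h8 | h8 | h8
        · omega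
        · omega
        · exact h8.2
    rw [update_comm hyc.symm, update_idem] at this
    rwa [hqa _ (by omega)]
  · have hs' := pickSmall_eq_zero (sz := sz) (t := t) (P := P) (by omega)
    dsimp only
    have := placed_new h0 h1 hε hT h hs' fun a ha hba hra => by
      have h8 : nb sz t P (P a) ≤ 1 ∧ 1 ≤ ld sz t P (P a) := by
        rcases rank_pair_cases (fun i hi => h0 i (by omega)) hT (fun h => hp a ha h hba) with
          h8 | h8 | h8
        · omega
        · omega
        · exact h8.2
      have h9 : pickMixed sz t P ≠ 0 := fun hz => pick_eq_zero hz a ha ⟨hba, h8⟩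
      obtain ⟨-, -, h6⟩ := pick_pos h9
      have h7 := h6 a ha ⟨hba, h8⟩
      change 1 - sz a ≤ 1 - sz (pickMixed sz t P - 1) at h7
      have h10 : ¬ sz (pickMixed sz t P - 1) < sz c := fun h => hy ⟨by omega, h⟩
      linarith
    rwa [update_idem] at this

/-! ## The arrival of an item -/

theorem Valid.succ (h : Valid sz t P fr) : Valid sz (t + 1) P fr ∧
    (∀ k, k ≠ 0 → ld sz (t + 1) P k = ld sz t P k) ∧
    (∀ k, k ≠ 0 → nb sz (t + 1) P k = nb sz t P k) ∧
    ld sz (t + 1) P 0 = ld sz t P 0 + sz t := by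
  have ht := h.out t le_rfl
  have hL : ∀ k, k ≠ 0 → ld sz (t + 1) P k = ld sz t P k := fun k hk =>
    binSum_succ sz (by omega)
  have hN : ∀ k, k ≠ 0 → nb sz (t + 1) P k = nb sz t P k := fun k hk =>
    binSum_succ (bigInd sz) (by omega)
  have hPn : ∀ a, P a ≠ 0 → a < t := fun a ha => by
    by_contra hc
    exact ha (h.out a (by omega))
  refine ⟨⟨h.lt, fun i hi => h.out i (by omega), fun k hk => ?_, ?_, ?_, ?_⟩, hL, hN,
    by simp [ld, binSum, sum_range_succ, ht]⟩
  · obtain ⟨h1, h2, h3⟩ := h.ok k hk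
    unfold LabelOK
    rw [hL k hk, hN k hk]
    refine ⟨h1, fun h4 i _ hP => h2 h4 i (hPn i (by omega)) hP, fun h4 h5 => ?_⟩
    rcases h3 h4 h5 with h6 | ⟨i, hi, h6⟩
    · exact Or.inl fun i _ hP => h6 i (hPn i (by omega)) hP
    · exact Or.inr ⟨i, by omega, h6⟩
  · intro i _ j _ hb hb' h1 h2 h3
    unfold rank at h3
    rw [hL _ h1, hL _ h2, hN _ h1, hN _ h2] at h3
    exact h.order i (hPn i h1) j (hPn j h2) hb hb' h1 h2 h3
  · intro i _ j _ hb h1 h2 h3 h4 h5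
    rw [hL _ h1] at h3
    rw [hL _ h2] at h4
    obtain ⟨h6, b, hb, h7⟩ := h.opn i (hPn i h1) j (hPn j h2) hb h1 h2 h3 h4 h5
    exact ⟨h6, b, by omega, h7⟩
  · intro k hk h1 h2 j _ hb h3
    rw [hN k hk] at h1
    rw [hL k hk] at h2
    rw [hL _ h3]
    exact h.closed k hk h1 h2 j (hPn j h3) hb h3

theorem Valid.labelSum_succ {M : Type*} [AddCommMonoid M] (h : Valid sz t P fr)
    (g : ℝ → ℕ → M) : labelSum g sz (t + 1) P F = labelSum g sz t P F := by
  refine sum_congr rfl fun k hk => ?_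
  have := mem_Ico.1 hk
  rw [h.succ.2.1 k (by omega), h.succ.2.2.1 k (by omega)]

theorem Valid.noSingle_succ (h : Valid sz t P fr) (hs : NoSingle sz t P) :
    NoSingle sz (t + 1) P := by
  intro j hj hb hP
  rw [h.succ.2.1 _ hP]
  refine hs j ?_ hb hP
  by_contra hc
  exact hP (h.out j (by omega))

/-- The invariants of the algorithm. -/
structure Good (ε : ℝ) (sz : ℕ → ℝ) (n : ℕ) (s : State) : Prop where
  valid : Valid sz n s.1 s.2
  ne : ∀ i < n, s.1 i ≠ 0
  chi : -3 ≤ labelSum chi sz n s.1 s.2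
  psi : labelSum (psi ε) sz n s.1 s.2 ≤ 2

/-- The volume `8` is `1` for freeing, `3` for rebalancing and `4` for placing. The disjunction
records why reinsertion will keep `psi ≤ 2`: either the pool volume is already budgeted, or there is
no single, so that no insertion of a small item raises `psi`. -/
theorem prepare_spec (h0 : ∀ i < t + 1, 0 < sz i) (h1 : ∀ i < t + 1, sz i ≤ 1) (hε : 0 ≤ ε)
    (hs : Good ε sz t s) (he : prepare sz t s = s') :
    Valid sz (t + 1) s'.1 s'.2 ∧ (∀ i < t + 1, s'.1 i = 0 → ¬ Big (sz i)) ∧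
      -3 ≤ labelSum chi sz (t + 1) s'.1 s'.2 ∧
      (labelSum (psi ε) sz (t + 1) s'.1 s'.2 + ld sz (t + 1) s'.1 0 ≤ 2 ∨
        NoSingle sz (t + 1) s'.1 ∧ labelSum (psi ε) sz (t + 1) s'.1 s'.2 ≤ 2) ∧
      moved sz t s.1 s'.1 ≤ 8 := by
  obtain ⟨P, fr⟩ := s
  have h0' : ∀ i < t, 0 < sz i := fun i hi => h0 i (by omega)
  have h1' : ∀ i < t, sz i ≤ 1 := fun i hi => h1 i (by omega)
  unfold prepare at he
  dsimp only at he
  obtain ⟨hT, ho, hcl, hp, hX, hY, hpool, hm⟩ :=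
    freeOpen_spec (ε := ε) h0' hs.valid hs.ne rfl
  have hX3 := hs.chi
  have hY2 := hs.psi
  dsimp only at hX hY hX3 hY2 hm hT ⊢
  rw [← hX] at hX3
  rw [← hY] at hY2
  generalize freeOpen sz t P = P₁ at *
  have hbs : ¬ Big (sz t) → sz t < 1 / 2 := fun h => by
    unfold Big at h
    linarith
  by_cases hw : pickSmall sz t P₁ = 0 <;> by_cases hb : Big (sz t) <;>
    simp only [hw, hb, if_true, if_false] at he
  · obtain ⟨P₂, fr₂, h2⟩ : ∃ P₂ fr₂, rebalance sz t (P₁, fr) = (P₂, fr₂) := ⟨_, _, rfl⟩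
    obtain ⟨hT₂, ho₂, hs₂, hz₂, hX₂, hY₂, hm₂⟩ := rebalance_spec h0' h1' hε hT ho hp
      (pickSmall_eq_zero hw) hX3 hY2 h2
    have hw₂ : pickSmall sz t P₂ = 0 := by
      by_contra hc
      obtain ⟨-, h3, -⟩ := pick_pos hc
      exact hs₂ ⟨_, h3⟩
    have hpool₂ : ld sz t P₂ 0 < 1 := by
      rwa [ld, binSum_congr (Q := P₁) fun i _ => hz₂ i]
    have pl := place_spec h0 h1 hε hT₂ ho₂ (fun i hi h => hp i hi ((hz₂ i).1 h))
      (fun h => absurd h hs₂) hb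
    rw [h2] at he
    rw [hw₂, he] at pl
    obtain ⟨h3, h4⟩ := pl.mixed hs₂
    -- The budget is `-1 - 1` for `chi`, and `1/2` plus a pool volume below `1` for `psi`.
    refine ⟨pl.valid, pl.pool, by omega, Or.inl (by linarith), ?_⟩
    have h5 := moved_triangle h0' P P₁ P₂
    have h6 := moved_triangle h0' P P₂ s'.1
    linarith [pl.moved]
  · obtain ⟨P₂, fr₂, h2⟩ : ∃ P₂ fr₂, rebalance sz t (P₁, fr) = (P₂, fr₂) := ⟨_, _, rfl⟩
    obtain ⟨hT₂, ho₂, hs₂, hz₂, hX₂, hY₂, hm₂⟩ := rebalance_spec h0' h1' hε hT ho hp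
      (pickSmall_eq_zero hw) hX3 hY2 h2
    rw [h2] at he
    subst he
    have hV := hT₂.valid ho₂ (fun h => absurd h hs₂)
    have hpool₂ : ld sz t P₂ 0 < 1 := by
      rwa [ld, binSum_congr (Q := P₁) fun i _ => hz₂ i]
    refine ⟨hV.succ.1, fun i hi h3 => ?_, ?_, Or.inl ?_, ?_⟩
    · rcases Nat.lt_succ_iff_lt_or_eq.1 hi with hi | rfl
      · exact hp i hi ((hz₂ i).1 h3)
      · exact hb
    · rw [hV.labelSum_succ]
      dsimp only
      omega
    · rw [hV.labelSum_succ, hV.succ.2.2.2]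
      dsimp only at *
      -- The bound `2` consists of `1/2` for `psi`, `1` for the pool and `1/2` for the new small
      -- item.
      linarith [hbs hb]
    · have h5 := moved_triangle h0' P P₁ P₂
      dsimp only
      linarith
  · have pl := place_spec h0 h1 hε hT ho hp hcl hb
    rw [he] at pl
    obtain ⟨-, h3, -⟩ := pick_pos hw
    obtain ⟨h4, h5, h6⟩ := pl.small ⟨_, h3⟩
    refine ⟨pl.valid, pl.pool, by omega, Or.inr ⟨h4, by linarith⟩, ?_⟩
    have h7 := moved_triangle h0' P P₁ s'.1
    linarith [pl.moved]
  · subst he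
    have hV := hT.valid ho hcl
    obtain ⟨-, h3, -⟩ := pick_pos hw
    refine ⟨hV.succ.1, fun i hi h3 => ?_, ?_, Or.inr ⟨hV.noSingle_succ (hcl ⟨_, h3⟩), ?_⟩, ?_⟩
    · rcases Nat.lt_succ_iff_lt_or_eq.1 hi with hi | rfl
      · exact hp i hi h3
      · exact hb
    · rwa [hV.labelSum_succ]
    · rwa [hV.labelSum_succ]
    · dsimp only
      linarith

/-- Reinsertion moves no item that already has a bin, so the migration is that of `prepare`, and it
vanishes for items smaller than `ε`. -/
theorem arrive_spec (h0 : ∀ i < t + 1, 0 < sz i) (h1 : ∀ i < t + 1, sz i ≤ 1) (hε : 0 ≤ ε)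
    (hε' : ε ≤ 1 / 2) (hs : Good ε sz t s) :
    Good ε sz (t + 1) (arrive ε sz t s) ∧
      moved sz t s.1 (arrive ε sz t s).1 ≤ if ε ≤ sz t then 8 else 0 := by
  unfold arrive
  split_ifs with ht
  · obtain ⟨hV, hp, hX, hY, hm⟩ := prepare_spec h0 h1 hε hs rfl
    generalize prepare sz t s = s' at *
    obtain ⟨he, hne⟩ := extends_insertUpTo (ε := ε) (j := t + 1) h0 hε hV hp le_rfl
    refine ⟨⟨he.valid, hne, hX.trans he.chi, ?_⟩, le_trans (sum_le_sum fun i hi => ?_) hm⟩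
    · rcases hY with hY | ⟨h2, h3⟩
      · have h4 := he.psi
        have h5 := ld_nonneg (P := (insertUpTo sz (t + 1) s' (t + 1)).1) h0 0
        linarith
      · exact (he.noSingle h2).2.trans h3
    · have hi' := mem_range.1 hi
      have := h0 i (by omega)
      have h2 := hs.ne i hi'
      have h3 := he.keep i
      split_ifs with h4 h5
      · exact le_rfl
      · push Not at h5
        rw [h5] at h2
        rw [h5, h3 h2] at h4
        exact absurd rfl h4
      · exact this.le
      · exact le_rfl
  · have hV := hs.valid.succ
    have hlt : sz t < ε := not_le.1 ht
    have htiny : ∀ i < t + 1, s.1 i = 0 → i = t := fun i hi h => by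
      rcases Nat.lt_succ_iff_lt_or_eq.1 hi with hi | rfl
      · exact absurd h (hs.ne i hi)
      · rfl
    -- Since `ε ≤ 1/2`, an item smaller than `ε` is not big; it is the only item without a bin.
    obtain ⟨he, hne⟩ := extends_insertUpTo (ε := ε) (j := t + 1) h0 hε hV.1 (fun i hi h => by
      rw [htiny i hi h]
      unfold Big
      linarith) le_rfl
    refine ⟨⟨he.valid, hne, ?_, ?_⟩, ?_⟩
    · have := he.chi
      rw [hs.valid.labelSum_succ] at this
      exact hs.chi.trans this
    · have := he.tiny fun i hi h => by rwa [htiny i hi h]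
      rw [hs.valid.labelSum_succ] at this
      exact this.trans hs.psi
    · refine (sum_eq_zero fun i hi => ?_).le
      have h3 := he.keep i (hs.ne i (mem_range.1 hi))
      rw [h3]
      simp

theorem run_good (h0 : ∀ i < n, 0 < sz i) (h1 : ∀ i < n, sz i ≤ 1) (hε : 0 ≤ ε)
    (hε' : ε ≤ 1 / 2) : Good ε sz n (run ε sz n) := by
  induction n with
  | zero =>
    refine ⟨⟨fun i => by simp [run], fun _ _ => rfl, fun k hk => labelOK_of_forall_ne (by simp),
      by simp, by simp, fun k hk _ h => ?_⟩, by simp, by simp [run, labelSum],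
      by simp [run, labelSum]⟩
    simp [binSum] at h
    linarith
  | succ n ih =>
    exact (arrive_spec h0 h1 hε hε' (ih (fun i hi => h0 i (by omega))
      fun i hi => h1 i (by omega))).1

end

noncomputable section

variable {sz w : ℕ → ℝ} {n i j k l fr F : ℕ} {P Q : ℕ → ℕ} {ε δ : ℝ} {s : State}

/-! ## The competitive ratio -/

theorem load_eq (I : List ℝ) (P : ℕ → ℕ) (k : ℕ) : load I P k = ld (size I) I.length P k := by
  rw [load, sum_filter, ld, binSum]

theorem sum_eq_sum_binSum (hP : ∀ i < n, P i ≠ 0) (hF : ∀ i, P i < F) :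
    ∑ i ∈ range n, w i = ∑ k ∈ Ico 1 F, binSum w n P k := by
  unfold binSum
  rw [sum_comm]
  refine sum_congr rfl fun i hi => ?_
  rw [sum_ite_eq, if_pos]
  have := hP i (mem_range.1 hi)
  exact mem_Ico.2 ⟨by omega, hF i⟩

/-- The covered bins of an optimal solution are disjoint, and each has weight at least `c`. It is
used with `c = 1` for sizes and with `c = 2` for the weights below. -/
theorem mul_opt_le (I : List ℝ) (hw : ∀ i < I.length, 0 ≤ w i) {c : ℝ}
    (h : ∀ Q k, 1 ≤ ld (size I) I.length Q k → c ≤ binSum w I.length Q k) :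
    c * opt I ≤ ∑ i ∈ range I.length, w i := by
  obtain ⟨Q, hQ⟩ := (isGreatest_opt I).1
  rw [← hQ]
  unfold numCovered
  rw [← sum_fiberwise_of_maps_to (s := range I.length) (t := (range I.length).image Q) (g := Q)
    fun i hi => mem_image_of_mem Q hi]
  have h2 : ∀ k, ∑ i ∈ range I.length with Q i = k, w i = binSum w I.length Q k := fun k => by
    rw [sum_filter, binSum]
  simp only [h2]
  calc c * _ = ∑ k ∈ ((range I.length).image Q).filter (fun k => 1 ≤ load I Q k), c := by
        rw [sum_const, nsmul_eq_mul, mul_comm]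
    _ ≤ ∑ k ∈ ((range I.length).image Q).filter (fun k => 1 ≤ load I Q k),
          binSum w I.length Q k := sum_le_sum fun k hk => by
        have := (mem_filter.1 hk).2
        rw [load_eq] at this
        exact h Q k this
    _ ≤ _ := sum_le_sum_of_subset_of_nonneg (filter_subset _ _) fun k _ _ =>
        sum_nonneg fun i hi => by
          split_ifs
          · exact hw i (mem_range.1 hi)
          · exact le_rfl

theorem numCovered_eq (I : List ℝ) (hP : ∀ i < I.length, P i ≠ 0) (hF : ∀ i, P i < F) :
    (numCovered I P : ℝ) =
      ∑ k ∈ Ico 1 F, if 1 ≤ ld (size I) I.length P k then (1 : ℝ) else 0 := by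
  rw [← sum_filter, sum_const, nsmul_eq_mul, mul_one, numCovered]
  congr 2
  ext k
  simp only [mem_filter, load_eq, mem_image, mem_range, mem_Ico]
  constructor
  · rintro ⟨⟨i, hi, rfl⟩, h⟩
    have := hP i hi
    exact ⟨⟨by omega, hF i⟩, h⟩
  · rintro ⟨-, h⟩
    obtain ⟨i, hi, hk⟩ :=
      exists_mem_of_ld (sz := size I) (n := I.length) (P := P) (k := k) (by linarith)
    exact ⟨⟨i, hi, hk⟩, h⟩

theorem ld_le_two (h1 : ∀ i < n, sz i ≤ 1) (hok : LabelOK sz n P k) (hN : nb sz n P k = 2) :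
    ld sz n P k ≤ 2 := by
  have : ld sz n P k ≤ ((nb sz n P k : ℕ) : ℝ) := by
    unfold ld nb binSum
    push_cast
    refine sum_le_sum fun i hi => ?_
    split_ifs with h
    · rw [bigInd_of_big (hok.2.1 hN i (mem_range.1 hi) h).1]
      simpa using h1 i (mem_range.1 hi)
    · simp
  rw [hN] at this
  exact_mod_cast this

/-- The volume argument: the definition of `psi` makes the bound hold bin by bin, except for at most
one uncovered bin, which costs `1`; `psi ≤ 2` supplies the rest of the constant. -/
theorem sum_le_of_good (h0 : ∀ i < n, 0 < sz i) (h1 : ∀ i < n, sz i ≤ 1) (hε : 0 ≤ ε)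
    (hG : Good ε sz n s) (hi : i < n) (hN : nb sz n s.1 (s.1 i) = 0) :
    ∑ i ∈ range n, sz i ≤ (3 / 2 + ε) *
      (∑ k ∈ Ico 1 s.2, if 1 ≤ ld sz n s.1 k then (1 : ℝ) else 0) + 3 := by
  obtain ⟨P, fr⟩ := s
  dsimp only at *
  have hV := hG.valid
  have hP := hG.ne
  dsimp only at hV hP
  have hsi : ¬ Big (sz i) := fun hb => by
    have := one_le_nb hi rfl hb (P := P)
    omega
  -- If the given bin is covered, `closed` excludes singles and `opn` leaves only one uncovered bin.
  -- If it is uncovered, `opn` would force a big item into it as soon as another uncovered bin were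
  -- in use.
  obtain ⟨l, hl⟩ : ∃ l, ∀ j < n, ld sz n P (P j) < 1 → P j = l ∧ nb sz n P (P j) = 0 := by
    by_cases hc : 1 ≤ ld sz n P (P i)
    · have hns := hV.closed _ (hP i hi) hN hc
      by_cases hex : ∃ j < n, ld sz n P (P j) < 1
      · obtain ⟨j, hj, hLj⟩ := hex
        have hsm : ∀ a < n, ld sz n P (P a) < 1 → ¬ Big (sz a) := fun a ha hLa hb => by
          have := hns a ha hb (hP a ha)
          linarith
        refine ⟨P j, fun a ha hLa => ⟨?_, ?_⟩⟩
        · by_contra hne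
          exact hsm a ha hLa (hV.opn j hj a ha (hsm j hj hLj) (hP j hj) (hP a ha) hLj hLa hne).1
        · by_contra hne
          obtain ⟨b, hb, hPb, hbb⟩ := exists_big hne
          exact hsm b hb (by rwa [hPb]) hbb
      · push Not at hex
        exact ⟨0, fun j hj h => by linarith [hex j hj]⟩
    · refine ⟨P i, fun j hj hLj => ?_⟩
      have : P j = P i := by
        by_contra hne
        obtain ⟨-, b, hb, hbb, hPb, -⟩ :=
          hV.opn i hi j hj hsi (hP i hi) (hP j hj) (not_le.1 hc) hLj hne
        have := one_le_nb hb hPb hbb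
        omega
      rw [this]
      exact ⟨rfl, hN⟩
  rw [sum_eq_sum_binSum hP hV.lt, mul_sum]
  have key : ∀ k ∈ Ico 1 fr, binSum sz n P k ≤
      (3 / 2 + ε) * (if 1 ≤ ld sz n P k then (1 : ℝ) else 0) +
        psi ε (ld sz n P k) (nb sz n P k) + if k = l then 1 else 0 := fun k hk => by
    have hk0 : k ≠ 0 := by
      have := mem_Ico.1 hk
      omega
    have hok := hV.ok k hk0
    by_cases hc : 1 ≤ ld sz n P k
    · have h2 : (0 : ℝ) ≤ if k = l then 1 else 0 := by split_ifs <;> norm_num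
      rw [if_pos hc]
      have h3 := hok.1
      have h4 := hok.ld_lt h1
      have h5 := ld_le_two h1 hok
      unfold psi
      rw [if_neg (not_lt.2 hc)]
      generalize nb sz n P k = b at *
      unfold ld at *
      interval_cases b
      · have := h4 (by omega)
        simp only [OfNat.zero_ne_ofNat, if_false, zero_ne_one]
        linarith
      · simp only [OfNat.one_ne_ofNat, if_false, if_true]
        linarith
      · have := h5 rfl
        simp only [if_true]
        linarith
    · rw [if_neg hc]
      by_cases hz : ld sz n P k = 0
      · have h2 : nb sz n P k = 0 := by
          by_contra hne
          obtain ⟨b, hb, hPb, -⟩ := exists_big hne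
          have := le_ld h0 hb hPb
          linarith [h0 b hb]
        change ld sz n P k ≤ _
        rw [h2, hz, psi_zero]
        split_ifs <;> norm_num
      · obtain ⟨j, hj, rfl⟩ := exists_mem_of_ld hz
        obtain ⟨h2, h3⟩ := hl j hj (not_le.1 hc)
        rw [if_pos h2, h3]
        simp only [psi, OfNat.zero_ne_ofNat, if_false, zero_ne_one]
        unfold ld at *
        linarith
  refine (sum_le_sum key).trans ?_
  rw [sum_add_distrib, sum_add_distrib, sum_ite_eq']
  have h2 := hG.psi
  unfold labelSum at h2
  dsimp only at h2
  have h3 : (if l ∈ Ico 1 fr then (1 : ℝ) else 0) ≤ 1 := by split_ifs <;> norm_num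
  linarith

/-! ### The weight argument, for solutions without a bin of small items only. -/

theorem binSum_eq_of_one (hi : i < n) (hP : P i = k)
    (h : ∀ j < n, P j = k → j ≠ i → w j = sz j / δ) :
    binSum w n P k = w i + (ld sz n P k - sz i) / δ := by
  have : ∀ j ∈ range n, (if P j = k then w j else 0) =
      (if P j = k then sz j else 0) / δ + if j = i then w i - sz i / δ else 0 := fun j hj => by
    by_cases hji : j = i
    · simp [hji, hP]
    · by_cases hjk : P j = k
      · simp [hji, hjk, h j (mem_range.1 hj) hjk hji]
      · simp [hji, hjk]
  unfold ld binSum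
  rw [sum_congr rfl this, sum_add_distrib, ← sum_div, sum_ite_eq', if_pos (mem_range.2 hi)]
  ring

theorem binSum_eq_of_two (hi : i < n) (hj : j < n) (hij : i ≠ j) (hP : P i = k) (hP' : P j = k)
    (h : ∀ a < n, P a = k → a ≠ i → a ≠ j → w a = sz a / δ) :
    binSum w n P k = w i + w j + (ld sz n P k - sz i - sz j) / δ := by
  have : ∀ a ∈ range n, (if P a = k then w a else 0) =
      (if P a = k then sz a else 0) / δ + (if a = i then w i - sz i / δ else 0) +
        if a = j then w j - sz j / δ else 0 := fun a ha => by
    by_cases hai : a = i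
    · subst hai
      simp [hij, hP]
    · by_cases haj : a = j
      · subst haj
        simp [hai, hP']
      · by_cases hak : P a = k
        · simp [hai, haj, hak, h a (mem_range.1 ha) hak hai haj]
        · simp [hai, haj, hak]
  unfold ld binSum
  rw [sum_congr rfl this, sum_add_distrib, sum_add_distrib, ← sum_div, sum_ite_eq', sum_ite_eq',
    if_pos (mem_range.2 hi), if_pos (mem_range.2 hj)]
  ring

/-- The weights of the items: `T` contains the items that cover their bin. -/
def weight (sz : ℕ → ℝ) (δ : ℝ) (T : Set ℕ) (i : ℕ) : ℝ :=
  if Big (sz i) then max 1 (2 - (1 - sz i) / δ) else if i ∈ T then 1 else sz i / δ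

/-- Call an item heavy if it is big or in `T`; it then weighs at least `1`, so two heavy items
suffice. With one heavy item the light ones add at least `(1 - s) / δ`, which fills the deficit of a
big item and is at least `1` for a small one. Without heavy items the load `1` gives `1 / δ ≥ 2`.
Nothing is needed about the choice of `T`. -/
theorem two_le_binSum_weight (h0 : ∀ i < n, 0 < sz i) (hδ : 0 < δ) (hδ' : δ ≤ 1 / 2) (T : Set ℕ)
    (hL : 1 ≤ ld sz n Q k) : 2 ≤ binSum (weight sz δ T) n Q k := by
  have hpos : ∀ i < n, 0 < weight sz δ T i := fun i hi => by
    unfold weight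
    split_ifs
    · exact lt_of_lt_of_le one_pos (le_max_left _ _)
    · exact one_pos
    · exact div_pos (h0 i hi) hδ
  have hheavy : ∀ i, Big (sz i) ∨ i ∈ T → 1 ≤ weight sz δ T i := fun i hi => by
    unfold weight
    split_ifs with h1 h2
    · exact le_max_left _ _
    · exact le_rfl
    · tauto
  have hlight : ∀ i, ¬ (Big (sz i) ∨ i ∈ T) → weight sz δ T i = sz i / δ := fun i hi => by
    rw [weight, if_neg (by tauto), if_neg (by tauto)]
  by_cases he : ∃ i < n, Q i = k ∧ (Big (sz i) ∨ i ∈ T)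
  · obtain ⟨i, hi, hQi, hh⟩ := he
    by_cases he' : ∃ j < n, j ≠ i ∧ Q j = k ∧ (Big (sz j) ∨ j ∈ T)
    · obtain ⟨j, hj, hji, hQj, hh'⟩ := he'
      have := add_le_ld hpos hi hj hji.symm hQi hQj
      unfold ld at this
      linarith [hheavy i hh, hheavy j hh']
    · rw [binSum_eq_of_one (sz := sz) (δ := δ) hi hQi fun j hj hQj hji =>
        hlight j fun h => he' ⟨j, hj, hji, hQj, h⟩]
      have h2 : (1 - sz i) / δ ≤ (ld sz n Q k - sz i) / δ := by gcongr
      by_cases hb : Big (sz i)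
      · have h3 : 2 - (1 - sz i) / δ ≤ weight sz δ T i := by
          rw [weight, if_pos hb]
          exact le_max_right _ _
        linarith
      · have h3 : 1 ≤ (1 - sz i) / δ := by
          rw [le_div_iff₀ hδ]
          unfold Big at hb
          linarith
        linarith [hheavy i hh]
  · push Not at he
    have : binSum (weight sz δ T) n Q k = ld sz n Q k / δ := by
      unfold ld binSum
      rw [sum_div]
      refine sum_congr rfl fun i hi => ?_
      split_ifs with h
      · exact hlight i (by have := he i (mem_range.1 hi) h; tauto)
      · simp
    rw [this, le_div_iff₀ hδ]
    linarith

theorem Valid.exists_threshold (h0 : ∀ i < n, 0 < sz i) (hV : Valid sz n P fr)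
    (hP : ∀ i < n, P i ≠ 0) : ∃ δ : ℝ, 0 < δ ∧ δ ≤ 1 / 2 ∧
      (∀ i < n, Big (sz i) → rank sz n P (P i) ≠ 2 → sz i ≤ 1 - δ) ∧
      (∀ i < n, Big (sz i) → rank sz n P (P i) = 2 → 1 - δ ≤ sz i) ∧
      ∀ i < n, ∀ b < n, ¬ Big (sz i) → ld sz n P (P i) < 1 → Big (sz b) → P b = P i →
        1 - δ ≤ sz b := by
  -- The value `1 - δ` is the largest size of a big item outside the mixed bins, or `1/2` if there
  -- is none.
  let S := (range n).filter fun i => Big (sz i) ∧ rank sz n P (P i) ≠ 2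
  have hrle : ∀ i, rank sz n P (P i) ≤ 2 := fun i => by unfold rank; split_ifs <;> omega
  by_cases hS : S.Nonempty
  · obtain ⟨m, hm, hmax⟩ := S.exists_max_image sz hS
    obtain ⟨hm1, hbm, hrm⟩ := mem_filter.1 hm
    have hmn := mem_range.1 hm1
    have hm_lt : sz m < 1 := by
      unfold rank at hrm
      split_ifs at hrm with h1 h2
      · exact ((hV.ok _ (hP m hmn)).2.1 h1 m hmn rfl).2
      · exact (le_ld h0 hmn rfl).trans_lt h2
      · exact absurd rfl hrm
    refine ⟨1 - sz m, by linarith, by unfold Big at hbm; linarith, fun i hi hb hr => ?_,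
      fun i hi hb hr => ?_, fun i hi b hb hsi hL hbb hPb => ?_⟩
    · have := hmax i (mem_filter.2 ⟨mem_range.2 hi, hb, hr⟩)
      linarith
    · have := hV.order i hi m hmn hb hbm (hP i hi) (hP m hmn) (by have := hrle m; omega)
      linarith
    · have hrb : rank sz n P (P b) = 1 := by
        rw [hPb]
        exact rank_uncovered h0 hL
      suffices sz m ≤ sz b by linarith
      by_cases hr0 : rank sz n P (P m) = 0
      · exact hV.order b hb m hmn hbb hbm (hP b hb) (hP m hmn) (by omega)
      · have hLm : ld sz n P (P m) < 1 := by
          unfold rank at hrm hr0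
          by_contra hc
          split_ifs at hrm hr0 <;> tauto
        by_cases hmi : P m = P i
        · rw [eq_of_nb_le_one (nb_le_one h0 hL) hb hmn hPb hmi hbb hbm]
        · obtain ⟨-, b', hb', hbb', hPb', hle⟩ :=
            hV.opn i hi m hmn hsi (hP i hi) (hP m hmn) hL hLm hmi
          rwa [eq_of_nb_le_one (nb_le_one h0 hL) hb hb' hPb hPb' hbb hbb']
  · rw [not_nonempty_iff_eq_empty] at hS
    have hn : ∀ i < n, Big (sz i) → rank sz n P (P i) = 2 := fun i hi hb => by
      by_contra hc
      have : i ∈ S := mem_filter.2 ⟨mem_range.2 hi, hb, hc⟩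
      rw [hS] at this
      simp at this
    refine ⟨1 / 2, by norm_num, le_rfl, fun i hi hb hr => absurd (hn i hi hb) hr,
      fun i hi hb _ => ?_, fun i hi b hb _ _ hbb _ => ?_⟩
    · unfold Big at hb
      linarith
    · unfold Big at hbb
      linarith

/-- Singles and paired items have weight `1`, so a pair weighs `2 = 3 - 1` and a single bin without
small items `1 = 0 + 1`, where the correction is `-chi`. Mixed bins weigh at most `3`, and the one
uncovered bin with small items costs at most `1` more. -/
theorem Valid.sum_weight_le (h0 : ∀ i < n, 0 < sz i) (h1 : ∀ i < n, sz i ≤ 1)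
    (hV : Valid sz n P fr) (hP : ∀ i < n, P i ≠ 0) (hN : ∀ i < n, nb sz n P (P i) ≠ 0) :
    ∃ δ : ℝ, 0 < δ ∧ δ ≤ 1 / 2 ∧ ∃ T : Set ℕ, ∑ i ∈ range n, weight sz δ T i ≤
      3 * (∑ k ∈ Ico 1 fr, if 1 ≤ ld sz n P k then (1 : ℝ) else 0) -
        ((labelSum chi sz n P fr : ℤ) : ℝ) + 1 := by
  obtain ⟨δ, hδ, hδ', hlow, hhigh, hopen⟩ := hV.exists_threshold h0 hP
  -- A small item whose removal uncovers the bin `k` is fixed for each mixed bin; these items form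
  -- `T`. The default `0` is never used as such an item.
  have hlast : ∀ k, ∃ i, nb sz n P k ≤ 1 → 1 ≤ ld sz n P k → k ≠ 0 →
      (∀ i < n, P i = k → Big (sz i)) ∨ i < n ∧ P i = k ∧ ¬ Big (sz i) ∧
        ld sz n P k - sz i < 1 := fun k => by
    by_cases hk : nb sz n P k ≤ 1 ∧ 1 ≤ ld sz n P k ∧ k ≠ 0
    · rcases (hV.ok k hk.2.2).2.2 hk.1 hk.2.1 with h | ⟨i, hi, h⟩
      · exact ⟨0, fun _ _ _ => Or.inl h⟩
      · exact ⟨i, fun _ _ _ => Or.inr ⟨hi, h⟩⟩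
    · exact ⟨0, fun h2 h3 h4 => absurd ⟨h2, h3, h4⟩ hk⟩
  choose f hf using hlast
  let T : Set ℕ := {i | 1 ≤ ld sz n P (P i) ∧ f (P i) = i}
  refine ⟨δ, hδ, hδ', T, ?_⟩
  obtain ⟨l, hl⟩ : ∃ l, ∀ j < n, ¬ Big (sz j) → ld sz n P (P j) < 1 → P j = l := by
    by_cases hex : ∃ j < n, ¬ Big (sz j) ∧ ld sz n P (P j) < 1
    · obtain ⟨j, hj, hb, hL⟩ := hex
      refine ⟨P j, fun a ha hba hLa => ?_⟩
      by_contra hne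
      exact hba (hV.opn j hj a ha hb (hP j hj) (hP a ha) hL hLa hne).1
    · exact ⟨0, fun j hj hb hL => absurd ⟨j, hj, hb, hL⟩ hex⟩
  have hwlow : ∀ i < n, Big (sz i) → rank sz n P (P i) ≠ 2 → weight sz δ T i = 1 :=
    fun i hi hb hr => by
      rw [weight, if_pos hb, max_eq_left]
      have : 1 ≤ (1 - sz i) / δ := by
        rw [le_div_iff₀ hδ]
        linarith [hlow i hi hb hr]
      linarith
  have hwhigh : ∀ i < n, Big (sz i) → rank sz n P (P i) = 2 →
      weight sz δ T i = 2 - (1 - sz i) / δ := fun i hi hb hr => by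
    rw [weight, if_pos hb, max_eq_right]
    have : (1 - sz i) / δ ≤ 1 := by
      rw [div_le_iff₀ hδ]
      linarith [hhigh i hi hb hr]
    linarith
  have key : ∀ k ∈ Ico 1 fr, binSum (weight sz δ T) n P k ≤
      3 * (if 1 ≤ ld sz n P k then (1 : ℝ) else 0) - (chi (ld sz n P k) (nb sz n P k) : ℤ) +
        if k = l then 1 else 0 := fun k hk => by
    have hk0 : k ≠ 0 := by
      have := mem_Ico.1 hk
      omega
    have h2 : (0 : ℝ) ≤ if k = l then 1 else 0 := by split_ifs <;> norm_num
    have hok := hV.ok k hk0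
    have hb3 := hok.1
    by_cases hb0 : nb sz n P k = 0
    · have hne : ∀ i < n, P i ≠ k := fun i hi h => hN i hi (h ▸ hb0)
      rw [binSum_empty _ hne, hb0, ld, binSum_empty _ hne, chi_zero]
      rw [if_neg (by norm_num)]
      simpa using h2
    by_cases hb2 : nb sz n P k = 2
    · have h3 := one_le_ld_of_nb h0 (P := P) (k := k) hb2.ge
      have h4 : binSum (weight sz δ T) n P k = ((nb sz n P k : ℕ) : ℝ) := by
        unfold nb binSum
        push_cast
        refine sum_congr rfl fun i hi => ?_
        split_ifs with h
        · have hi' := mem_range.1 hi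
          have hbi := (hok.2.1 hb2 i hi' h).1
          rw [bigInd_of_big hbi, hwlow i hi' hbi]
          · simp
          · rw [h, rank_paired hb2]
            omega
        · simp
      rw [h4, hb2, if_pos h3]
      simp only [chi, if_true]
      push_cast
      linarith
    have hb1 : nb sz n P k = 1 := by omega
    obtain ⟨b, hb, hPb, hbb⟩ := exists_big hb0
    have huniq : ∀ a < n, P a = k → Big (sz a) → a = b := fun a ha hPa hba =>
      eq_of_nb_le_one hb1.le ha hb hPa hPb hba hbb
    by_cases hc : 1 ≤ ld sz n P k
    · have hr : rank sz n P (P b) = 2 := by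
        rw [hPb]
        unfold rank
        rw [if_neg hb2, if_neg (not_lt.2 hc)]
      have hwb := hwhigh b hb hbb hr
      have hch : chi (ld sz n P k) (nb sz n P k) = 0 := by
        rw [hb1]
        simp [chi, not_lt.2 hc]
      rw [hch, if_pos hc]
      rcases hf k hb1.le hc hk0 with h3 | ⟨h3, h4, h5, h6⟩
      · rw [binSum_eq_of_one (sz := sz) (δ := δ) hb hPb fun j hj hPj hjb =>
          absurd (huniq j hj hPj (h3 j hj hPj)) hjb]
        have h7 : ld sz n P k = sz b := ld_eq_of_forall hb hPb fun j hj hPj =>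
          huniq j hj hPj (h3 j hj hPj)
        have h8 : 0 ≤ (1 - sz b) / δ := div_nonneg (by linarith [h1 b hb]) hδ.le
        rw [h7, hwb, sub_self, zero_div]
        push_cast
        linarith
      · have hfb : b ≠ f k := by
          intro h
          rw [← h] at h5
          exact h5 hbb
        have hwf : weight sz δ T (f k) = 1 := by
          rw [weight, if_neg h5, if_pos]
          change 1 ≤ ld sz n P (P (f k)) ∧ f (P (f k)) = f k
          rw [h4]
          exact ⟨hc, rfl⟩
        rw [binSum_eq_of_two (sz := sz) (δ := δ) hb h3 hfb hPb h4 fun a ha hPa hab haf => by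
          rw [weight, if_neg fun h => hab (huniq a ha hPa h), if_neg]
          rintro ⟨-, h⟩
          rw [hPa] at h
          exact haf h.symm]
        -- Without `f k` the load is below `1`, so the remaining small items weigh at most `(1 - sz
        -- b) / δ`, exactly what is subtracted in the weight of `b`.
        have h7 : (ld sz n P k - sz b - sz (f k)) / δ ≤ (1 - sz b) / δ :=
          div_le_div_of_nonneg_right (by linarith) hδ.le
        rw [hwb, hwf]
        push_cast
        linarith
    · have hLk := not_le.1 hc
      have hr : rank sz n P (P b) ≠ 2 := by
        rw [hPb, rank_uncovered h0 hLk]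
        omega
      have hwb := hwlow b hb hbb hr
      have hch : chi (ld sz n P k) (nb sz n P k) = -1 := by
        rw [hb1]
        simp [chi, hLk]
      rw [hch, if_neg hc]
      rw [binSum_eq_of_one (sz := sz) (δ := δ) hb hPb fun j hj hPj hjb => by
        rw [weight, if_neg fun h => hjb (huniq j hj hPj h), if_neg]
        rintro ⟨h, -⟩
        rw [hPj] at h
        exact hc h]
      rw [hwb]
      by_cases hsm : ∃ i < n, P i = k ∧ ¬ Big (sz i)
      · obtain ⟨i, hi, hPi, hbi⟩ := hsm
        have h3 := hopen i hi b hb hbi (by rwa [hPi]) hbb (by rw [hPb, hPi])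
        have h4 : k = l := by rw [← hPi, hl i hi hbi (by rwa [hPi])]
        -- The load is below `1` and `b` has size at least `1 - δ`, so the small items have total
        -- size below `δ`.
        have h5 : (ld sz n P k - sz b) / δ ≤ 1 := by
          rw [div_le_iff₀ hδ]
          linarith
        rw [if_pos h4]
        push_cast
        linarith
      · push Not at hsm
        rw [ld_eq_of_forall hb hPb fun j hj hPj => huniq j hj hPj (hsm j hj hPj), sub_self,
          zero_div]
        push_cast
        linarith
  rw [sum_eq_sum_binSum hP hV.lt]
  refine (sum_le_sum key).trans ?_
  rw [sum_add_distrib, sum_sub_distrib, sum_ite_eq', ← mul_sum]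
  have h3 : (if l ∈ Ico 1 fr then (1 : ℝ) else 0) ≤ 1 := by split_ifs <;> norm_num
  unfold labelSum
  push_cast
  linarith

theorem opt_le_of_good {I : List ℝ} (h0 : ∀ i < I.length, 0 < size I i)
    (h1 : ∀ i < I.length, size I i ≤ 1) (hε : 0 ≤ ε) (hG : Good ε (size I) I.length s) :
    (opt I : ℝ) ≤ (3 / 2 + ε) * numCovered I s.1 + 3 := by
  rw [numCovered_eq I hG.ne hG.valid.lt]
  by_cases h : ∃ i < I.length, nb (size I) I.length s.1 (s.1 i) = 0
  · obtain ⟨i, hi, hN⟩ := h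
    refine le_trans ?_ (sum_le_of_good h0 h1 hε hG hi hN)
    have := mul_opt_le (w := size I) (c := 1) I (fun i hi => (h0 i hi).le) fun Q k h => h
    linarith
  · push Not at h
    obtain ⟨δ, hδ, hδ', T, hT⟩ := hG.valid.sum_weight_le h0 h1 hG.ne h
    have h2 := mul_opt_le (w := weight (size I) δ T) (c := 2) I (fun i hi => by
      unfold weight
      split_ifs
      · exact zero_le_one.trans (le_max_left _ _)
      · exact zero_le_one
      · exact div_nonneg (h0 i hi).le hδ.le) fun Q k h => two_le_binSum_weight h0 hδ hδ' T h
    have h3 : ((-3 : ℤ) : ℝ) ≤ ((labelSum chi (size I) I.length s.1 s.2 : ℤ) : ℝ) := by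
      exact_mod_cast hG.chi
    push_cast at h3
    have h4 : 0 ≤ ∑ k ∈ Ico 1 s.2, if 1 ≤ ld (size I) I.length s.1 k then (1 : ℝ) else 0 :=
      sum_nonneg fun k _ => by split_ifs <;> norm_num
    have h5 := mul_nonneg hε h4
    -- Here `2 opt ≤ 3 ALG + 4`, so the constant `2` would suffice in this case; the other case
    -- determines the constant `3`.
    linarith

end

noncomputable section

/-! ## Migration -/

variable {sz sz' : ℕ → ℝ} {n : ℕ}

theorem pick_congr {C C' : ℕ → Prop} {K K' : ℕ → ℝ} (hC : ∀ i < n, C i ↔ C' i)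
    (hK : ∀ i < n, K i = K' i) : pick C K n = pick C' K' n := by
  induction n with
  | zero => rfl
  | succ n ih =>
    rw [pick, pick, ih (fun i hi => hC i (by omega)) fun i hi => hK i (by omega)]
    have h1 := hC n (by omega)
    have h2 := hK n (by omega)
    rcases pick_cases C' K' n with ⟨e, -⟩ | ⟨i, hi, e, -⟩
    · simp [h1, e]
    · simp [h1, h2, e, hK i (by omega)]

theorem pick_le (C : ℕ → Prop) (K : ℕ → ℝ) (n : ℕ) : pick C K n ≤ n := by
  rcases pick_cases C K n with ⟨e, -⟩ | ⟨i, hi, e, -⟩ <;> omega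

section Congr

variable (h : ∀ i < n, sz i = sz' i)
include h

theorem ld_congr (P : ℕ → ℕ) (k : ℕ) : ld sz n P k = ld sz' n P k :=
  sum_congr rfl fun i hi => by rw [h i (mem_range.1 hi)]

theorem nb_congr (P : ℕ → ℕ) (k : ℕ) : nb sz n P k = nb sz' n P k :=
  sum_congr rfl fun i hi => by rw [bigInd, bigInd, h i (mem_range.1 hi)]

theorem freeOpen_congr (P : ℕ → ℕ) : freeOpen sz n P = freeOpen sz' n P := by
  funext i
  unfold freeOpen
  rw [ld_congr h]
  by_cases hi : i < n
  · rw [h i hi]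
  · simp [hi]

theorem pickSingle_congr (P : ℕ → ℕ) (e : ℕ) : pickSingle sz n P e = pickSingle sz' n P e :=
  pick_congr (fun i hi => by rw [h i hi, ld_congr h]) fun i hi => by rw [h i hi]

theorem pickPaired_congr (P : ℕ → ℕ) : pickPaired sz n P = pickPaired sz' n P :=
  pick_congr (fun i hi => by rw [h i hi, nb_congr h]) h

theorem pickMixed_congr (P : ℕ → ℕ) : pickMixed sz n P = pickMixed sz' n P :=
  pick_congr (fun i hi => by rw [h i hi, ld_congr h, nb_congr h]) fun i hi => by rw [h i hi]

theorem pickSmall_congr (P : ℕ → ℕ) : pickSmall sz n P = pickSmall sz' n P :=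
  pick_congr (fun i _ => by rw [ld_congr h, nb_congr h]) h

theorem pickOpen_congr (P : ℕ → ℕ) : pickOpen sz n P = pickOpen sz' n P :=
  pick_congr (fun i _ => by rw [ld_congr h]) fun i _ => ld_congr h P (P i)

theorem numSingle_congr (P : ℕ → ℕ) : numSingle sz n P = numSingle sz' n P :=
  sum_congr rfl fun i hi => by rw [h i (mem_range.1 hi), ld_congr h]

theorem numPaired_congr (P : ℕ → ℕ) : numPaired sz n P = numPaired sz' n P :=
  sum_congr rfl fun i hi => by rw [h i (mem_range.1 hi), nb_congr h]

theorem exchange_congr (P : ℕ → ℕ) {i j : ℕ} (hi : i ≤ n) (hj : j ≤ n) :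
    exchange sz P i (j - 1) = exchange sz' P i (j - 1) := by
  unfold exchange
  by_cases h1 : 1 ≤ i
  · rw [h (i - 1) (by omega), h (j - 1) (by omega)]
  · simp [h1]

theorem breakUp_congr (P : ℕ → ℕ) (fr : ℕ) : breakUp sz n P fr = breakUp sz' n P fr := by
  unfold breakUp
  dsimp only
  rw [pickPaired_congr h P, pickPaired_congr h (update _ _ _), pickSingle_congr h]
  exact exchange_congr h _ (pick_le _ _ _) (pick_le _ _ _)

theorem rebalance_congr (s : State) : rebalance sz n s = rebalance sz' n s := by
  unfold rebalance pairUp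
  rw [numPaired_congr h, numSingle_congr h, breakUp_congr h]
  simp only [pickSingle_congr h]

theorem trim_congr (k : ℕ) (P : ℕ → ℕ) {j : ℕ} (hj : j ≤ n) :
    trim sz n k P j = trim sz' n k P j := by
  induction j with
  | zero => rfl
  | succ j ih => rw [trim, trim, ih (by omega), h j (by omega), ld_congr h]

theorem insertItem_congr (i : ℕ) (s : State) : insertItem sz n i s = insertItem sz' n i s := by
  unfold insertItem
  rw [pickOpen_congr h]

theorem insertUpTo_congr (s : State) (j : ℕ) : insertUpTo sz n s j = insertUpTo sz' n s j := by
  induction j with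
  | zero => rfl
  | succ j ih => rw [insertUpTo, insertUpTo, ih, insertItem_congr h]

end Congr

theorem place_congr (h : ∀ i < n + 1, sz i = sz' i) (w : ℕ) (s : State) :
    place sz n w s = place sz' n w s := by
  have hn : ∀ i < n, sz i = sz' i := fun i hi => h i (by omega)
  have h1 : ∀ i ≤ n, placePaired sz n i s.1 = placePaired sz' n i s.1 := fun i hi => by
    unfold placePaired
    rw [h n (by omega), h (i - 1) (by omega)]
  have h2 : (placePaired sz' n (pickPaired sz' n s.1) s.1).2 ≤ n := by
    have : pickPaired sz' n s.1 ≤ n := pick_le _ _ _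
    unfold placePaired
    split_ifs
    · dsimp only
      omega
    · exact le_rfl
  have h3 : ∀ y ≤ n, ∀ c ≤ n, ∀ s, host sz w y c s = host sz' w y c s := fun y hy c hc s => by
    unfold host
    rw [h (y - 1) (by omega), h c (by omega)]
  unfold place
  dsimp only
  rw [pickPaired_congr hn, pickMixed_congr hn, h1 (pickPaired _ _ _) (pick_le _ _ _),
    h3 (pickMixed _ _ _) (pick_le _ _ _) _ h2,
    trim_congr h _ _ le_rfl]

theorem prepare_congr (h : ∀ i < n + 1, sz i = sz' i) (s : State) :
    prepare sz n s = prepare sz' n s := by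
  have hn : ∀ i < n, sz i = sz' i := fun i hi => h i (by omega)
  unfold prepare
  dsimp only
  simp only [freeOpen_congr hn, pickSmall_congr hn, rebalance_congr hn, place_congr h,
    h n (by omega)]

/-- The first `n` rounds read only the first `n` sizes. Hence the solution for `I` is an
intermediate state of the run on `I ++ [x]`, and migration is a statement about one call of
`arrive`. -/
theorem run_congr (ε : ℝ) (h : ∀ i < n, sz i = sz' i) : run ε sz n = run ε sz' n := by
  induction n with
  | zero => rfl
  | succ n ih =>
    rw [run, run, ih fun i hi => h i (by omega), arrive, arrive, insertUpTo_congr h,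
      prepare_congr h, h n (by omega)]

/-- The online algorithm. -/
def onlineAlg (ε : ℝ) (I : List ℝ) : ℕ → ℕ := (run ε (size I) I.length).1

theorem IsInstance.size_pos {I : List ℝ} (hI : IsInstance I) : ∀ i < I.length, 0 < size I i :=
  fun i hi => by
    rw [size, List.getD_eq_getElem _ _ hi]
    exact (hI _ (List.getElem_mem hi)).1

theorem IsInstance.size_le_one {I : List ℝ} (hI : IsInstance I) : ∀ i < I.length, size I i ≤ 1 :=
  fun i hi => by
    rw [size, List.getD_eq_getElem _ _ hi]
    exact (hI _ (List.getElem_mem hi)).2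

theorem hasCompetitiveRatio_onlineAlg {ε : ℝ} (hε : 0 ≤ ε) (hε' : ε ≤ 1 / 2) :
    HasCompetitiveRatio (onlineAlg ε) (3 / 2 + ε) 3 := fun _ hI =>
  opt_le_of_good hI.size_pos hI.size_le_one hε (run_good hI.size_pos hI.size_le_one hε hε')

theorem hasMigrationFactor_onlineAlg {ε : ℝ} (hε : 0 < ε) (hε' : ε ≤ 1 / 2) :
    HasMigrationFactor (onlineAlg ε) (27 / ε) := fun I x hI => by
  have hlen : (I ++ [x]).length = I.length + 1 := by simp
  have hsz : ∀ i < I.length, size I i = size (I ++ [x]) i := fun i hi => by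
    rw [size, size, List.getD_append _ _ _ _ hi]
  have hx : size (I ++ [x]) I.length = x := by simp [size]
  have h0 := hI.size_pos
  have h1 := hI.size_le_one
  rw [hlen] at h0 h1
  have hs := run_good (n := I.length) (fun i hi => h0 i (by omega)) (fun i hi => h1 i (by omega))
    hε.le hε'
  have hm := (arrive_spec h0 h1 hε.le hε' hs).2
  have e : migrated I (onlineAlg ε I) (onlineAlg ε (I ++ [x])) =
      moved (size (I ++ [x])) I.length (run ε (size (I ++ [x])) I.length).1
        (arrive ε (size (I ++ [x])) I.length (run ε (size (I ++ [x])) I.length)).1 := by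
    unfold migrated moved onlineAlg
    rw [hlen, run_congr ε hsz, sum_filter]
    exact sum_congr rfl fun i hi => by rw [hsz i (mem_range.1 hi)]; rfl
  rw [e]
  refine hm.trans ?_
  have hx0 : 0 < x := hx ▸ h0 I.length (by omega)
  rw [hx, div_mul_eq_mul_div, le_div_iff₀ hε]
  -- An item of size at least `ε` allows migration `27`, and only `8` is needed.
  split_ifs with h <;> linarith

end

noncomputable section

/-! ## Reasoning about programs -/

variable {N : ℕ} {m m1 m2 : Memory} {c d : Program} {b : BoolExpr} {Q R : Memory → Prop}

/-- A bound for the running time of a program all of whose loops take at most `N` rounds, as a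
polynomial in `N`. -/
def Program.time : Program → Polynomial ℕ
  | .skip => 1
  | .setNat _ i e => .C (i.cost + e.cost + 1)
  | .setReal _ i e => .C (i.cost + e.cost + 1)
  | .seq c d => c.time + d.time
  | .ite b c d => .C (b.cost + 1) + (c.time + d.time)
  | .loop b c => (.X + 1) * (.C (b.cost + 1) + c.time)

/-- The program `c`, started with the memory `m`, halts in time with a memory that satisfies
`Q`. -/
def Runs (N : ℕ) (c : Program) (m : Memory) (Q : Memory → Prop) : Prop :=
  ∃ m' t, Exec c m m' t ∧ t ≤ c.time.eval N ∧ Q m'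

theorem Runs.mono (h : Runs N c m Q) (hQ : ∀ m', Q m' → R m') : Runs N c m R := by
  obtain ⟨m', t, h1, h2, h3⟩ := h
  exact ⟨m', t, h1, h2, hQ m' h3⟩

theorem Runs.skip (h : Q m) : Runs N .skip m Q :=
  ⟨m, 1, .skip m, by simp [Program.time], h⟩

theorem Runs.setNat {a : ℕ} {i e : NatExpr} (h : Q (m.writeNat a (i.eval m) (e.eval m))) :
    Runs N (.setNat a i e) m Q :=
  ⟨_, _, .setNat a i e m, by simp [Program.time], h⟩

theorem Runs.setReal {a : ℕ} {i : NatExpr} {e : RealExpr}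
    (h : Q (m.writeReal a (i.eval m) (e.eval m))) : Runs N (.setReal a i e) m Q :=
  ⟨_, _, .setReal a i e m, by simp [Program.time], h⟩

theorem Runs.seq (hc : Runs N c m R) (hd : ∀ m', R m' → Runs N d m' Q) :
    Runs N (.seq c d) m Q := by
  obtain ⟨m', t, h1, h2, h3⟩ := hc
  obtain ⟨m'', u, h4, h5, h6⟩ := hd m' h3
  exact ⟨m'', t + u, .seq h1 h4, by simpa [Program.time] using add_le_add h2 h5, h6⟩

theorem Runs.ite (hc : b.Holds m → Runs N c m Q) (hd : ¬ b.Holds m → Runs N d m Q) :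
    Runs N (.ite b c d) m Q := by
  by_cases hb : b.Holds m
  · obtain ⟨m', t, h1, h2, h3⟩ := hc hb
    refine ⟨m', _, .iteTrue d hb h1, ?_, h3⟩
    simp only [Program.time, Polynomial.eval_add, Polynomial.eval_C]
    omega
  · obtain ⟨m', t, h1, h2, h3⟩ := hd hb
    refine ⟨m', _, .iteFalse c hb h1, ?_, h3⟩
    simp only [Program.time, Polynomial.eval_add, Polynomial.eval_C]
    omega

/-- The register `r`. -/
abbrev reg (r : ℕ) : NatExpr := .get r (.const 0)

/-- The real register `r`. -/
abbrev realReg (r : ℕ) : RealExpr := .get r (.const 0)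

/-- Run `c` with the register `r` equal to `0, 1, …`, up to the value of the register `u`. -/
def forLoop (r u : ℕ) (c : Program) : Program :=
  .seq (.setNat r (.const 0) (.const 0))
    (.loop (.natLe (.add (reg r) (.const 1)) (reg u))
      (.seq c (.setNat r (.const 0) (.add (reg r) (.const 1)))))

attribute [simp] NatExpr.eval RealExpr.eval BoolExpr.Holds

@[simp] theorem writeNat_nat_self (m : Memory) (a i v : ℕ) :
    (m.writeNat a i v).nat a = update (m.nat a) i v := by
  simp [Memory.writeNat]

@[simp] theorem writeNat_nat_of_ne (m : Memory) {a a' : ℕ} (i v : ℕ) (h : a' ≠ a) :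
    (m.writeNat a i v).nat a' = m.nat a' := by
  simp [Memory.writeNat, h]

@[simp] theorem writeNat_real (m : Memory) (a i v : ℕ) : (m.writeNat a i v).real = m.real := rfl

@[simp] theorem writeReal_real_self (m : Memory) (a i : ℕ) (v : ℝ) :
    (m.writeReal a i v).real a = update (m.real a) i v := by
  simp [Memory.writeReal]

@[simp] theorem writeReal_real_of_ne (m : Memory) {a a' : ℕ} (i : ℕ) (v : ℝ) (h : a' ≠ a) :
    (m.writeReal a i v).real a' = m.real a' := by
  simp [Memory.writeReal, h]

@[simp] theorem writeReal_nat (m : Memory) (a i : ℕ) (v : ℝ) : (m.writeReal a i v).nat = m.nat :=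
  rfl

/-- Induction on the number of remaining rounds. The final failing test accounts for the `+ 1` in
`(X + 1)` in the time bound. -/
theorem Runs.loop {Inv : ℕ → Memory → Prop} {B : ℕ}
    (hb : ∀ i ≤ B, ∀ m, Inv i m → (b.Holds m ↔ i < B))
    (hc : ∀ i < B, ∀ m, Inv i m → Runs N c m (Inv (i + 1))) (hB : B ≤ N) (h0 : Inv 0 m) :
    Runs N (.loop b c) m (Inv B) := by
  have key : ∀ j ≤ B, ∀ m, Inv (B - j) m → ∃ m' t, Exec (.loop b c) m m' t ∧
      t ≤ j * (b.cost + 1 + c.time.eval N) + (b.cost + 1) ∧ Inv B m' := by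
    intro j
    induction j with
    | zero =>
      intro _ m hm
      have : ¬ b.Holds m := by simp [hb (B - 0) (by omega) m hm]
      exact ⟨m, _, .loopFalse c this, by omega, hm⟩
    | succ j ih =>
      intro hj m hm
      have hbm : b.Holds m := (hb (B - (j + 1)) (by omega) m hm).2 (by omega)
      obtain ⟨m', t, h1, h2, h3⟩ := hc _ (by omega) m hm
      rw [show B - (j + 1) + 1 = B - j by omega] at h3
      obtain ⟨m'', u, h4, h5, h6⟩ := ih (by omega) m' h3
      refine ⟨m'', _, .loopTrue hbm h1 h4, ?_, h6⟩
      rw [add_mul]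
      omega
  obtain ⟨m', t, h1, h2, h3⟩ := key B le_rfl m (by simpa using h0)
  refine ⟨m', t, h1, h2.trans ?_, h3⟩
  simp only [Program.time, Polynomial.eval_add, Polynomial.eval_C, Polynomial.eval_mul,
    Polynomial.eval_X, Polynomial.eval_one]
  have := Nat.mul_le_mul_right (b.cost + 1 + c.time.eval N) hB
  rw [add_mul, one_mul]
  omega

/-- The hypothesis `hs` makes the invariant insensitive to the counter, which the loop itself
overwrites; the body must preserve the counter. -/
theorem Runs.forLoop {r u B : ℕ} {Inv : ℕ → Memory → Prop} (hB : B ≤ N)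
    (hu : ∀ i m, Inv i m → m.nat u 0 = B)
    (hs : ∀ i m v, Inv i m → Inv i (m.writeNat r 0 v))
    (hc : ∀ i < B, ∀ m, Inv i m → m.nat r 0 = i →
      Runs N c m fun m' => m'.nat r 0 = i ∧ Inv (i + 1) m')
    (h0 : Inv 0 m) (hQ : ∀ m', Inv B m' → Q m') : Runs N (forLoop r u c) m Q := by
  unfold BinCovering.forLoop
  refine Runs.seq (R := fun m => m.nat r 0 = 0 ∧ Inv 0 m)
    (Runs.setNat ⟨by simp, hs _ _ _ h0⟩) fun m1 hm1 => ?_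
  refine (Runs.loop (Inv := fun i m => m.nat r 0 = i ∧ Inv i m) (B := B) ?_ ?_ hB hm1).mono
    fun m' h => hQ m' h.2
  · rintro i hi m ⟨h1, h2⟩
    simp [h1, hu i m h2]
  · rintro i hi m ⟨h1, h2⟩
    refine (hc i hi m h2 h1).seq fun m' h => Runs.setNat ⟨by simp [h.1], ?_⟩
    exact hs _ _ _ h.2

/-- The memories agree on the arrays of natural numbers below `a` and on the arrays of real
numbers below `a'`. -/
structure Same (a a' : ℕ) (m m' : Memory) : Prop where
  nat : ∀ k < a, m'.nat k = m.nat k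
  real : ∀ k < a', m'.real k = m.real k

theorem Same.refl (a a' : ℕ) (m : Memory) : Same a a' m m := ⟨fun _ _ => rfl, fun _ _ => rfl⟩

theorem Same.mono {a a' d d' : ℕ} (h : Same a a' m m1) (hd : d ≤ a) (hd' : d' ≤ a') :
    Same d d' m m1 :=
  ⟨fun k hk => h.nat k (hk.trans_le hd), fun k hk => h.real k (hk.trans_le hd')⟩

theorem Same.trans {a a' : ℕ} (h : Same a a' m m1) (h' : Same a a' m1 m2) : Same a a' m m2 :=
  ⟨fun k hk => (h'.nat k hk).trans (h.nat k hk), fun k hk => (h'.real k hk).trans (h.real k hk)⟩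

theorem Same.writeNat {a a' k : ℕ} (h : Same a a' m m1) (hk : a ≤ k) (i v : ℕ) :
    Same a a' m (m1.writeNat k i v) :=
  ⟨fun j hj => by rw [writeNat_nat_of_ne _ _ _ (by omega), h.nat j hj], h.real⟩

theorem Same.writeReal {a a' k : ℕ} (h : Same a a' m m1) (hk : a' ≤ k) (i : ℕ) (v : ℝ) :
    Same a a' m (m1.writeReal k i v) :=
  ⟨h.nat, fun j hj => by rw [writeReal_real_of_ne _ _ _ (by omega), h.real j hj]⟩

/-! ## The program

Array `0` of natural numbers holds the number of items, array `1` the labels, register `2` the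
fresh label, register `3` the arriving item, register `4` the bound for the loops over the items.
Array `0` of real numbers holds the sizes, array `1` holds `ε`. -/

/-- The size of the item `e`. -/
abbrev sizeAt (e : NatExpr) : RealExpr := .get 0 e

/-- The label of the item `e`. -/
abbrev labelAt (e : NatExpr) : NatExpr := .get 1 e

/-- The item `e` is big. -/
abbrev bigAt (e : NatExpr) : BoolExpr := .realLe .one (.add (sizeAt e) (sizeAt e))

/-- The test for `x < y`. -/
abbrev realLt (x y : RealExpr) : BoolExpr := .not (.realLe y x)

/-- The test for `e = f`. -/
abbrev natEq (e f : NatExpr) : BoolExpr := .and (.natLe e f) (.natLe f e)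

/-- Subtract `1`. -/
abbrev pred (e : NatExpr) : NatExpr := .sub e (.const 1)

/-- Compute the load and the number of big items of the label in register `19`. -/
def sumLabel : Program :=
  -- The only real constant is `1`, so zero is computed as `1 - 1`.
  .seq (.setReal 3 (.const 0) (.sub .one .one)) <|
  .seq (.setNat 21 (.const 0) (.const 0)) <|
  forLoop 20 4 <|
    .ite (natEq (labelAt (reg 20)) (reg 19))
      (.seq (.setReal 3 (.const 0) (.add (realReg 3) (sizeAt (reg 20))))
        (.ite (bigAt (reg 20)) (.setNat 21 (.const 0) (.add (reg 21) (.const 1))) .skip))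
      .skip

theorem runs_sumLabel (hB : m.nat 4 0 ≤ N) : Runs N sumLabel m fun m' => Same 20 3 m m' ∧
    m'.real 3 0 = ld (m.real 0) (m.nat 4 0) (m.nat 1) (m.nat 19 0) ∧
    m'.nat 21 0 = nb (m.real 0) (m.nat 4 0) (m.nat 1) (m.nat 19 0) := by
  unfold sumLabel
  refine Runs.seq (R := fun m' => Same 20 3 m m' ∧ m'.real 3 0 = 0)
    (Runs.setReal ⟨(Same.refl _ _ _).writeReal le_rfl _ _, by simp⟩) fun m1 h1 => ?_
  refine Runs.seq (R := fun m' => Same 20 3 m m' ∧ m'.real 3 0 = 0 ∧ m'.nat 21 0 = 0)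
    (Runs.setNat ⟨h1.1.writeNat (by norm_num) _ _, by simp [h1.2], by simp⟩) fun m1 h1 => ?_
  refine Runs.forLoop (B := m.nat 4 0) (Inv := fun i m' => Same 20 3 m m' ∧
    m'.real 3 0 = binSum (m.real 0) i (m.nat 1) (m.nat 19 0) ∧
    m'.nat 21 0 = binSum (bigInd (m.real 0)) i (m.nat 1) (m.nat 19 0)) hB ?_ ?_ ?_ ?_
    fun m' h => h
  · rintro i m' ⟨h, -⟩
    rw [h.nat 4 (by norm_num)]
  · rintro i m' v ⟨h, h', h''⟩
    exact ⟨h.writeNat le_rfl _ _, by simpa using h', by simpa using h''⟩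
  · rintro i hi m' ⟨hS, h2, h3⟩ h4
    have e1 := hS.nat 1 (by norm_num)
    have e19 := hS.nat 19 (by norm_num)
    have e0 := hS.real 0 (by norm_num)
    have hs : ∀ {M : Type} [AddCommMonoid M] (f : ℕ → M),
        binSum f (i + 1) (m.nat 1) (m.nat 19 0) = binSum f i (m.nat 1) (m.nat 19 0) +
          if m.nat 1 i = m.nat 19 0 then f i else 0 := fun f => sum_range_succ _ _
    rw [hs, hs]
    refine Runs.ite (fun hb => ?_) fun hb => Runs.skip ?_
    · have hb' : m.nat 1 i = m.nat 19 0 := by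
        simp [h4, e1, e19] at hb
        omega
      refine Runs.seq (R := fun m'' => Same 20 3 m m'' ∧ m''.real 3 0 =
          binSum (m.real 0) i (m.nat 1) (m.nat 19 0) + m.real 0 i ∧ m''.nat 21 0 = m'.nat 21 0 ∧
          m''.nat 20 0 = i) (Runs.setReal
        ⟨hS.writeReal le_rfl _ _, by simp [h2, h4, e0], by simp, by simp [h4]⟩) ?_
      rintro m'' ⟨hS', h5, h6, h7⟩
      have e0' := hS'.real 0 (by norm_num)
      rw [if_pos hb', if_pos hb']
      refine Runs.ite (fun hbig => Runs.setNat ?_) fun hbig => Runs.skip ?_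
      · have : Big (m.real 0 i) := by simpa [h7, e0', Big] using hbig
        refine ⟨by simpa using h7, hS'.writeNat (by norm_num) _ _, by simpa using h5, ?_⟩
        simp [h6, h3, bigInd_of_big this]
      · have : ¬ Big (m.real 0 i) := by simpa [h7, e0', Big] using hbig
        exact ⟨h7, hS', h5, by rw [h6, h3, bigInd_of_small this, add_zero]⟩
    · have hb' : m.nat 1 i ≠ m.nat 19 0 := by
        simp [h4, e1, e19] at hb
        omega
      rw [if_neg hb', if_neg hb', add_zero, add_zero]
      exact ⟨h4, hS, h2, h3⟩
  · exact ⟨h1.1, by simpa [binSum] using h1.2.1, by simpa [binSum] using h1.2.2⟩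

/-- For each item, compute the load and the number of big items of its label and run `c`. -/
def scan (c : Program) : Program :=
  forLoop 18 4 (.seq (.setNat 19 (.const 0) (labelAt (reg 18))) (.seq sumLabel c))

/-- Loads refer to the labels at the moment when the item is visited, so the body may change labels
during the scan, as trimming does. -/
theorem runs_scan {B : ℕ} {Inv : ℕ → Memory → Prop} (hB : B ≤ N)
    (hu : ∀ i m, Inv i m → m.nat 4 0 = B)
    (hs : ∀ i m m', Inv i m → Same 18 3 m m' → Inv i m')
    (hc : ∀ i < B, ∀ m, Inv i m → m.nat 18 0 = i →
      m.real 3 0 = ld (m.real 0) B (m.nat 1) (m.nat 1 i) →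
      m.nat 21 0 = nb (m.real 0) B (m.nat 1) (m.nat 1 i) →
      Runs N c m fun m' => m'.nat 18 0 = i ∧ Inv (i + 1) m')
    (h0 : Inv 0 m) : Runs N (scan c) m (Inv B) := by
  refine Runs.forLoop hB hu (fun i m v h => hs i m _ h
    ((Same.refl _ _ _).writeNat le_rfl _ _)) (fun i hi m hm hi' => ?_) h0 fun m h => h
  refine Runs.seq (R := fun m' => m'.nat 19 0 = m.nat 1 i ∧ Same 19 3 m m') (Runs.setNat
    ⟨by simp [hi'], (Same.refl _ _ _).writeNat le_rfl _ _⟩) fun m1 h1 => ?_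
  have hu1 : m1.nat 4 0 = B := by rw [h1.2.nat 4 (by norm_num), hu i m hm]
  refine (runs_sumLabel (hu1.trans_le hB)).seq fun m2 h2 => ?_
  have h3 : Same 19 3 m m2 := h1.2.trans (h2.1.mono (by norm_num) le_rfl)
  refine hc i hi m2 (hs i m m2 hm (h3.mono (by norm_num) le_rfl)) ?_ ?_ ?_
  · rw [h3.nat 18 (by norm_num), hi']
  · rw [h2.2.1, hu1, h1.1, h3.nat 1 (by norm_num), h1.2.nat 1 (by norm_num), h3.real 0 (by norm_num),
      h1.2.real 0 (by norm_num)]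
  · rw [h2.2.2, hu1, h1.1, h3.nat 1 (by norm_num), h1.2.nat 1 (by norm_num), h3.real 0 (by norm_num),
      h1.2.real 0 (by norm_num)]

end

/-! ### States in memory, and the programs for selecting, counting, freeing and trimming. -/

noncomputable section

variable {ε : ℝ} {sz : ℕ → ℝ} {n t B w r i : ℕ} {s : State} {m m' : Memory} {C : BoolExpr}
  {K : RealExpr} {C' : ℕ → Prop} {K' : ℕ → ℝ} {Q : Memory → Prop} {d : Program}

/-- The memory represents the state `s`. Register `5` holds `w`. -/
structure Repr (ε : ℝ) (sz : ℕ → ℝ) (n t B w : ℕ) (s : State) (m : Memory) : Prop where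
  le : B ≤ n
  sizes : m.real 0 = sz
  eps : m.real 1 0 = ε
  num : m.nat 0 0 = n
  labels : m.nat 1 = s.1
  fresh : m.nat 2 0 = s.2
  item : m.nat 3 0 = t
  bound : m.nat 4 0 = B
  small : m.nat 5 0 = w

theorem Repr.same (h : Repr ε sz n t B w s m) (hs : Same 6 2 m m') : Repr ε sz n t B w s m' where
  le := h.le
  sizes := by rw [hs.real 0 (by norm_num), h.sizes]
  eps := by rw [hs.real 1 (by norm_num), h.eps]
  num := by rw [hs.nat 0 (by norm_num), h.num]
  labels := by rw [hs.nat 1 (by norm_num), h.labels]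
  fresh := by rw [hs.nat 2 (by norm_num), h.fresh]
  item := by rw [hs.nat 3 (by norm_num), h.item]
  bound := by rw [hs.nat 4 (by norm_num), h.bound]
  small := by rw [hs.nat 5 (by norm_num), h.small]

theorem Repr.setTemp (h : Repr ε sz n t B w s m) {k : ℕ} (hk : 6 ≤ k) (i v : ℕ) :
    Repr ε sz n t B w s (m.writeNat k i v) :=
  h.same ((Same.refl _ _ _).writeNat hk _ _)

theorem Repr.setLabel (h : Repr ε sz n t B w s m) (i v : ℕ) :
    Repr ε sz n t B w (update s.1 i v, s.2) (m.writeNat 1 i v) :=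
  ⟨h.le, by simp [h.sizes], by simp [h.eps], by simp [h.num], by simp [h.labels],
    by simp [h.fresh], by simp [h.item], by simp [h.bound], by simp [h.small]⟩

theorem Repr.setFresh (h : Repr ε sz n t B w s m) (v : ℕ) :
    Repr ε sz n t B w (s.1, v) (m.writeNat 2 0 v) :=
  ⟨h.le, by simp [h.sizes], by simp [h.eps], by simp [h.num], by simp [h.labels],
    by simp, by simp [h.item], by simp [h.bound], by simp [h.small]⟩

theorem Repr.setItem (h : Repr ε sz n t B w s m) (v : ℕ) :
    Repr ε sz n v B w s (m.writeNat 3 0 v) :=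
  ⟨h.le, by simp [h.sizes], by simp [h.eps], by simp [h.num], by simp [h.labels],
    by simp [h.fresh], by simp, by simp [h.bound], by simp [h.small]⟩

theorem Repr.setBound (h : Repr ε sz n t B w s m) {v : ℕ} (hv : v ≤ n) :
    Repr ε sz n t v w s (m.writeNat 4 0 v) :=
  ⟨hv, by simp [h.sizes], by simp [h.eps], by simp [h.num], by simp [h.labels],
    by simp [h.fresh], by simp [h.item], by simp, by simp [h.small]⟩

theorem Repr.setSmall (h : Repr ε sz n t B w s m) (v : ℕ) :
    Repr ε sz n t B v s (m.writeNat 5 0 v) :=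
  ⟨h.le, by simp [h.sizes], by simp [h.eps], by simp [h.num], by simp [h.labels],
    by simp [h.fresh], by simp [h.item], by simp [h.bound], by simp⟩

theorem Runs.seq_setNat {N a : ℕ} {i e : NatExpr}
    (h : Runs N d (m.writeNat a (i.eval m) (e.eval m)) Q) :
    Runs N (.seq (.setNat a i e) d) m Q :=
  (Runs.setNat (Q := fun m' => Runs N d m' Q) h).seq fun _ h => h

/-- A memory during a scan started with the memory `m`, when it comes to the item `i`. -/
structure Scanning (sz : ℕ → ℝ) (B : ℕ) (P : ℕ → ℕ) (m : Memory) (i : ℕ) (m' : Memory) :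
    Prop where
  nat : ∀ k < 17, m'.nat k = m.nat k
  index : m'.nat 18 0 = i
  sizes : m'.real 0 = sz
  labels : m'.nat 1 = P
  load : m'.real 3 0 = ld sz B P (P i)
  count : m'.nat 21 0 = nb sz B P (P i)

/-- For scans that leave the state alone: their results are carried only by array `17` and real
register `2`, so the invariant speaks of nothing else. -/
theorem runs_scan_result {Inv : ℕ → (ℕ → ℕ) → ℝ → Prop} (hR : Repr ε sz n t B w s m)
    (hc : ∀ i < B, ∀ m', Scanning sz B s.1 m i m' → Inv i (m'.nat 17) (m'.real 2 0) →
      Runs n d m' fun m'' => Same 17 2 m' m'' ∧ m''.nat 18 0 = i ∧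
        Inv (i + 1) (m''.nat 17) (m''.real 2 0))
    (h0 : Inv 0 (m.nat 17) (m.real 2 0)) :
    Runs n (scan d) m fun m' => Same 17 2 m m' ∧ Inv B (m'.nat 17) (m'.real 2 0) := by
  refine runs_scan (Inv := fun i m' => Same 17 2 m m' ∧ Inv i (m'.nat 17) (m'.real 2 0)) hR.le
    ?_ ?_ ?_ ⟨Same.refl _ _ _, h0⟩
  · rintro i m' ⟨h, -⟩
    rw [h.nat 4 (by norm_num), hR.bound]
  · rintro i m1 m2 ⟨h1, h2⟩ h
    refine ⟨h1.trans (h.mono (by norm_num) (by norm_num)), ?_⟩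
    rwa [h.nat 17 (by norm_num), h.real 2 (by norm_num)]
  · rintro i hi m' ⟨h1, h2⟩ h3 h4 h5
    have e0 := h1.real 0 (by norm_num)
    have e1 := h1.nat 1 (by norm_num)
    rw [e0, e1, hR.labels, hR.sizes] at h4 h5
    exact (hc i hi m' ⟨h1.nat, h3, e0.trans hR.sizes, e1.trans hR.labels, h4, h5⟩ h2).mono
      fun m'' h => ⟨h.2.1, h1.trans h.1, h.2.2⟩

/-- The postcondition of a program that writes `v` to the register `r`. -/
def Returns (ε : ℝ) (sz : ℕ → ℝ) (n t B w : ℕ) (s : State) (m : Memory) (r v : ℕ)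
    (m' : Memory) : Prop :=
  Repr ε sz n t B w s m' ∧ m'.nat r 0 = v ∧ ∀ k < 17, k ≠ r → m'.nat k = m.nat k

theorem runs_save (hr : 6 ≤ r) {v : ℕ} (hR : Repr ε sz n t B w s m)
    (hS : Same 17 2 m m') (hv : m'.nat 17 0 = v) :
    Runs n (.setNat r (.const 0) (reg 17)) m' (Returns ε sz n t B w s m r v) :=
  Runs.setNat ⟨(hR.same (hS.mono (by norm_num) le_rfl)).setTemp hr _ _, by simp [hv],
    fun k hk hkr => by rw [writeNat_nat_of_ne _ _ _ hkr, hS.nat k hk]⟩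

/-- Write `pick` for the condition `C` and the key `K` to the register `r`. -/
def pickInto (r : ℕ) (C : BoolExpr) (K : RealExpr) : Program :=
  .seq (.setNat 17 (.const 0) (.const 0)) <| .seq
    (scan (.ite (.and C (.not (.and (.natLe (.const 1) (reg 17)) (.realLe K (realReg 2)))))
      (.seq (.setReal 2 (.const 0) K) (.setNat 17 (.const 0) (.add (reg 18) (.const 1)))) .skip))
    (.setNat r (.const 0) (reg 17))

/-- Real register `2` caches the best key so far. It is meaningless until a candidate has been
found, hence the guarded second half of the invariant. -/
theorem runs_pickInto (hr : 6 ≤ r) (hR : Repr ε sz n t B w s m)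
    (hC : ∀ i < B, ∀ m', Scanning sz B s.1 m i m' → (C.Holds m' ↔ C' i))
    (hK : ∀ i < B, ∀ m', Scanning sz B s.1 m i m' → K.eval m' = K' i) :
    Runs n (pickInto r C K) m (Returns ε sz n t B w s m r (pick C' K' B)) := by
  refine Runs.seq_setNat (Runs.seq (runs_scan_result (Inv := fun i f x => f 0 = pick C' K' i ∧
    (1 ≤ pick C' K' i → x = K' (pick C' K' i - 1))) (hR.setTemp (by norm_num) _ _)
    (fun i hi m' hm ⟨h1, h2⟩ => ?_) ⟨by simp [pick], by simp [pick]⟩) fun m' h =>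
      runs_save hr hR (((Same.refl _ _ _).writeNat (by norm_num) _ _).trans h.1) h.2.1)
  replace hm : Scanning sz B s.1 m i m' :=
    ⟨fun k hk => by rw [hm.nat k hk, writeNat_nat_of_ne _ _ _ (by omega)], hm.2, hm.3, hm.4, hm.5,
      hm.6⟩
  have e1 := hC i hi m' hm
  have e2 := hK i hi m' hm
  have e3 : (¬ (1 ≤ pick C' K' i ∧ K' i ≤ m'.real 2 0)) ↔
      ¬ (1 ≤ pick C' K' i ∧ K' i ≤ K' (pick C' K' i - 1)) :=
    not_congr (and_congr_right fun h => by rw [h2 h])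
  rw [pick]
  refine Runs.ite (fun hb => ?_) fun hb => ?_
  · simp only [BoolExpr.Holds, NatExpr.eval, RealExpr.eval, e1, e2, h1, e3] at hb
    rw [if_pos hb]
    refine (Runs.setReal (Q := fun m'' => Same 17 2 m' m'' ∧ m''.nat 18 0 = i ∧
      m''.real 2 0 = K' i) ⟨(Same.refl _ _ _).writeReal le_rfl _ _, by simpa using hm.index,
        by simp [e2]⟩).seq fun m'' h => Runs.setNat ⟨h.1.writeNat le_rfl _ _, ?_⟩
    simp [h.2.1, h.2.2]
  · simp only [BoolExpr.Holds, NatExpr.eval, RealExpr.eval, e1, e2, h1, e3] at hb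
    rw [if_neg hb]
    exact Runs.skip ⟨Same.refl _ _ _, hm.index, h1, h2⟩

/-- Write the number of items that satisfy `C` to the register `r`. -/
def countInto (r : ℕ) (C : BoolExpr) : Program :=
  .seq (.setNat 17 (.const 0) (.const 0)) <| .seq
    (scan (.ite C (.setNat 17 (.const 0) (.add (reg 17) (.const 1))) .skip))
    (.setNat r (.const 0) (reg 17))

theorem runs_countInto (hr : 6 ≤ r) (hR : Repr ε sz n t B w s m)
    (hC : ∀ i < B, ∀ m', Scanning sz B s.1 m i m' → (C.Holds m' ↔ C' i)) :
    Runs n (countInto r C) m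
      (Returns ε sz n t B w s m r (∑ i ∈ range B, if C' i then 1 else 0)) := by
  refine Runs.seq_setNat (Runs.seq (runs_scan_result
    (Inv := fun i f _ => f 0 = ∑ j ∈ range i, if C' j then 1 else 0)
    (hR.setTemp (by norm_num) _ _) (fun i hi m' hm h1 => ?_) (by simp)) fun m' h =>
      runs_save hr hR (((Same.refl _ _ _).writeNat (by norm_num) _ _).trans h.1) h.2)
  replace hm : Scanning sz B s.1 m i m' :=
    ⟨fun k hk => by rw [hm.nat k hk, writeNat_nat_of_ne _ _ _ (by omega)], hm.2, hm.3, hm.4, hm.5,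
      hm.6⟩
  have e1 := hC i hi m' hm
  rw [sum_range_succ]
  refine Runs.ite (fun hb => Runs.setNat ?_) fun hb => Runs.skip ?_
  · rw [if_pos (e1.1 hb)]
    exact ⟨(Same.refl _ _ _).writeNat le_rfl _ _, by simpa using hm.index, by simp [h1]⟩
  · rw [if_neg fun h => hb (e1.2 h)]
    exact ⟨Same.refl _ _ _, hm.index, h1⟩

/-- The current bin is uncovered. -/
abbrev isOpen : BoolExpr := realLt (realReg 3) .one

/-- The current bin contains two big items. -/
abbrev isPaired : BoolExpr := .natLe (.const 2) (reg 21)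

/-- The program for `pickSingle`, with `e` in register `7`. -/
def pickSingleInto (r : ℕ) : Program :=
  pickInto r (.and (bigAt (reg 18)) (.and isOpen
    (.not (natEq (.add (reg 18) (.const 1)) (reg 7))))) (.sub .one (sizeAt (reg 18)))

theorem runs_pickSingle (hr : 6 ≤ r) (hR : Repr ε sz n t B w s m) {e : ℕ} (he : m.nat 7 0 = e) :
    Runs n (pickSingleInto r) m
      (Returns ε sz n t B w s m r (pickSingle sz B s.1 e)) :=
  runs_pickInto hr hR (fun i _ m' h => by
    simp [h.index, h.sizes, h.load, h.nat 7 (by norm_num), he, Big, le_antisymm_iff])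
    fun i _ m' h => by simp [h.index, h.sizes]

/-- The program for `pickPaired`. -/
def pickPairedInto (r : ℕ) : Program :=
  pickInto r (.and (bigAt (reg 18)) isPaired) (sizeAt (reg 18))

theorem runs_pickPaired (hr : 6 ≤ r) (hR : Repr ε sz n t B w s m) :
    Runs n (pickPairedInto r) m (Returns ε sz n t B w s m r (pickPaired sz B s.1)) :=
  runs_pickInto hr hR (fun i _ m' h => by simp [h.index, h.sizes, h.count, Big])
    fun i _ m' h => by simp [h.index, h.sizes]

/-- The program for `pickMixed`. -/
def pickMixedInto (r : ℕ) : Program :=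
  pickInto r (.and (bigAt (reg 18)) (.and (.natLe (reg 21) (.const 1)) (.realLe .one (realReg 3))))
    (.sub .one (sizeAt (reg 18)))

theorem runs_pickMixed (hr : 6 ≤ r) (hR : Repr ε sz n t B w s m) :
    Runs n (pickMixedInto r) m (Returns ε sz n t B w s m r (pickMixed sz B s.1)) :=
  runs_pickInto hr hR (fun i _ m' h => by simp [h.index, h.sizes, h.count, h.load, Big])
    fun i _ m' h => by simp [h.index, h.sizes]

/-- The program for `pickSmall`. -/
def pickSmallInto (r : ℕ) : Program :=
  pickInto r (.and (.natLe (.const 1) (labelAt (reg 18))) (.and (.natLe (reg 21) (.const 0))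
    (.realLe .one (realReg 3)))) (sizeAt (reg 18))

theorem runs_pickSmall (hr : 6 ≤ r) (hR : Repr ε sz n t B w s m) :
    Runs n (pickSmallInto r) m (Returns ε sz n t B w s m r (pickSmall sz B s.1)) :=
  runs_pickInto hr hR (fun i _ m' h => by
    simp [h.index, h.labels, h.count, h.load, Nat.one_le_iff_ne_zero])
    fun i _ m' h => by simp [h.index, h.sizes]

/-- The program for `pickOpen`. -/
def pickOpenInto (r : ℕ) : Program :=
  pickInto r (.and (.natLe (.const 1) (labelAt (reg 18))) isOpen) (realReg 3)

theorem runs_pickOpen (hr : 6 ≤ r) (hR : Repr ε sz n t B w s m) :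
    Runs n (pickOpenInto r) m (Returns ε sz n t B w s m r (pickOpen sz B s.1)) :=
  runs_pickInto hr hR (fun i _ m' h => by
    simp [h.index, h.labels, h.load, Nat.one_le_iff_ne_zero])
    fun i _ m' h => by simp [h.load]

theorem runs_numSingle (hr : 6 ≤ r) (hR : Repr ε sz n t B w s m) :
    Runs n (countInto r (.and (bigAt (reg 18)) isOpen)) m
      (Returns ε sz n t B w s m r (numSingle sz B s.1)) := by
  convert runs_countInto (C := .and (bigAt (reg 18)) isOpen)
    (C' := fun i => Big (sz i) ∧ ld sz B s.1 (s.1 i) < 1) hr hR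
    fun i _ m' h => by simp [h.index, h.sizes, h.load, Big] using 2
  exact sum_congr rfl fun i _ => by congr

theorem runs_numPaired (hr : 6 ≤ r) (hR : Repr ε sz n t B w s m) :
    Runs n (countInto r (.and (bigAt (reg 18)) isPaired)) m
      (Returns ε sz n t B w s m r (numPaired sz B s.1)) := by
  convert runs_countInto (C := .and (bigAt (reg 18)) isPaired)
    (C' := fun i => Big (sz i) ∧ 2 ≤ nb sz B s.1 (s.1 i)) hr hR
    fun i _ m' h => by simp [h.index, h.sizes, h.count, Big] using 2
  exact sum_congr rfl fun i _ => by congr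

/-- The program for `freeOpen`. -/
def freeOpenProg : Program :=
  -- The new labels are collected in array `17` and copied afterwards, because `freeOpen` refers to
  -- the loads of the old labelling throughout.
  .seq (scan (.ite (.and (.not (bigAt (reg 18))) isOpen) (.setNat 17 (reg 18) (.const 0))
    (.setNat 17 (reg 18) (labelAt (reg 18)))))
    (forLoop 18 4 (.setNat 1 (reg 18) (.get 17 (reg 18))))

theorem runs_freeOpen (hR : Repr ε sz n t B w s m) :
    Runs n freeOpenProg m (Repr ε sz n t B w (freeOpen sz B s.1, s.2)) := by
  refine Runs.seq (runs_scan_result (Inv := fun i f _ => ∀ j < i, f j = freeOpen sz B s.1 j) hR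
    (fun i hi m' hm h1 => ?_) (by simp)) fun m1 ⟨h1, h2⟩ => ?_
  · have hj : ∀ j < i + 1, j = i ∨ (j < i ∧ j ≠ i) := fun j hj => by omega
    refine Runs.ite (fun hb => Runs.setNat ⟨(Same.refl _ _ _).writeNat le_rfl _ _,
      by simpa using hm.index, fun j hji => ?_⟩) fun hb => Runs.setNat
        ⟨(Same.refl _ _ _).writeNat le_rfl _ _, by simpa using hm.index, fun j hji => ?_⟩
    all_goals
      simp only [BoolExpr.Holds, NatExpr.eval, RealExpr.eval, hm.index, hm.sizes, hm.load,
        not_le] at hb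
      rcases hj j hji with rfl | ⟨hj1, hj2⟩
      · simp [hm.index, hm.labels, freeOpen, hi, Big, hb]
      · simp [hm.index, hj2, h1 j hj1]
  · refine Runs.forLoop (Inv := fun i m' => Repr ε sz n t B w
      ((fun j => if j < i then freeOpen sz B s.1 j else s.1 j), s.2) m' ∧ m'.nat 17 = m1.nat 17)
      hR.le ?_ ?_ ?_ ⟨?_, rfl⟩ ?_
    · exact fun i m' h => h.1.bound
    · exact fun i m' v h => ⟨h.1.setTemp (by norm_num) _ _, by simp [h.2]⟩
    · rintro i hi m' ⟨h3, h4⟩ h5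
      refine Runs.setNat ⟨by simpa using h5, ?_, by simp [h4]⟩
      convert h3.setLabel i (freeOpen sz B s.1 i) using 1
      · refine Prod.ext (funext fun j => ?_) rfl
        rcases eq_or_ne j i with rfl | hj
        · simp
        · simp [update_of_ne hj, show j < i + 1 ↔ j < i by omega]
      · simp [h5, h4, h2 i hi]
    · simpa using hR.same (h1.mono (by norm_num) le_rfl)
    · rintro m' ⟨h, -⟩
      convert h using 3 with j
      unfold freeOpen
      by_cases hj : j < B <;> simp [hj]

/-- The program for `trim`, with the label in register `11`. -/
def trimProg : Program :=
  scan (.ite (.and (natEq (labelAt (reg 18)) (reg 11)) (.and (.not (bigAt (reg 18)))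
    (.realLe .one (.sub (realReg 3) (sizeAt (reg 18)))))) (.setNat 1 (reg 18) (.const 0)) .skip)

/-- The scan recomputes the load after each removal, in step with the recursion of `trim`; the test
on the label lets the load of the current item's bin stand for that of register `11`. -/
theorem runs_trim (hR : Repr ε sz n t B w s m) :
    Runs n trimProg m (Repr ε sz n t B w (trim sz B (m.nat 11 0) s.1 B, s.2)) := by
  refine (runs_scan (Inv := fun i m' => Repr ε sz n t B w (trim sz B (m.nat 11 0) s.1 i, s.2) m' ∧
    m'.nat 11 0 = m.nat 11 0) hR.le ?_ ?_ ?_ ⟨hR, rfl⟩).mono fun m' h => h.1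
  · exact fun i m' h => h.1.bound
  · exact fun i m1 m2 h hS => ⟨h.1.same (hS.mono (by norm_num) (by norm_num)),
      by rw [hS.nat 11 (by norm_num), h.2]⟩
  · rintro i hi m' ⟨h1, h2⟩ h3 h4 h5
    rw [h1.sizes, h1.labels] at h4
    have hiff : (trim sz B (m.nat 11 0) s.1 i i ≤ m.nat 11 0 ∧
        m.nat 11 0 ≤ trim sz B (m.nat 11 0) s.1 i i) ∧ ¬ (1 ≤ sz i + sz i) ∧
        1 ≤ ld sz B (trim sz B (m.nat 11 0) s.1 i) (trim sz B (m.nat 11 0) s.1 i i) - sz i ↔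
      trim sz B (m.nat 11 0) s.1 i i = m.nat 11 0 ∧ ¬ Big (sz i) ∧
        1 ≤ ld sz B (trim sz B (m.nat 11 0) s.1 i) (m.nat 11 0) - sz i := by
      rw [← le_antisymm_iff]
      exact and_congr_right fun h => by rw [h]; rfl
    rw [trim]
    refine Runs.ite (fun hb => Runs.setNat ?_) fun hb => Runs.skip ?_
    · simp only [BoolExpr.Holds, NatExpr.eval, RealExpr.eval, h1.labels, h1.sizes, h2, h3, h4,
        hiff] at hb
      rw [if_pos hb]
      refine ⟨by simpa using h3, ?_, by simpa using h2⟩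
      simpa [h3] using h1.setLabel i 0
    · simp only [BoolExpr.Holds, NatExpr.eval, RealExpr.eval, h1.labels, h1.sizes, h2, h3, h4,
        hiff] at hb
      rw [if_neg hb]
      exact ⟨h3, h1, h2⟩

end

/-! ### Programs for the steps of the algorithm. -/

noncomputable section

variable {ε : ℝ} {sz : ℕ → ℝ} {n t B w r i : ℕ} {s : State} {m m' : Memory} {Q : Memory → Prop}

/-- The program for `pairUp`. -/
def pairUpProg : Program :=
  .seq (.setNat 7 (.const 0) (.const 0)) <| .seq (pickSingleInto 8) <|
  .seq (.setNat 7 (.const 0) (reg 8)) <| .seq (pickSingleInto 9) <|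
  .setNat 1 (pred (reg 8)) (labelAt (pred (reg 9)))

theorem runs_pairUp (hR : Repr ε sz n t B w s m) :
    Runs n pairUpProg m (Repr ε sz n t B w (pairUp sz B s.1, s.2)) := by
  refine Runs.seq_setNat ((runs_pickSingle (by norm_num) (hR.setTemp (by norm_num) _ _)
    (e := 0) (by simp)).seq fun m1 ⟨h1, e1, f1⟩ => Runs.seq_setNat
      ((runs_pickSingle (by norm_num) (h1.setTemp (by norm_num) _ _)
        (e := pickSingle sz B s.1 0) (by simp [e1])).seq fun m2 ⟨h2, e2, f2⟩ => Runs.setNat ?_))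
  have e3 : m2.nat 8 0 = pickSingle sz B s.1 0 := by
    rw [f2 8 (by norm_num) (by norm_num), writeNat_nat_of_ne _ _ _ (by norm_num), e1]
  simpa [e2, e3, h2.labels, pairUp] using h2.setLabel (pickSingle sz B s.1 0 - 1)
    (s.1 (pickSingle sz B s.1 (pickSingle sz B s.1 0) - 1))

/-- The program for `breakUp`. -/
def breakUpProg : Program :=
  .seq (pickPairedInto 8) <| .seq (.setNat 1 (pred (reg 8)) (reg 2)) <|
  .seq (.setNat 2 (.const 0) (.add (reg 2) (.const 1))) <| .seq (pickPairedInto 8) <|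
  .seq (.setNat 7 (.const 0) (.const 0)) <| .seq (pickSingleInto 9) <|
  .ite (.and (.natLe (.const 1) (reg 8)) (realLt (sizeAt (pred (reg 9))) (sizeAt (pred (reg 8)))))
    (.seq (.setNat 10 (.const 0) (labelAt (pred (reg 8)))) <|
      .seq (.setNat 1 (pred (reg 8)) (labelAt (pred (reg 9)))) <|
      .setNat 1 (pred (reg 9)) (reg 10))
    .skip

theorem runs_breakUp (hR : Repr ε sz n t B w s m) :
    Runs n breakUpProg m (Repr ε sz n t B w (breakUp sz B s.1 s.2, s.2 + 1)) := by
  refine (runs_pickPaired (by norm_num) hR).seq fun m1 ⟨h1, e1, _⟩ =>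
    Runs.seq_setNat (Runs.seq_setNat ?_)
  have h2 := (h1.setLabel (pickPaired sz B s.1 - 1) s.2).setFresh (s.2 + 1)
  simp only [NatExpr.eval, e1, h1.fresh, writeNat_nat_of_ne, ne_eq, OfNat.ofNat_ne_one,
    not_false_eq_true]
  refine (runs_pickPaired (by norm_num) h2).seq fun m3 ⟨h3, e3, _⟩ => Runs.seq_setNat
    ((runs_pickSingle (by norm_num) (h3.setTemp (by norm_num) _ _) (e := 0) (by simp)).seq
      fun m4 ⟨h4, e4, f4⟩ => ?_)
  have e8 : m4.nat 8 0 = m3.nat 8 0 := by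
    rw [f4 8 (by norm_num) (by norm_num), writeNat_nat_of_ne _ _ _ (by norm_num)]
  rw [e3] at e8
  unfold breakUp exchange
  dsimp only
  refine Runs.ite (fun hb => Runs.seq_setNat (Runs.seq_setNat (Runs.setNat ?_))) fun hb =>
    Runs.skip ?_
  · simp only [BoolExpr.Holds, NatExpr.eval, RealExpr.eval, e8, e4, h4.sizes, not_le] at hb
    rw [if_pos hb]
    have h5 := ((h4.setTemp (k := 10) (by norm_num) 0 (m4.nat 1 (m4.nat 8 0 - 1))).setLabel
      (m4.nat 8 0 - 1) (m4.nat 1 (m4.nat 9 0 - 1))).setLabel (m4.nat 9 0 - 1)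
      (m4.nat 1 (m4.nat 8 0 - 1))
    simpa [e8, e4, h4.labels] using h5
  · simp only [BoolExpr.Holds, NatExpr.eval, RealExpr.eval, e8, e4, h4.sizes, not_le] at hb
    rw [if_neg hb]
    exact h4

/-- The program for `rebalance`. -/
def rebalanceProg : Program :=
  .seq (countInto 8 (.and (bigAt (reg 18)) isPaired)) <|
  .seq (countInto 9 (.and (bigAt (reg 18)) isOpen)) <|
  .ite (.natLe (.add (reg 8) (.const 4)) (.add (reg 9) (reg 9))) pairUpProg <|
  .ite (.natLe (.add (.add (reg 9) (reg 9)) (.const 4)) (reg 8)) breakUpProg .skip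

theorem runs_rebalance (hR : Repr ε sz n t B w s m) :
    Runs n rebalanceProg m (Repr ε sz n t B w (rebalance sz B s)) := by
  refine (runs_numPaired (by norm_num) hR).seq fun m1 ⟨h1, e1, _⟩ =>
    (runs_numSingle (by norm_num) h1).seq fun m2 ⟨h2, e2, f2⟩ => ?_
  rw [← f2 8 (by norm_num) (by norm_num)] at e1
  unfold rebalance
  rw [← e1, ← e2]
  refine Runs.ite (fun hb => ?_) fun hb => Runs.ite (fun hb' => ?_) fun hb' => Runs.skip ?_
  · rw [if_pos (by simpa using hb)]
    exact runs_pairUp h2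
  · rw [if_neg (by simpa using hb), if_pos (by simpa using hb')]
    exact runs_breakUp h2
  · rw [if_neg (by simpa using hb), if_neg (by simpa using hb')]
    exact h2

/-- The program for `place`. -/
def placeProg : Program :=
  -- Both selections are made before any label changes, since `place` evaluates them on the given
  -- state.
  .seq (pickPairedInto 8) <| .seq (pickMixedInto 9) <| .seq (.setNat 10 (.const 0) (reg 3)) <|
  .seq (.ite (.and (.natLe (.const 1) (reg 8)) (realLt (sizeAt (reg 3)) (sizeAt (pred (reg 8)))))
    (.seq (.setNat 1 (reg 3) (labelAt (pred (reg 8)))) (.setNat 10 (.const 0) (pred (reg 8))))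
    .skip) <|
  .seq (.ite (.natLe (.const 1) (reg 5)) (.setNat 11 (.const 0) (labelAt (pred (reg 5)))) <|
    .ite (.and (.natLe (.const 1) (reg 9)) (realLt (sizeAt (pred (reg 9))) (sizeAt (reg 10))))
      (.seq (.setNat 11 (.const 0) (labelAt (pred (reg 9)))) <|
        .seq (.setNat 1 (pred (reg 9)) (reg 2)) <|
        .setNat 2 (.const 0) (.add (reg 2) (.const 1)))
      (.seq (.setNat 11 (.const 0) (reg 2)) (.setNat 2 (.const 0) (.add (reg 2) (.const 1))))) <|
  .seq (.setNat 1 (reg 10) (reg 11)) <|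
  -- From here on the new item counts, so the bound of the scans is raised first.
  .seq (.setNat 4 (.const 0) (.add (reg 3) (.const 1))) trimProg

theorem runs_place (ht : t < n) (hR : Repr ε sz n t t w s m) :
    Runs n placeProg m (Repr ε sz n t (t + 1) w (place sz t w s)) := by
  refine (runs_pickPaired (by norm_num) hR).seq fun m1 ⟨h1, e1, _⟩ =>
    (runs_pickMixed (by norm_num) h1).seq fun m2 ⟨h2, e2, f2⟩ => Runs.seq_setNat ?_
  rw [← f2 8 (by norm_num) (by norm_num)] at e1
  unfold place
  dsimp only
  rw [← e1, ← e2]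
  set q := placePaired sz t (m2.nat 8 0) s.1 with hq
  refine Runs.seq (R := fun m' => Repr ε sz n t t w (q.1, s.2) m' ∧ m'.nat 10 0 = q.2 ∧
    m'.nat 9 0 = m2.nat 9 0) ?_ fun m3 ⟨h3, e3, e3'⟩ => Runs.seq (R := fun m' =>
      Repr ε sz n t t w (host sz w (m2.nat 9 0) q.2 (q.1, s.2)).1 m' ∧ m'.nat 10 0 = q.2 ∧
        m'.nat 11 0 = (host sz w (m2.nat 9 0) q.2 (q.1, s.2)).2) ?_ fun m4 ⟨h4, e4, e4'⟩ => ?_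
  · have h3 := h2.setTemp (k := 10) (by norm_num) 0 (m2.nat 3 0)
    rw [hq]
    unfold placePaired
    refine Runs.ite (fun hb => Runs.seq_setNat (Runs.setNat ?_)) fun hb => Runs.skip ?_
    · simp [h2.sizes, h2.item] at hb
      rw [if_pos hb]
      refine ⟨?_, by simp, by simp⟩
      have := (h3.setLabel t (s.1 (m2.nat 8 0 - 1))).setTemp (k := 10) (by norm_num) 0
        (m2.nat 8 0 - 1)
      simpa [h2.item, h2.labels] using this
    · simp [h2.sizes, h2.item] at hb
      rw [if_neg (by simpa using hb)]
      exact ⟨by simpa using h3, by simp [h2.item], by simp⟩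
  · unfold host
    refine Runs.ite (fun hb => Runs.setNat ?_) fun hb => Runs.ite (fun hb' =>
      Runs.seq_setNat (Runs.seq_setNat (Runs.setNat ?_))) fun hb' => Runs.seq_setNat (Runs.setNat ?_)
    · rw [if_pos (by simpa [h3.small] using hb)]
      exact ⟨h3.setTemp (by norm_num) _ _, by simp [e3], by simp [h3.small, h3.labels]⟩
    · simp [h3.sizes, e3, e3'] at hb'
      rw [if_neg (by simpa [h3.small] using hb), if_pos hb']
      refine ⟨?_, by simp [e3], by simp [e3', h3.labels]⟩
      have := ((h3.setTemp (k := 11) (by norm_num) 0 (q.1 (m2.nat 9 0 - 1))).setLabel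
        (m2.nat 9 0 - 1) s.2).setFresh (s.2 + 1)
      simpa [h3.labels, h3.fresh, e3'] using this
    · simp [h3.sizes, e3, e3'] at hb'
      rw [if_neg (by simpa [h3.small] using hb), if_neg (by simpa using hb')]
      refine ⟨?_, by simp [e3], by simp [h3.fresh]⟩
      have := (h3.setTemp (k := 11) (by norm_num) 0 s.2).setFresh (s.2 + 1)
      simpa [h3.fresh] using this
  · refine Runs.seq_setNat (Runs.seq_setNat ?_)
    have h5 := (h4.setLabel q.2 (host sz w (m2.nat 9 0) q.2 (q.1, s.2)).2).setBound
      (Nat.succ_le_of_lt ht)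
    have h6 := runs_trim h5
    simpa [e4, e4', h4.item] using h6

/-- The program for `prepare`. -/
def prepareProg : Program :=
  .seq (.setNat 4 (.const 0) (reg 3)) <| .seq freeOpenProg <| .seq (pickSmallInto 6) <|
  .seq (.setNat 5 (.const 0) (reg 6)) <|
  .seq (.ite (.natLe (reg 5) (.const 0)) rebalanceProg .skip) <|
  .ite (bigAt (reg 3)) placeProg .skip

theorem runs_prepare (ht : t < n) (hR : Repr ε sz n t B w s m) :
    Runs n prepareProg m fun m' => ∃ B' w', Repr ε sz n t B' w' (prepare sz t s) m' := by
  refine Runs.seq_setNat ((runs_freeOpen (hR.setBound (v := m.nat 3 0)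
    (by rw [hR.item]; omega))).seq fun m1 h1 => (runs_pickSmall (by norm_num) h1).seq
      fun m2 ⟨h2, e2, _⟩ => Runs.seq_setNat ?_)
  have h3 := h2.setSmall (m2.nat 6 0)
  rw [hR.item] at e2 h3
  unfold prepare
  dsimp only
  rw [← e2]
  refine Runs.seq (R := Repr ε sz n t t (m2.nat 6 0) (if m2.nat 6 0 = 0 then
    rebalance sz t (freeOpen sz t s.1, s.2) else (freeOpen sz t s.1, s.2)))
    (Runs.ite (fun hb => ?_) fun hb => Runs.skip ?_)
    fun m4 h4 => Runs.ite (fun hb => ?_) fun hb => Runs.skip ⟨t, m2.nat 6 0, ?_⟩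
  · rw [if_pos (by simpa using hb)]
    exact runs_rebalance h3
  · rw [if_neg (by simpa using hb)]
    exact h3
  · rw [if_pos (by simpa [h4.item, h4.sizes, Big] using hb)]
    exact (runs_place ht h4).mono fun m' h => ⟨_, _, h⟩
  · rw [if_neg (by simpa [h4.item, h4.sizes, Big] using hb)]
    exact h4

/-- The program for `insertUpTo`. -/
def insertProg : Program :=
  forLoop 12 4 <| .ite (.natLe (labelAt (reg 12)) (.const 0))
    (.seq (pickOpenInto 8) <| .ite (.natLe (reg 8) (.const 0))
      (.seq (.setNat 1 (reg 12) (reg 2)) (.setNat 2 (.const 0) (.add (reg 2) (.const 1))))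
      (.setNat 1 (reg 12) (labelAt (pred (reg 8)))))
    .skip

theorem runs_insert (hR : Repr ε sz n t B w s m) :
    Runs n insertProg m (Repr ε sz n t B w (insertUpTo sz B s B)) := by
  refine Runs.forLoop (Inv := fun i => Repr ε sz n t B w (insertUpTo sz B s i)) hR.le
    (fun i m h => h.bound) (fun i m v h => h.setTemp (by norm_num) _ _) (fun i hi m1 h1 hi' => ?_)
    hR fun _ h => h
  rw [insertUpTo]
  generalize insertUpTo sz B s i = s1 at h1
  unfold insertItem
  refine Runs.ite (fun hb => ?_) fun hb => Runs.skip ?_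
  · rw [if_pos (by simpa [hi', h1.labels] using hb)]
    refine (runs_pickOpen (by norm_num) h1).seq fun m2 ⟨h2, e2, f2⟩ => ?_
    have e3 := (congrFun (f2 12 (by norm_num) (by norm_num)) 0).trans hi'
    rw [← e2]
    refine Runs.ite (fun hb' => Runs.seq_setNat (Runs.setNat ⟨by simp [e3], ?_⟩)) fun hb' =>
      Runs.setNat ⟨by simp [e3], ?_⟩
    · rw [if_pos (by simpa using hb')]
      simpa [e3, h2.fresh] using (h2.setLabel i s1.2).setFresh (s1.2 + 1)
    · rw [if_neg (by simpa using hb')]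
      simpa [e3, h2.labels] using h2.setLabel i (s1.1 (m2.nat 8 0 - 1))
  · rw [if_neg (by simpa [hi', h1.labels] using hb)]
    exact ⟨hi', h1⟩

/-- The program for the online algorithm. -/
def mainProg : Program :=
  .seq (.setNat 2 (.const 0) (.const 1)) <| forLoop 3 0 <|
    .seq (.ite (.realLe (realReg 1) (sizeAt (reg 3))) prepareProg .skip) <|
    .seq (.setNat 4 (.const 0) (.add (reg 3) (.const 1))) insertProg

/-- The program replays all arrivals, starting from the fresh label `1`. No loop exceeds `I.length`
rounds, so the time bound depends on the program text only and not on `ε`. -/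
theorem runs_main (ε : ℝ) (I : List ℝ) :
    Runs I.length mainProg (initMemory ε I) fun m => m.nat 1 = onlineAlg ε I := by
  refine Runs.seq_setNat (Runs.forLoop (B := I.length) (Inv := fun i m =>
    ∃ t B w, Repr ε (size I) I.length t B w (run ε (size I) i) m) le_rfl ?_ ?_ ?_ ?_ ?_)
  · rintro i m ⟨t, B, w, h⟩
    exact h.num
  · rintro i m v ⟨t, B, w, h⟩
    exact ⟨_, _, _, h.setItem v⟩
  · rintro i hi m ⟨t, B, w, h⟩ hi'
    obtain rfl : t = i := h.item.symm.trans hi'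
    rw [run, arrive]
    refine Runs.seq (R := fun m' => ∃ B w, Repr ε (size I) I.length t B w
      (if ε ≤ size I t then prepare (size I) t (run ε (size I) t) else run ε (size I) t) m')
      (Runs.ite (fun hb => ?_) fun hb => Runs.skip ⟨B, w, ?_⟩) fun m1 ⟨B', w', h1⟩ =>
        Runs.seq_setNat ?_
    · rw [if_pos (by simpa [h.eps, h.sizes, h.item] using hb)]
      exact runs_prepare hi h
    · rw [if_neg (by simpa [h.eps, h.sizes, h.item] using hb)]
      exact h
    · have h2 := h1.setBound (Nat.succ_le_of_lt hi)
      generalize (if ε ≤ size I t then prepare (size I) t (run ε (size I) t)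
        else run ε (size I) t) = s at h2
      refine (runs_insert (by simpa [h1.item] using h2)).mono
        fun m' h' => ⟨h'.item, _, _, _, h'⟩
  · refine ⟨0, 0, 0, Nat.zero_le _, ?_, ?_, ?_, ?_, ?_, ?_, ?_, ?_⟩ <;>
      simp [initMemory, run, size, funext_iff]
  · rintro m ⟨t, B, w, h⟩
    exact h.labels

theorem implements_onlineAlg (ε : ℝ) :
    Implements mainProg mainProg.time ε (onlineAlg ε) := fun I _ => by
  obtain ⟨m, t, h1, h2, h3⟩ := runs_main ε I
  exact ⟨m, t, h1, h2, fun i _ => congrFun h3 i⟩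

end
end BinCovering

theorem theorem2p2 :
    ∃ (c : BinCovering.Program) (p : Polynomial ℕ), ∀ ε : ℝ, 0 < ε → ε ≤ 1 / 2 →
      ∃ A : List ℝ → ℕ → ℕ,
        BinCovering.Implements c p ε A ∧
        BinCovering.HasCompetitiveRatio A (3 / 2 + ε) 3 ∧
        BinCovering.HasMigrationFactor A (27 / ε) :=
  ⟨BinCovering.mainProg, BinCovering.mainProg.time, fun ε h h' => ⟨BinCovering.onlineAlg ε,
    BinCovering.implements_onlineAlg ε, BinCovering.hasCompetitiveRatio_onlineAlg h.le h',
    BinCovering.hasMigrationFactor_onlineAlg h h'⟩⟩
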